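/- Let $R,\rho_0,\varepsilon_m>0$. Elliptic coordinates $(\rho,\omega)$ in $\mathbb R^2$ are given by $x_1=R\cos\omega\cosh\rho$, $x_2=R\sin\omega\sinh\rho$, and $\Omega$ is the open region bounded by the ellipse $\partial\Omega=\{\rho=\rho_0\}$ ($\rho_0$ is its elliptic radius). Let $z\in\mathbb R^2\setminus\overline\Omega$ have elliptic coordinates $(\rho_z,\omega_z)$ with $\rho_z>\rho_0$, and let $a\in\mathbb R^2\setminus\{0\}$. For $\delta>0$ let $u_\delta:\mathbb R^2\setminus\{z\}\to\mathbb C$ be the solution of $$\nabla\cdot\varepsilon\nabla u=a\cdot\nabla\delta_z\ \text{ in }\mathbb R^2,\qquad u(x)=O(|x|^{-1})\ \text{ as }|x|\to\infty,$$ with $\varepsilon=\kappa_\delta$ in $\Omega$ and $\varepsilon=\varepsilon_m$ in $\mathbb R^2\setminus\overline\Omega$. That is, $u$ is continuous on $\mathbb R^2\setminus\{z\}$ and harmonic in $\Omega$ and in $\mathbb R^2\setminus(\overline\Omega\cup\{z\})$; $u-\varepsilon_m^{-1}a\cdot\nabla\Gamma(\cdot-z)$ extends to a harmonic function near $z$,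 where $\Gamma(x)=\frac1{2\pi}\ln|x|$; $\nabla u$ has limits at $\partial\Omega$ from both sides, and $\varepsilon_m\,\partial_\nu u|_+=\kappa_\delta\,\partial_\nu u|_-$ on $\partial\Omega$; and $u$ satisfies the decay condition. Suppose that either $\kappa_\delta=-\varepsilon_m+i\delta$ for all $\delta>0$ (that is, $\varepsilon_c=-\varepsilon_m$), or $\kappa_\delta$ is normalized so that $$\lambda:=\frac{\kappa_\delta+\varepsilon_m}{2(\kappa_\delta-\varepsilon_m)}=i\delta\quad\text{for all }\delta>0.$$ In both cases $\lambda\to0$, the essential spectrum of the Neumann–Poincaré operator of $\partial\Omega$. Then for every $\delta>0$ the solution $u_\delta$ exists and is unique, $\nabla u_\delta\in L^2(\Omega)$, and as $\delta\to0^+$ $$\|\nabla u_\delta\|_{L^2(\Omega)}^2\sim\begin{cases}\delta^{-3+\rho_z/\rho_0}\,|\log\delta| & \text{if }\rho_0<\rho_z<3\rho_0,\\ |\log\delta|^2 & \text{if }\rho_z=3\rho_0,\\ 1 & \text{if }\rho_z>3\rho_0.\end{cases}$$ Here $f(\delta)\sim g(\delta)$ means that there are constants $C_1,C_2>0$, independent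 of $\delta$, with $C_1<f(\delta)/g(\delta)<C_2$ for all sufficiently small $\delta>0$. Consequently, $E_\delta:=\delta\|\nabla u_\delta\|^2_{L^2(\Omega)}\to\infty$ as $\delta\to0^+$ if and only if $\rho_z\le2\rho_0$, and $E_\delta\to0$ if $\rho_z>2\rho_0$. -/

import Mathlib

open scoped Topology
open Filter

noncomputable section

/-- The Euclidean plane `ℝ²`. -/
abbrev Plane : Type := EuclideanSpace ℝ (Fin 2)

/-- The point with elliptic coordinates `(ρ, ω)`, for ellipses with foci `(± R, 0)`. -/
def ellipticPoint (R ρ ω : ℝ) : Plane :=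
  !₂[R * Real.cos ω * Real.cosh ρ, R * Real.sin ω * Real.sinh ρ]

/-- The open region bounded by the ellipse of elliptic radius `ρ₀`. The value `ρ = 0` gives the
segment between the foci. -/
def ellipseDomain (R ρ₀ : ℝ) : Set Plane :=
  {x | ∃ ρ ω : ℝ, 0 ≤ ρ ∧ ρ < ρ₀ ∧ x = ellipticPoint R ρ ω}

/-- The length `Ξ` of the coordinate vectors `∂x/∂ρ` and `∂x/∂ω`. -/
def scaleFactor (R ρ ω : ℝ) : ℝ :=
  R * Real.sqrt (Real.sinh ρ ^ 2 + Real.sin ω ^ 2)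

/-- The outward unit normal `Ξ⁻¹ ∂x/∂ρ` of the ellipse of elliptic radius `ρ₀`, at the point with
elliptic coordinates `(ρ₀, ω)`. -/
def ellipseNormal (R ρ₀ ω : ℝ) : Plane :=
  (scaleFactor R ρ₀ ω)⁻¹ •
    !₂[R * Real.cos ω * Real.sinh ρ₀, R * Real.sin ω * Real.cosh ρ₀]

/-- The fundamental solution `Γ(x) = (1 / 2π) log |x|` of the Laplacian in the plane. -/
def fundamentalSolution (x : Plane) : ℝ :=
  1 / (2 * Real.pi) * Real.log ‖x‖

/-- The dipole field `x ↦ a · ∇Γ(x - z)`, whose distributional Laplacian is `a · ∇δ_z`. -/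
def dipoleField (a z x : Plane) : ℝ :=
  fderiv ℝ fundamentalSolution (x - z) a

/-- `u` solves `∇ · ε ∇u = a · ∇δ_z` in `ℝ²`, `u(x) = O(|x|⁻¹)` as `|x| → ∞`, where `ε = κ` in the
ellipse of elliptic radius `ρ₀` and `ε = εm` outside its closure, with `z` outside the closure:
`u` is harmonic off the interface and `z`, has the dipole singularity at `z`, and its potential
and its flux `ε ∂u/∂ν` are continuous across the interface. The value `u z` is irrelevant. -/
structure IsDipoleSolution (R ρ₀ : ℝ) (κ : ℂ) (εm : ℝ) (a z : Plane) (u : Plane → ℂ) : Prop where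
  harmonic_inside : InnerProductSpace.HarmonicOnNhd u (ellipseDomain R ρ₀)
  harmonic_outside :
    InnerProductSpace.HarmonicOnNhd u (closure (ellipseDomain R ρ₀) ∪ {z})ᶜ
  source : ∃ w : Plane → ℂ, InnerProductSpace.HarmonicAt w z ∧
    ∀ᶠ x in 𝓝[≠] z, u x = w x + ((dipoleField a z x / εm : ℝ) : ℂ)
  continuous_potential : ContinuousOn u {z}ᶜ
  continuous_flux : ∀ ω : ℝ, ∃ gIn gOut : Plane →L[ℝ] ℂ,
    Tendsto (fderiv ℝ u) (𝓝[ellipseDomain R ρ₀] (ellipticPoint R ρ₀ ω)) (𝓝 gIn) ∧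
    Tendsto (fderiv ℝ u) (𝓝[(closure (ellipseDomain R ρ₀))ᶜ] (ellipticPoint R ρ₀ ω))
      (𝓝 gOut) ∧
    (εm : ℂ) * gOut (ellipseNormal R ρ₀ ω) = κ * gIn (ellipseNormal R ρ₀ ω)
  decay : u =O[Bornology.cobounded Plane] fun x => ‖x‖⁻¹

/-- The spectral parameter `λ = (κ + εm) / (2 (κ - εm))` of the Neumann–Poincaré equation
associated with the permittivity `κ` of the inclusion and `εm` of the matrix. -/
def spectralParameter (κ : ℂ) (εm : ℝ) : ℂ :=
  (κ + εm) / (2 * (κ - εm))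

/-- The squared length `|∇u(x)|²` of the gradient of a complex valued function. -/
def gradSq (u : Plane → ℂ) (x : Plane) : ℝ :=
  ∑ i : Fin 2, ‖fderiv ℝ u x (EuclideanSpace.single i 1)‖ ^ 2

/-- The squared norm `‖∇u‖²` in `L²(Ω)`. -/
def gradL2Sq (Ω : Set Plane) (u : Plane → ℂ) : ℝ :=
  ∫ x in Ω, gradSq u x

/-- `f(δ) ∼ g(δ)` as `δ → 0+`: the quotient stays between two positive constants. -/
def Comparable (f g : ℝ → ℝ) : Prop :=
  ∃ C₁ C₂ : ℝ, 0 < C₁ ∧ ∀ᶠ δ in 𝓝[>] (0 : ℝ), C₁ < f δ / g δ ∧ f δ / g δ < C₂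

end

/-! The map `w = R cosh ζ`, `ζ = ρ + iω`, is conformal. Harmonic functions of `w` become harmonic
functions of `ζ` that are even and `2πi`-periodic, the interface becomes the line `Re ζ = ρ₀`, the
conormal derivative becomes `∂/∂ρ` up to a common factor, and the Dirichlet integral is invariant.
The problem therefore splits into Fourier modes.

Existence. Inside the ellipse the field is a series in `cosh (nζ)` and `cosh (n conj ζ)`; the
scattered field outside is a series in `e^{-nζ}` and `e^{-n conj ζ}`. Both transmission conditions
are encoded in one identity, `2 εm U(ζ) = (εm + κ) V(ζ) + (εm - κ) V(2ρ₀ - conj ζ)`, where the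
reflection fixes the interface (`reflection_identity`). Matching coefficients is a 2 × 2 system per
mode, whose determinant is the product of `εm + κ ± (εm - κ) e^{-2nρ₀}`; it does not vanish for
nonreal `κ`.

Uniqueness. The difference of two solutions has no singularity. Its inner modes are odd in `n`
because it is even in `ζ`, decay removes the growing outer modes, and for nonreal `κ` the flux
condition forces the remaining modes to vanish (`eq_zero_of_transmission`).

Asymptotics. Parseval turns the energy into a series (`IsDipoleSolution.energy`). The squared dipole
coefficients are a constant times `e^{-2nρz}`, and under either normalization of `κ` both
determinant factors are comparable with `δ + q^n`, `q = e^{-2ρ₀}` (`exists_norm_den_bounds`). So the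
energy is comparable with `∑ n r^n / (δ + q^n)²`, `r = e^{-2(ρz - ρ₀)}`. Cut at the `N` with `q^N ≈
δ`, so `N` is of order `|log δ|`. Below the cut the terms behave like `n (r/q²)^n` with `r/q² =
e^{-2(ρz - 3ρ₀)}`; above it they decay geometrically and add at most a multiple of the size at the
cut. The sum is thus of order `N (r/q²)^N`, `N²` or `1` according to whether `ρz` is below, at or
above `3ρ₀`. Multiplying by `δ` moves the threshold for blow-up to `2ρ₀`. -/

open ComplexConjugate InnerProductSpace MeasureTheory

/-! ### The plane as ℂ, and holomorphic derivatives of harmonic functions. -/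

/-- The linear isometry `(x₁, x₂) ↦ x₁ + i x₂` from the plane to the complex numbers. -/
noncomputable def planeToComplex : Plane ≃ₗᵢ[ℝ] ℂ := Complex.orthonormalBasisOneI.repr.symm

theorem planeToComplex_apply (x : Plane) : planeToComplex x = x 0 + x 1 * Complex.I := by
  rw [planeToComplex, ← Complex.orthonormalBasisOneI.sum_repr_symm]
  simp

theorem planeToComplex_vec (p q : ℝ) : planeToComplex !₂[p, q] = p + q * Complex.I := by
  simp [planeToComplex_apply]

section Isometry

variable {E E' F : Type*} [NormedAddCommGroup E] [InnerProductSpace ℝ E] [FiniteDimensional ℝ E]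
  [NormedAddCommGroup E'] [InnerProductSpace ℝ E'] [FiniteDimensional ℝ E']
  [NormedAddCommGroup F] [NormedSpace ℝ F]

/-- The Laplacian is a trace of second derivatives over any orthonormal basis, and `J` carries one
orthonormal basis to another. -/
theorem laplacian_comp_linearIsometryEquiv (J : E ≃ₗᵢ[ℝ] E') (f : E' → F) (x : E) :
    Laplacian.laplacian (f ∘ J) x = Laplacian.laplacian f (J x) := by
  rw [laplacian_eq_iteratedFDeriv_orthonormalBasis _ (stdOrthonormalBasis ℝ E),
    laplacian_eq_iteratedFDeriv_orthonormalBasis _ ((stdOrthonormalBasis ℝ E).map J)]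
  have h := J.toContinuousLinearEquiv.iteratedFDerivWithin_comp_right f
    (s := Set.univ) uniqueDiffOn_univ (x := x) (Set.mem_univ _) 2
  simp only [Set.preimage_univ, iteratedFDerivWithin_univ] at h
  have h' : iteratedFDeriv ℝ 2 (f ∘ J) x = _ := h
  simp only [h']
  refine Finset.sum_congr rfl fun i _ => ?_
  rw [ContinuousMultilinearMap.compContinuousLinearMap_apply]
  congr 1
  ext k
  fin_cases k <;> simp

theorem HarmonicAt.comp_linearIsometryEquiv (J : E ≃ₗᵢ[ℝ] E') {f : E' → F} {x : E}
    (h : HarmonicAt f (J x)) : HarmonicAt (f ∘ J) x := by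
  refine ⟨h.1.comp x J.contDiff.contDiffAt, ?_⟩
  have := J.continuous.continuousAt.eventually h.2
  filter_upwards [this] with y hy
  rw [laplacian_comp_linearIsometryEquiv, hy]
  rfl

end Isometry

/-- Twice the complex derivative `∂u/∂w`. -/
noncomputable def complexPartial (u : ℂ → ℂ) (z : ℂ) : ℂ :=
  fderiv ℝ u z 1 - Complex.I * fderiv ℝ u z Complex.I

/-- `∂u` is complex linear in `u`, so it suffices to treat the real and imaginary parts, for which
`∂` of a real harmonic function is holomorphic. -/
theorem HarmonicAt.differentiableAt_complexPartial {u : ℂ → ℂ} {z : ℂ} (h : HarmonicAt u z) :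
    DifferentiableAt ℂ (complexPartial u) z := by
  have hr : HarmonicAt (fun w => (u w).re) z := h.comp_CLM Complex.reCLM
  have hi : HarmonicAt (fun w => (u w).im) z := h.comp_CLM Complex.imCLM
  have hd := (HarmonicAt.differentiableAt_complex_partial hr).add
    ((HarmonicAt.differentiableAt_complex_partial hi).const_mul Complex.I)
  refine hd.congr_of_eventuallyEq ?_
  filter_upwards [h.eventually] with w hw
  have hu : DifferentiableAt ℝ u w := hw.1.differentiableAt (by norm_num)
  have h1 : fderiv ℝ (fun w => (u w).re) w = Complex.reCLM.comp (fderiv ℝ u w) :=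
    (Complex.reCLM.hasFDerivAt.comp w hu.hasFDerivAt).fderiv
  have h2 : fderiv ℝ (fun w => (u w).im) w = Complex.imCLM.comp (fderiv ℝ u w) :=
    (Complex.imCLM.hasFDerivAt.comp w hu.hasFDerivAt).fderiv
  simp only [complexPartial, Pi.add_apply, h1, h2]
  apply Complex.ext
  · simp
  · simp
    ring

/-- The combination annihilates the antiholomorphic part of the real derivative, so what is left is
complex linear in `h`. This is the chain rule for `∂` under a holomorphic substitution. -/
theorem fderiv_apply_eq_complexPartial (u : ℂ → ℂ) (z h : ℂ) :
    fderiv ℝ u z h - Complex.I * fderiv ℝ u z (Complex.I * h) = complexPartial u z * h := by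
  have e : ∀ k : ℂ, fderiv ℝ u z k =
      k.re * fderiv ℝ u z 1 + k.im * fderiv ℝ u z Complex.I := fun k => by
    conv_lhs => rw [show k = k.re • (1 : ℂ) + k.im • Complex.I by
      apply Complex.ext <;> simp]
    rw [map_add, map_smul, map_smul]
    simp
  rw [e h, e (Complex.I * h), complexPartial]
  conv_rhs => rw [← Complex.re_add_im h]
  simp only [Complex.mul_re, Complex.I_re, Complex.I_im, Complex.mul_im, zero_mul, one_mul,
    zero_sub, zero_add, Complex.ofReal_neg]
  ring_nf
  simp only [Complex.I_sq]
  ring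

theorem DifferentiableOn.harmonicOnNhd {f : ℂ → ℂ} {s : Set ℂ} (h : DifferentiableOn ℂ f s)
    (hs : IsOpen s) : HarmonicOnNhd f s :=
  fun _ hz => (h.analyticAt (hs.mem_nhds hz)).harmonicAt

theorem DifferentiableOn.harmonicOnNhd_conj {f : ℂ → ℂ} {s : Set ℂ} (h : DifferentiableOn ℂ f s)
    (hs : IsOpen s) : HarmonicOnNhd (fun z => conj (f z)) s :=
  fun _ hz => (h.analyticAt (hs.mem_nhds hz)).harmonicAt_conj

/-! ### Elliptic coordinates and confocal ellipses. -/

/-- The map `ζ = ρ + i ω ↦ R cosh ζ` from elliptic coordinates to the complex plane. -/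
noncomputable def ellipticMap (R : ℝ) (ζ : ℂ) : ℂ := R * Complex.cosh ζ

/-- The sum of the distances to the foci `± R`. -/
noncomputable def focalSum (R : ℝ) (w : ℂ) : ℝ := ‖w - R‖ + ‖w + R‖

theorem planeToComplex_ellipticPoint (R ρ ω : ℝ) :
    planeToComplex (ellipticPoint R ρ ω) = ellipticMap R (ρ + ω * Complex.I) := by
  rw [ellipticPoint, planeToComplex_vec, ellipticMap, Complex.cosh_add, Complex.cosh_mul_I,
    Complex.sinh_mul_I]
  push_cast
  ring

theorem hasDerivAt_ellipticMap (R : ℝ) (ζ : ℂ) :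
    HasDerivAt (ellipticMap R) (R * Complex.sinh ζ) ζ :=
  (Complex.hasDerivAt_cosh ζ).const_mul _

theorem differentiable_ellipticMap (R : ℝ) : Differentiable ℂ (ellipticMap R) :=
  fun ζ => (hasDerivAt_ellipticMap R ζ).differentiableAt

theorem continuous_ellipticMap (R : ℝ) : Continuous (ellipticMap R) :=
  (differentiable_ellipticMap R).continuous

theorem ellipticMap_neg (R : ℝ) (ζ : ℂ) : ellipticMap R (-ζ) = ellipticMap R ζ := by
  simp [ellipticMap]

theorem continuous_focalSum (R : ℝ) : Continuous (focalSum R) := by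
  unfold focalSum
  fun_prop

theorem norm_cosh_sub_one (ζ : ℂ) : ‖Complex.cosh ζ - 1‖ = Real.cosh ζ.re - Real.cos ζ.im := by
  have h : 0 ≤ Real.cosh ζ.re - Real.cos ζ.im := by
    linarith [Real.one_le_cosh ζ.re, Real.cos_le_one ζ.im]
  have hre : (Complex.cosh ζ).re = Real.cosh ζ.re * Real.cos ζ.im := by
    conv_lhs => rw [← Complex.re_add_im ζ, Complex.cosh_add, Complex.cosh_mul_I, Complex.sinh_mul_I]
    simp [← Complex.ofReal_cosh, ← Complex.ofReal_sinh, ← Complex.ofReal_cos, ← Complex.ofReal_sin]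
  have him : (Complex.cosh ζ).im = Real.sinh ζ.re * Real.sin ζ.im := by
    conv_lhs => rw [← Complex.re_add_im ζ, Complex.cosh_add, Complex.cosh_mul_I, Complex.sinh_mul_I]
    simp [← Complex.ofReal_cosh, ← Complex.ofReal_sinh, ← Complex.ofReal_cos, ← Complex.ofReal_sin]
  rw [← sq_eq_sq₀ (norm_nonneg _) h, ← Complex.normSq_eq_norm_sq, Complex.normSq_apply]
  simp only [Complex.sub_re, Complex.sub_im, Complex.one_re, Complex.one_im, hre, him]
  linear_combination (Real.sin ζ.im ^ 2) * (-(Real.cosh_sq ζ.re)) +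
    (Real.cosh ζ.re ^ 2 - 1) * Real.sin_sq_add_cos_sq ζ.im

theorem norm_cosh_add_one (ζ : ℂ) : ‖Complex.cosh ζ + 1‖ = Real.cosh ζ.re + Real.cos ζ.im := by
  have h := norm_cosh_sub_one (ζ + Real.pi * Complex.I)
  rw [Complex.cosh_add, Complex.cosh_mul_I, Complex.sinh_mul_I, ← Complex.ofReal_cos,
    ← Complex.ofReal_sin, Real.cos_pi, Real.sin_pi] at h
  rw [show Complex.cosh ζ * ((-1 : ℝ) : ℂ) + Complex.sinh ζ * (((0 : ℝ) : ℂ) * Complex.I) - 1 =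
    -(Complex.cosh ζ + 1) by push_cast; ring, norm_neg] at h
  simpa using h

/-- This is the focal definition of the ellipse. It describes all regions by a continuous function
of `w`, so openness, closures and membership need no choice of coordinates. -/
theorem focalSum_ellipticMap {R : ℝ} (hR : 0 < R) (ζ : ℂ) :
    focalSum R (ellipticMap R ζ) = 2 * R * Real.cosh ζ.re := by
  have h1 : ellipticMap R ζ - R = R * (Complex.cosh ζ - 1) := by rw [ellipticMap]; ring
  have h2 : ellipticMap R ζ + R = R * (Complex.cosh ζ + 1) := by rw [ellipticMap]; ring
  rw [focalSum, h1, h2, norm_mul, norm_mul, norm_cosh_sub_one, norm_cosh_add_one,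
    Complex.norm_real, Real.norm_of_nonneg hR.le]
  ring

theorem exists_ellipticMap_eq {R : ℝ} (hR : 0 < R) (w : ℂ) :
    ∃ ζ : ℂ, 0 ≤ ζ.re ∧ ζ.im ∈ Set.Ioc (-Real.pi) Real.pi ∧ ellipticMap R ζ = w := by
  obtain ⟨x, hx⟩ := Complex.cos_surjective (w / R)
  have hR' : (R : ℂ) ≠ 0 := by exact_mod_cast hR.ne'
  have h1 : ∃ ζ : ℂ, 0 ≤ ζ.re ∧ ellipticMap R ζ = w := by
    have h : ellipticMap R (x * Complex.I) = w := by
      rw [ellipticMap, Complex.cosh_mul_I, hx]; field_simp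
    rcases le_total 0 (x * Complex.I).re with h0 | h0
    · exact ⟨_, h0, h⟩
    · exact ⟨-(x * Complex.I), by simpa using h0, by rw [ellipticMap_neg, h]⟩
  obtain ⟨ζ, h0, hζ⟩ := h1
  refine ⟨ζ.re + toIocMod Real.two_pi_pos (-Real.pi) ζ.im * Complex.I, by simpa using h0, ?_, ?_⟩
  · have := toIocMod_mem_Ioc Real.two_pi_pos (-Real.pi) ζ.im
    simp only [Complex.add_im, Complex.ofReal_im, Complex.mul_im, Complex.ofReal_re, Complex.I_im,
      mul_one, Complex.I_re, mul_zero, add_zero, zero_add]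
    rwa [show -Real.pi + 2 * Real.pi = Real.pi by ring] at this
  · rw [← hζ, ellipticMap, ellipticMap]
    congr 1
    rw [toIocMod, ← Complex.cos_mul_I, ← Complex.cos_mul_I, Complex.cos_eq_cos_iff]
    refine ⟨-toIocDiv Real.two_pi_pos (-Real.pi) ζ.im, Or.inl ?_⟩
    conv_lhs => rw [← Complex.re_add_im ζ]
    simp only [zsmul_eq_mul]
    push_cast
    linear_combination ((toIocDiv Real.two_pi_pos (-Real.pi) ζ.im : ℂ) * (2 * Real.pi)) * Complex.I_sq

theorem ellipticMap_injOn {R : ℝ} (hR : 0 < R) :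
    Set.InjOn (ellipticMap R) {ζ | 0 < ζ.re ∧ ζ.im ∈ Set.Ioo (-Real.pi) Real.pi} := by
  rintro ζ ⟨h1, h2, h3⟩ ξ ⟨h4, h5, h6⟩ h
  have hR' : (R : ℂ) ≠ 0 := by exact_mod_cast hR.ne'
  have h' := mul_left_cancel₀ hR' h
  rw [← Complex.cos_mul_I, ← Complex.cos_mul_I, Complex.cos_eq_cos_iff] at h'
  obtain ⟨k, hk | hk⟩ := h'
  · have hre := congrArg Complex.re hk
    have him := congrArg Complex.im hk
    simp at hre him
    have hk0 : k = 0 := by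
      have hπ := Real.pi_pos
      have a1 : (k : ℝ) < 1 := by
        by_contra hc
        push Not at hc
        nlinarith
      have a2 : (-1 : ℝ) < k := by
        by_contra hc
        push Not at hc
        nlinarith
      have b1 : k < 1 := by exact_mod_cast a1
      have b2 : -1 < k := by exact_mod_cast a2
      omega
    subst hk0
    simp at hre
    apply Complex.ext <;> linarith
  · have him := congrArg Complex.im hk
    simp at him
    linarith

theorem focalSum_ellipticMap_lt {R : ℝ} (hR : 0 < R) {ρ : ℝ} (hρ : 0 ≤ ρ) (ζ : ℂ) :
    focalSum R (ellipticMap R ζ) < 2 * R * Real.cosh ρ ↔ |ζ.re| < ρ := by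
  rw [focalSum_ellipticMap hR, mul_lt_mul_iff_right₀ (by positivity), Real.cosh_lt_cosh,
    abs_of_nonneg hρ]

theorem focalSum_ellipticMap_le {R : ℝ} (hR : 0 < R) {ρ : ℝ} (hρ : 0 ≤ ρ) (ζ : ℂ) :
    focalSum R (ellipticMap R ζ) ≤ 2 * R * Real.cosh ρ ↔ |ζ.re| ≤ ρ := by
  rw [focalSum_ellipticMap hR, mul_le_mul_iff_right₀ (by positivity), Real.cosh_le_cosh,
    abs_of_nonneg hρ]

/-- The open region bounded by the ellipse of elliptic radius `ρ`, in the complex plane. -/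
def complexEllipse (R ρ : ℝ) : Set ℂ := {w | focalSum R w < 2 * R * Real.cosh ρ}

theorem isOpen_complexEllipse (R ρ : ℝ) : IsOpen (complexEllipse R ρ) :=
  isOpen_lt (continuous_focalSum R) continuous_const

theorem ellipticMap_mem_complexEllipse {R : ℝ} (hR : 0 < R) {ρ : ℝ} (hρ : 0 ≤ ρ) {ζ : ℂ} :
    ellipticMap R ζ ∈ complexEllipse R ρ ↔ |ζ.re| < ρ :=
  focalSum_ellipticMap_lt hR hρ ζ

theorem closure_complexEllipse {R : ℝ} (hR : 0 < R) {ρ : ℝ} (hρ : 0 < ρ) :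
    closure (complexEllipse R ρ) = {w | focalSum R w ≤ 2 * R * Real.cosh ρ} := by
  apply Set.Subset.antisymm
  · exact closure_minimal (fun w (hw : focalSum R w < 2 * R * Real.cosh ρ) => show focalSum R w ≤ _ from hw.le)
      (isClosed_le (continuous_focalSum R) continuous_const)
  · intro w hw
    obtain ⟨ζ, h0, -, rfl⟩ := exists_ellipticMap_eq hR w
    have h1 : |ζ.re| ≤ ρ := (focalSum_ellipticMap_le hR hρ.le ζ).1 hw
    rw [abs_of_nonneg h0] at h1
    -- A point of the closed ellipse is approached from inside along `t ζ` with `t → 1` from below,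
    -- since this shrinks the elliptic radius.
    have ht : Tendsto (fun t : ℝ => ellipticMap R (t * ζ)) (𝓝[<] 1)
        (𝓝 (ellipticMap R ((1 : ℝ) * ζ))) := by
      have : Continuous fun t : ℝ => ellipticMap R (t * ζ) :=
        (continuous_ellipticMap R).comp (by fun_prop)
      exact this.continuousAt.tendsto.mono_left nhdsWithin_le_nhds
    rw [Complex.ofReal_one, one_mul] at ht
    refine mem_closure_of_tendsto ht ?_
    filter_upwards [Ioo_mem_nhdsLT (show (0 : ℝ) < 1 by norm_num)] with t ht
    rw [ellipticMap_mem_complexEllipse hR hρ.le]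
    simp only [Complex.mul_re, Complex.ofReal_re, Complex.ofReal_im, zero_mul, sub_zero]
    rw [abs_of_nonneg (mul_nonneg ht.1.le h0)]
    rcases h0.eq_or_lt with h | h
    · rw [← h]; simpa using hρ
    · nlinarith [ht.2]

theorem ellipticMap_mem_closure_complexEllipse {R : ℝ} (hR : 0 < R) {ρ : ℝ} (hρ : 0 < ρ) {ζ : ℂ} :
    ellipticMap R ζ ∈ closure (complexEllipse R ρ) ↔ |ζ.re| ≤ ρ := by
  rw [closure_complexEllipse hR hρ]
  exact focalSum_ellipticMap_le hR hρ.le ζ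

theorem ellipseDomain_eq_preimage {R : ℝ} (hR : 0 < R) {ρ₀ : ℝ} (hρ : 0 < ρ₀) :
    ellipseDomain R ρ₀ = planeToComplex ⁻¹' complexEllipse R ρ₀ := by
  ext x
  simp only [ellipseDomain, Set.mem_ofPred_eq, Set.mem_preimage]
  constructor
  · rintro ⟨ρ, ω, h0, h1, rfl⟩
    rw [planeToComplex_ellipticPoint, ellipticMap_mem_complexEllipse hR hρ.le]
    simpa [abs_of_nonneg h0] using h1
  · intro h
    obtain ⟨ζ, h0, -, hζ⟩ := exists_ellipticMap_eq hR (planeToComplex x)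
    rw [← hζ, ellipticMap_mem_complexEllipse hR hρ.le, abs_of_nonneg h0] at h
    refine ⟨ζ.re, ζ.im, h0, h, ?_⟩
    apply planeToComplex.injective
    rw [planeToComplex_ellipticPoint, Complex.re_add_im, hζ]

theorem isOpen_ellipseDomain {R : ℝ} (hR : 0 < R) {ρ₀ : ℝ} (hρ : 0 < ρ₀) :
    IsOpen (ellipseDomain R ρ₀) := by
  rw [ellipseDomain_eq_preimage hR hρ]
  exact (isOpen_complexEllipse R ρ₀).preimage planeToComplex.continuous

theorem closure_ellipseDomain {R : ℝ} (hR : 0 < R) {ρ₀ : ℝ} (hρ : 0 < ρ₀) :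
    closure (ellipseDomain R ρ₀) = planeToComplex ⁻¹' closure (complexEllipse R ρ₀) := by
  rw [ellipseDomain_eq_preimage hR hρ]
  exact (planeToComplex.toHomeomorph.preimage_closure _).symm

theorem isCompact_closure_complexEllipse {R : ℝ} (hR : 0 < R) {ρ : ℝ} (hρ : 0 < ρ) :
    IsCompact (closure (complexEllipse R ρ)) := by
  refine Metric.isCompact_of_isClosed_isBounded isClosed_closure ?_
  rw [closure_complexEllipse hR hρ]
  refine (Metric.isBounded_closedBall (x := (0 : ℂ)) (r := 2 * R * Real.cosh ρ + R)).subset ?_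
  intro w hw
  simp only [Set.mem_ofPred_eq, focalSum] at hw
  rw [mem_closedBall_zero_iff]
  have h1 : ‖w‖ ≤ ‖w - R‖ + ‖(R : ℂ)‖ := by simpa using norm_add_le (w - R) (R : ℂ)
  rw [Complex.norm_real, Real.norm_of_nonneg hR.le] at h1
  linarith [norm_nonneg (w + R)]

theorem planeToComplex_ellipseNormal {R : ℝ} (ρ₀ ω : ℝ) :
    planeToComplex (ellipseNormal R ρ₀ ω) =
      (scaleFactor R ρ₀ ω)⁻¹ • (R * Complex.sinh (ρ₀ + ω * Complex.I)) := by
  rw [ellipseNormal, map_smul, planeToComplex_vec, Complex.sinh_add, Complex.cosh_mul_I,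
    Complex.sinh_mul_I]
  congr 1
  push_cast
  ring

theorem scaleFactor_pos {R : ℝ} (hR : 0 < R) {ρ₀ : ℝ} (hρ : 0 < ρ₀) (ω : ℝ) :
    0 < scaleFactor R ρ₀ ω := by
  have := Real.sinh_pos_iff.2 hρ
  unfold scaleFactor
  positivity

/-! ### Fourier modes along vertical segments. -/

/-- The unnormalized `n`-th Fourier coefficient of `F` on the vertical segment of abscissa `ρ`. -/
noncomputable def modeCoeff (F : ℂ → ℂ) (n : ℤ) (ρ : ℝ) : ℂ :=
  ∫ ω in (-Real.pi)..Real.pi, F (ρ + ω * Complex.I) * Complex.exp (-(n * (ω * Complex.I)))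

theorem modeCoeff_eq_fourierCoeffOn (F : ℂ → ℂ) (n : ℤ) (ρ : ℝ) :
    fourierCoeffOn (neg_lt_self Real.pi_pos) (fun ω : ℝ => F (ρ + ω * Complex.I)) n =
      (1 / (2 * Real.pi) : ℝ) • modeCoeff F n ρ := by
  rw [fourierCoeffOn_eq_integral, modeCoeff]
  congr 1
  · ring
  · refine intervalIntegral.integral_congr fun ω _ => ?_
    simp only [fourier_coe_apply, smul_eq_mul]
    rw [mul_comm]
    congr 2
    have hπ : (Real.pi : ℂ) ≠ 0 := by exact_mod_cast Real.pi_ne_zero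
    push_cast
    field_simp
    ring

theorem hasSum_modeCoeff_sq {F : ℂ → ℂ} {ρ : ℝ}
    (hF : Continuous fun ω : ℝ => F (ρ + ω * Complex.I)) :
    HasSum (fun n : ℤ => ‖modeCoeff F n ρ‖ ^ 2)
      (2 * Real.pi * ∫ ω in (-Real.pi)..Real.pi, ‖F (ρ + ω * Complex.I)‖ ^ 2) := by
  have hmem : MemLp (fun ω : ℝ => F (ρ + ω * Complex.I)) 2
      (volume.restrict (Set.Ioc (-Real.pi) Real.pi)) := by
    obtain ⟨M, hM⟩ := isCompact_Icc.exists_bound_of_continuousOn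
      (hF.continuousOn (s := Set.Icc (-Real.pi) Real.pi))
    refine MemLp.of_bound hF.aestronglyMeasurable M ?_
    filter_upwards [ae_restrict_mem measurableSet_Ioc] with ω hω
    exact hM ω (Set.Ioc_subset_Icc_self hω)
  have h := (hasSum_sq_fourierCoeffOn (neg_lt_self Real.pi_pos) hmem).mul_left
    ((2 * Real.pi) ^ 2)
  simp only [modeCoeff_eq_fourierCoeffOn] at h
  have hπ := Real.pi_pos
  have e1 : ∀ n : ℤ, (2 * Real.pi) ^ 2 * ‖(1 / (2 * Real.pi)) • modeCoeff F n ρ‖ ^ 2 =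
      ‖modeCoeff F n ρ‖ ^ 2 := fun n => by
    rw [norm_smul, Real.norm_of_nonneg (by positivity)]
    field_simp
  have e2 : ∀ x : ℝ, (2 * Real.pi) ^ 2 * (Real.pi - -Real.pi)⁻¹ • x = 2 * Real.pi * x := fun x => by
    rw [smul_eq_mul, show Real.pi - -Real.pi = 2 * Real.pi by ring]
    field_simp
  simpa only [e1, e2] using h

/-- By Parseval the mean square vanishes, and a continuous function with vanishing mean square is
zero on the closed period. -/
theorem eq_zero_of_modeCoeff_eq_zero {F : ℂ → ℂ} {ρ : ℝ}
    (hF : Continuous fun ω : ℝ => F (ρ + ω * Complex.I))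
    (h0 : ∀ n : ℤ, modeCoeff F n ρ = 0) {ω : ℝ} (hω : ω ∈ Set.Icc (-Real.pi) Real.pi) :
    F (ρ + ω * Complex.I) = 0 := by
  by_contra hne
  have hpos := intervalIntegral.integral_pos (neg_lt_self Real.pi_pos)
    (f := fun ω : ℝ => ‖F (ρ + ω * Complex.I)‖ ^ 2) (hF.norm.pow 2).continuousOn
    (fun _ _ => by positivity) ⟨ω, hω, by positivity⟩
  have h := hasSum_modeCoeff_sq hF
  simp only [h0, norm_zero, ne_eq, OfNat.ofNat_ne_zero, not_false_eq_true, zero_pow] at h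
  have := h.unique hasSum_zero
  have hπ := Real.pi_pos
  have h2 : 0 < 2 * Real.pi * ∫ ω in (-Real.pi)..Real.pi, ‖F (ρ + ω * Complex.I)‖ ^ 2 := by
    positivity
  linarith

theorem modeCoeff_neg (F : ℂ → ℂ) (n : ℤ) (ρ : ℝ) :
    modeCoeff (fun ζ => F (-ζ)) n ρ = modeCoeff F (-n) (-ρ) := by
  have h := intervalIntegral.integral_comp_neg (a := -Real.pi) (b := Real.pi)
    (fun ω : ℝ => F (((-ρ : ℝ) : ℂ) + ω * Complex.I) *
      Complex.exp (-(((-n : ℤ) : ℂ) * (ω * Complex.I))))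
  rw [neg_neg] at h
  rw [modeCoeff, modeCoeff, ← h]
  refine intervalIntegral.integral_congr fun ω _ => ?_
  congr 2
  · push_cast; ring
  · push_cast; ring

theorem modeCoeff_conj (F : ℂ → ℂ) (n : ℤ) (ρ : ℝ) :
    modeCoeff (fun ζ => conj (F ζ)) n ρ = conj (modeCoeff F (-n) ρ) := by
  rw [modeCoeff, modeCoeff, ← intervalIntegral.intervalIntegral_conj]
  refine intervalIntegral.integral_congr fun ω _ => ?_
  simp only [map_mul, ← Complex.exp_conj]
  congr 2
  simp

/-- The Fourier modes of a holomorphic function of period `2 π i` on a vertical strip. -/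
theorem exists_modeCoeff_eq_of_differentiableOn {s : Set ℝ} (hs : s.OrdConnected) {H : ℂ → ℂ}
    (hH : DifferentiableOn ℂ H {ζ | ζ.re ∈ s})
    (hper : ∀ ζ, H (ζ + 2 * Real.pi * Complex.I) = H ζ) (n : ℤ) :
    ∃ C : ℂ, ∀ ρ ∈ s, modeCoeff H n ρ = C * Complex.exp (n * ρ) := by
  rcases s.eq_empty_or_nonempty with rfl | ⟨ρ₁, h₁⟩
  · exact ⟨0, by simp⟩
  refine ⟨modeCoeff H n ρ₁ * Complex.exp (-(n * ρ₁)), fun ρ hρ => ?_⟩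
  -- `G` is holomorphic and `2πi`-periodic, so the horizontal sides cancel in Cauchy's theorem on a
  -- rectangle of height `2π`; its integral over the vertical side does not depend on `ρ`.
  set G : ℂ → ℂ := fun ζ => H ζ * Complex.exp (-(n * ζ)) with hG
  have hGper : ∀ ζ, G (ζ + 2 * Real.pi * Complex.I) = G ζ := fun ζ => by
    have : Complex.exp (-(n * (ζ + 2 * Real.pi * Complex.I))) = Complex.exp (-(n * ζ)) := by
      rw [Complex.exp_eq_exp_iff_exists_int]
      exact ⟨-n, by push_cast; ring⟩
    simp only [hG, hper, this]
  have hmode : ∀ t : ℝ, ∫ ω in (-Real.pi)..Real.pi, G (t + ω * Complex.I) =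
      modeCoeff H n t * Complex.exp (-(n * t)) := fun t => by
    rw [modeCoeff, ← intervalIntegral.integral_mul_const]
    refine intervalIntegral.integral_congr fun ω _ => ?_
    simp only [hG]
    rw [mul_assoc, ← Complex.exp_add]
    congr 2
    ring
  have hrect := Complex.integral_boundary_rect_eq_zero_of_differentiableOn G
    (⟨ρ₁, -Real.pi⟩ : ℂ) (⟨ρ, Real.pi⟩ : ℂ) ?_
  · simp only at hrect
    have hbt : ∫ x in ρ₁..ρ, G (x + ((-Real.pi : ℝ) : ℂ) * Complex.I) =
        ∫ x in ρ₁..ρ, G (x + (Real.pi : ℂ) * Complex.I) := by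
      refine intervalIntegral.integral_congr fun x _ => ?_
      rw [← hGper]
      congr 1
      push_cast
      ring
    rw [hbt, sub_self, zero_add, ← smul_sub, smul_eq_zero_iff_right Complex.I_ne_zero, hmode, hmode,
      sub_eq_zero] at hrect
    rw [← hrect, mul_assoc, ← Complex.exp_add]
    simp
  · refine DifferentiableOn.mono
      (hH.fun_mul (Differentiable.differentiableOn (f := fun ζ => Complex.exp (-(n * ζ))) (by fun_prop))) fun ζ hζ => ?_
    exact hs.uIcc_subset h₁ hρ hζ.1

/-- The Fourier modes of a derivative along vertical lines. -/
theorem modeCoeff_of_hasDerivAt {V Q : ℂ → ℂ} {ρ : ℝ} (n : ℤ)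
    (hV : ∀ ω : ℝ, HasDerivAt (fun ω : ℝ => V (ρ + ω * Complex.I)) (Q (ρ + ω * Complex.I)) ω)
    (hQ : Continuous fun ω : ℝ => Q (ρ + ω * Complex.I))
    (hper : ∀ ζ, V (ζ + 2 * Real.pi * Complex.I) = V ζ) :
    modeCoeff Q n ρ = Complex.I * n * modeCoeff V n ρ := by
  have hE : ∀ ω : ℝ, HasDerivAt (fun ω : ℝ => Complex.exp (-(n * (ω * Complex.I))))
      (-(Complex.I * n) * Complex.exp (-(n * (ω * Complex.I)))) ω := fun ω => by
    have h1 : HasDerivAt (fun ω : ℝ => -((n : ℂ) * ((ω : ℂ) * Complex.I))) (-(n * (1 * Complex.I))) ω :=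
      ((Complex.ofRealCLM.hasDerivAt (x := ω)).mul_const Complex.I |>.const_mul (n : ℂ)).neg
    convert h1.cexp using 1
    ring
  have hcE : Continuous fun ω : ℝ => Complex.exp (-(n * (ω * Complex.I))) := by fun_prop
  have hVc : Continuous fun ω : ℝ => V (ρ + ω * Complex.I) :=
    continuous_iff_continuousAt.2 fun ω => (hV ω).continuousAt
  have h := intervalIntegral.integral_mul_deriv_eq_deriv_mul
    (u := fun ω : ℝ => Complex.exp (-(n * (ω * Complex.I)))) (v := fun ω : ℝ => V (ρ + ω * Complex.I))
    (a := -Real.pi) (b := Real.pi)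
    (fun ω _ => hE ω) (fun ω _ => hV ω) (by
      refine Continuous.intervalIntegrable ?_ _ _
      fun_prop) (hQ.intervalIntegrable _ _)
  have hbd : Complex.exp (-(n * ((Real.pi : ℂ) * Complex.I))) * V (ρ + Real.pi * Complex.I) -
      Complex.exp (-(n * (((-Real.pi : ℝ) : ℂ) * Complex.I))) * V (ρ + ((-Real.pi : ℝ) : ℂ) * Complex.I) = 0 := by
    have e1 : V (ρ + Real.pi * Complex.I) = V (ρ + ((-Real.pi : ℝ) : ℂ) * Complex.I) := by
      rw [← hper (ρ + ((-Real.pi : ℝ) : ℂ) * Complex.I)]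
      congr 1
      push_cast
      ring
    have e2 : Complex.exp (-(n * ((Real.pi : ℂ) * Complex.I))) =
        Complex.exp (-(n * (((-Real.pi : ℝ) : ℂ) * Complex.I))) := by
      rw [Complex.exp_eq_exp_iff_exists_int]
      exact ⟨-n, by push_cast; ring⟩
    rw [e1, e2, sub_self]
  rw [hbd, zero_sub] at h
  rw [modeCoeff, modeCoeff, ← intervalIntegral.integral_const_mul]
  simp only [mul_comm (Q _)]
  rw [h, ← intervalIntegral.integral_neg]
  refine intervalIntegral.integral_congr fun ω _ => ?_
  ring

theorem continuous_modeCoeff {V : ℂ → ℂ} (hV : Continuous V) (n : ℤ) :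
    Continuous (modeCoeff V n) := by
  unfold modeCoeff
  refine intervalIntegral.continuous_parametric_intervalIntegral_of_continuous' ?_ _ _
  unfold Function.uncurry
  fun_prop

/-- If a function that is continuous on a vertical strip has limits along a vertical boundary line,
then its Fourier modes converge to those of the limit. -/
theorem tendsto_modeCoeff {s k : Set ℝ} {F L : ℂ → ℂ} {ρ₀ : ℝ} (hk : IsCompact k)
    (hks : k ⊆ insert ρ₀ s) (hkn : k ∈ 𝓝[s] ρ₀) (hcl : ρ₀ ∈ closure s)
    (hF : ContinuousOn F {ζ | ζ.re ∈ s})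
    (hL : ∀ ω : ℝ, Tendsto F (𝓝[{ζ | ζ.re ∈ s}] (ρ₀ + ω * Complex.I)) (𝓝 (L (ρ₀ + ω * Complex.I))))
    (n : ℤ) : Tendsto (modeCoeff F n) (𝓝[s] ρ₀) (𝓝 (modeCoeff L n ρ₀)) := by
  set A : Set ℂ := {ζ | ζ.re ∈ s} with hA
  have hline : ∀ ω : ℝ, Tendsto (fun ρ : ℝ => (ρ + ω * Complex.I : ℂ)) (𝓝[s] ρ₀)
      (𝓝[A] (ρ₀ + ω * Complex.I)) := fun ω => by
    refine tendsto_nhdsWithin_iff.2 ⟨?_, ?_⟩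
    · have : Continuous fun ρ : ℝ => (ρ + ω * Complex.I : ℂ) := by fun_prop
      exact this.continuousAt.tendsto.mono_left nhdsWithin_le_nhds
    · filter_upwards [self_mem_nhdsWithin] with ρ hρ
      simpa [hA] using hρ
  have hcA : ∀ ω : ℝ, (ρ₀ + ω * Complex.I : ℂ) ∈ closure A := fun ω => by
    have hne : (𝓝[s] ρ₀).NeBot := mem_closure_iff_nhdsWithin_neBot.1 hcl
    exact mem_closure_iff_nhdsWithin_neBot.2 (hne.map _ |>.mono (hline ω))
  -- The extension by limits is continuous up to the boundary line, hence bounded on the compact set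
  -- `k × [-π, π]`. This bound dominates the integrands near `ρ₀`.
  have hext : ContinuousOn (extendFrom A F) {ζ | ζ.re ∈ insert ρ₀ s} := by
    refine continuousOn_extendFrom ?_ ?_
    · rintro ζ (h | h)
      · rw [← Complex.re_add_im ζ, h]
        exact hcA _
      · exact subset_closure h
    · rintro ζ (h | h)
      · rw [← Complex.re_add_im ζ, h]
        exact ⟨_, hL _⟩
      · exact ⟨_, hF ζ h⟩
  have hK : IsCompact ((fun p : ℝ × ℝ => (p.1 + p.2 * Complex.I : ℂ)) ''
      (k ×ˢ Set.Icc (-Real.pi) Real.pi)) :=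
    (hk.prod isCompact_Icc).image (by fun_prop)
  obtain ⟨M, hM⟩ := hK.exists_bound_of_continuousOn (hext.mono (by
    rintro _ ⟨p, hp, rfl⟩
    simpa using hks hp.1))
  have hE : ∀ ω : ℝ, ‖Complex.exp (-(n * (ω * Complex.I)))‖ = 1 := fun ω => by
    rw [show -((n : ℂ) * (ω * Complex.I)) = ((-(n * ω) : ℝ) : ℂ) * Complex.I by push_cast; ring]
    exact Complex.norm_exp_ofReal_mul_I _
  refine intervalIntegral.tendsto_integral_filter_of_dominated_convergence (fun _ => M) ?_ ?_
    (by simp) ?_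
  · filter_upwards [self_mem_nhdsWithin] with ρ hρ
    refine (Continuous.aestronglyMeasurable ?_)
    refine Continuous.mul ?_ (by fun_prop)
    exact hF.comp_continuous (by fun_prop) fun ω =>
      show (ρ + ω * Complex.I : ℂ).re ∈ s by simpa using hρ
  · filter_upwards [self_mem_nhdsWithin, hkn] with ρ hρ hρk
    refine Eventually.of_forall fun ω hω => ?_
    rw [norm_mul, hE, mul_one, ← extendFrom_extends hF (ρ + ω * Complex.I) (show (ρ + ω * Complex.I : ℂ).re ∈ s by simpa using hρ)]
    refine hM _ ⟨(ρ, ω), ⟨hρk, ?_⟩, rfl⟩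
    rw [Set.uIoc_of_le (by linarith [Real.pi_pos])] at hω
    exact Set.Ioc_subset_Icc_self hω
  · exact Eventually.of_forall fun ω _ => ((hL ω).comp (hline ω)).mul_const _

/-! ### Modes of a harmonic function in elliptic coordinates. -/

/-- The derivative of `D` in the elliptic coordinates `ζ`, in the direction `h`. -/
noncomputable def ellipticDeriv (R : ℝ) (D : ℂ → ℂ) (h ζ : ℂ) : ℂ :=
  fderiv ℝ D (ellipticMap R ζ) (h * (R * Complex.sinh ζ))

theorem ellipticMap_add_two_pi (R : ℝ) (ζ : ℂ) :
    ellipticMap R (ζ + 2 * Real.pi * Complex.I) = ellipticMap R ζ := by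
  simp [ellipticMap, Complex.cosh_add, Complex.cosh_mul_I, Complex.sinh_mul_I]

theorem sinh_add_two_pi (ζ : ℂ) :
    Complex.sinh (ζ + 2 * Real.pi * Complex.I) = Complex.sinh ζ := by
  simp [Complex.sinh_add, Complex.cosh_mul_I, Complex.sinh_mul_I]

theorem ellipticDeriv_neg (R : ℝ) (D : ℂ → ℂ) (h ζ : ℂ) :
    ellipticDeriv R D h (-ζ) = -ellipticDeriv R D h ζ := by
  simp [ellipticDeriv, ellipticMap_neg, Complex.sinh_neg]

theorem ellipticDeriv_conj (R : ℝ) (D : ℂ → ℂ) (h ζ : ℂ) :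
    ellipticDeriv R (fun w => conj (D w)) h ζ = conj (ellipticDeriv R D h ζ) := by
  have := Complex.conjCLE.comp_fderiv (f := D) (x := ellipticMap R ζ)
  have h' : fderiv ℝ (fun w => conj (D w)) (ellipticMap R ζ) = _ := this
  rw [ellipticDeriv, h']
  rfl

theorem hasFDerivAt_comp_ellipticMap {R : ℝ} {D : ℂ → ℂ} {ζ : ℂ}
    (hD : DifferentiableAt ℝ D (ellipticMap R ζ)) :
    HasFDerivAt (fun ζ => D (ellipticMap R ζ))
      ((fderiv ℝ D (ellipticMap R ζ)).comp
        ((ContinuousLinearMap.toSpanSingleton ℂ (R * Complex.sinh ζ)).restrictScalars ℝ)) ζ :=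
  hD.hasFDerivAt.comp ζ ((hasDerivAt_ellipticMap R ζ).hasFDerivAt.restrictScalars ℝ)

theorem hasDerivAt_comp_ellipticMap {R : ℝ} {D : ℂ → ℂ} {γ : ℝ → ℂ} {γ' : ℂ} {t : ℝ}
    (hD : DifferentiableAt ℝ D (ellipticMap R (γ t))) (hγ : HasDerivAt γ γ' t) :
    HasDerivAt (fun t => D (ellipticMap R (γ t))) (ellipticDeriv R D γ' (γ t)) t :=
  (hasFDerivAt_comp_ellipticMap hD).comp_hasDerivAt t hγ

section Strip

variable {R : ℝ} {D : ℂ → ℂ} {U : Set ℂ} {s : Set ℝ}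

theorem continuousOn_ellipticDeriv (hD : HarmonicOnNhd D U)
    (hsU : ∀ ζ : ℂ, ζ.re ∈ s → ellipticMap R ζ ∈ U) (h : ℂ) :
    ContinuousOn (ellipticDeriv R D h) {ζ | ζ.re ∈ s} := by
  intro ζ hζ
  have h1 : ContinuousAt (fderiv ℝ D) (ellipticMap R ζ) :=
    ((hD _ (hsU ζ hζ)).1.fderiv_right (m := 1) (by norm_num)).continuousAt
  have h2 : ContinuousAt (fun ζ => fderiv ℝ D (ellipticMap R ζ)) ζ :=
    ContinuousAt.comp (f := ellipticMap R) h1 (continuous_ellipticMap R).continuousAt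
  refine ContinuousAt.continuousWithinAt ?_
  refine ContinuousAt.clm_apply h2 ?_
  fun_prop

theorem continuous_ellipticDeriv_line (hD : HarmonicOnNhd D U)
    (hsU : ∀ ζ : ℂ, ζ.re ∈ s → ellipticMap R ζ ∈ U) (h : ℂ) {ρ : ℝ} (hρ : ρ ∈ s) :
    Continuous fun ω : ℝ => ellipticDeriv R D h (ρ + ω * Complex.I) :=
  (continuousOn_ellipticDeriv hD hsU h).comp_continuous (by fun_prop) fun ω =>
    show (ρ + ω * Complex.I : ℂ).re ∈ s by simpa using hρ

/-- The function is `∂_ρ - i ∂_ω` of `D ∘ ellipticMap R`, which by the chain rule is the holomorphic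
`complexPartial D` at `R cosh ζ` times `R sinh ζ`. Cauchy's theorem then determines its modes. -/
theorem differentiableOn_ellipticDeriv_sub (hD : HarmonicOnNhd D U)
    (hsU : ∀ ζ : ℂ, ζ.re ∈ s → ellipticMap R ζ ∈ U) :
    DifferentiableOn ℂ (fun ζ => ellipticDeriv R D 1 ζ - Complex.I * ellipticDeriv R D Complex.I ζ)
      {ζ | ζ.re ∈ s} := by
  intro ζ hζ
  simp only [ellipticDeriv, one_mul, fderiv_apply_eq_complexPartial]
  refine DifferentiableAt.differentiableWithinAt ?_
  refine DifferentiableAt.mul ?_ (by fun_prop)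
  exact DifferentiableAt.comp (f := ellipticMap R) ζ
    (HarmonicAt.differentiableAt_complexPartial (hD _ (hsU ζ hζ))) (differentiable_ellipticMap R ζ)

theorem ellipticDeriv_add_two_pi (R : ℝ) (D : ℂ → ℂ) (h ζ : ℂ) :
    ellipticDeriv R D h (ζ + 2 * Real.pi * Complex.I) = ellipticDeriv R D h ζ := by
  rw [ellipticDeriv, ellipticMap_add_two_pi, sinh_add_two_pi, ellipticDeriv]

theorem modeCoeff_add_mul {P Q : ℂ → ℂ} {ρ : ℝ} (c : ℂ) (n : ℤ)
    (hP : Continuous fun ω : ℝ => P (ρ + ω * Complex.I))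
    (hQ : Continuous fun ω : ℝ => Q (ρ + ω * Complex.I)) :
    modeCoeff (fun ζ => P ζ + c * Q ζ) n ρ = modeCoeff P n ρ + c * modeCoeff Q n ρ := by
  rw [modeCoeff, modeCoeff, modeCoeff, ← intervalIntegral.integral_const_mul,
    ← intervalIntegral.integral_add]
  · refine intervalIntegral.integral_congr fun ω _ => ?_
    ring
  · exact (hP.mul (by fun_prop)).intervalIntegrable _ _
  · exact ((hQ.mul (by fun_prop)).const_mul c).intervalIntegrable _ _

theorem modeCoeff_ellipticDeriv_I (hD : HarmonicOnNhd D U)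
    (hsU : ∀ ζ : ℂ, ζ.re ∈ s → ellipticMap R ζ ∈ U) (n : ℤ) {ρ : ℝ} (hρ : ρ ∈ s) :
    modeCoeff (ellipticDeriv R D Complex.I) n ρ =
      Complex.I * n * modeCoeff (fun ζ => D (ellipticMap R ζ)) n ρ := by
  refine modeCoeff_of_hasDerivAt n (fun ω => ?_)
    (continuous_ellipticDeriv_line hD hsU Complex.I hρ) (by simp [ellipticMap_add_two_pi])
  have hγ : HasDerivAt (fun ω : ℝ => (ρ + ω * Complex.I : ℂ)) Complex.I ω := by
    simpa using ((Complex.ofRealCLM.hasDerivAt (x := ω)).mul_const Complex.I).const_add (ρ : ℂ)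
  exact hasDerivAt_comp_ellipticMap (γ := fun ω : ℝ => (ρ + ω * Complex.I : ℂ))
    ((hD _ (hsU _ (by simpa using hρ))).1.differentiableAt (by norm_num)) hγ

/-- The Fourier modes of a harmonic function in elliptic coordinates. -/
theorem exists_modeCoeff_of_harmonicOnNhd (hD : HarmonicOnNhd D U) (hs : s.OrdConnected)
    (hsU : ∀ ζ : ℂ, ζ.re ∈ s → ellipticMap R ζ ∈ U) (n : ℤ) :
    ∃ C C' : ℂ, ∀ ρ ∈ s,
      modeCoeff (ellipticDeriv R D 1) n ρ + n * modeCoeff (fun ζ => D (ellipticMap R ζ)) n ρ =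
        C * Complex.exp (n * ρ) ∧
      modeCoeff (ellipticDeriv R D 1) n ρ - n * modeCoeff (fun ζ => D (ellipticMap R ζ)) n ρ =
        C' * Complex.exp (-(n * ρ)) := by
  have hDc : HarmonicOnNhd (fun w => conj (D w)) U :=
    hD.comp_CLM (Complex.conjCLE : ℂ →L[ℝ] ℂ)
  obtain ⟨C, hC⟩ := exists_modeCoeff_eq_of_differentiableOn hs
    (differentiableOn_ellipticDeriv_sub hD hsU) (by simp [ellipticDeriv_add_two_pi]) n
  -- `∂_ρ + i ∂_ω` of `D` is the conjugate of `∂_ρ - i ∂_ω` of `conj D`. Conjugation reverses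
  -- frequencies, so the holomorphic case is applied to `conj D` at `-n`.
  obtain ⟨C', hC'⟩ := exists_modeCoeff_eq_of_differentiableOn hs
    (differentiableOn_ellipticDeriv_sub hDc hsU) (by simp [ellipticDeriv_add_two_pi]) (-n)
  refine ⟨C, conj C', fun ρ hρ => ?_⟩
  have hP := continuous_ellipticDeriv_line hD hsU 1 hρ
  have hQ := continuous_ellipticDeriv_line hD hsU Complex.I hρ
  have hparts := modeCoeff_ellipticDeriv_I hD hsU n hρ
  constructor
  · rw [← hC ρ hρ]
    have := modeCoeff_add_mul (-Complex.I) n hP hQ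
    simp only [neg_mul, ← sub_eq_add_neg] at this
    rw [this, hparts]
    linear_combination ((n : ℂ) * modeCoeff (fun ζ => D (ellipticMap R ζ)) n ρ) * Complex.I_sq
  · have h1 := hC' ρ hρ
    have h2 := modeCoeff_conj
      (fun ζ => ellipticDeriv R D 1 ζ + Complex.I * ellipticDeriv R D Complex.I ζ) (-n) ρ
    simp only [map_add, map_mul, Complex.conj_I, neg_mul, ← sub_eq_add_neg, neg_neg] at h2
    simp only [ellipticDeriv_conj] at h1
    rw [h2, modeCoeff_add_mul _ _ hP hQ, hparts] at h1
    have h3 := congrArg conj h1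
    rw [Complex.conj_conj, map_mul, ← Complex.exp_conj] at h3
    have h4 : conj (((-n : ℤ) : ℂ) * (ρ : ℂ)) = -(n * ρ) := by simp
    rw [h4] at h3
    rw [← h3]
    linear_combination (-(n : ℂ) * modeCoeff (fun ζ => D (ellipticMap R ζ)) n ρ) * Complex.I_sq

/-- A harmonic function is constant where all Fourier modes of its gradient vanish. -/
theorem eq_of_modeCoeff_eq_zero (hD : HarmonicOnNhd D U) (hs : s.OrdConnected) (hso : IsOpen s)
    (hsU : ∀ ζ : ℂ, ζ.re ∈ s → ellipticMap R ζ ∈ U)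
    (h0 : ∀ n : ℤ, ∀ ρ ∈ s,
      modeCoeff (ellipticDeriv R D 1) n ρ = 0 ∧
      n * modeCoeff (fun ζ => D (ellipticMap R ζ)) n ρ = 0) {ζ ξ : ℂ} (hζ : ζ.re ∈ s)
    (hξ : ξ.re ∈ s) : D (ellipticMap R ζ) = D (ellipticMap R ξ) := by
  have hzero : ∀ h : ℂ, (∀ n : ℤ, ∀ ρ ∈ s, modeCoeff (ellipticDeriv R D h) n ρ = 0) →
      ∀ ζ : ℂ, ζ.re ∈ s → ellipticDeriv R D h ζ = 0 := fun h hh ζ hζ => by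
    have hper : Function.Periodic
        (fun ω : ℝ => ellipticDeriv R D h (ζ.re + ω * Complex.I)) (2 * Real.pi) := fun ω => by
      simp only
      rw [← ellipticDeriv_add_two_pi R D h (ζ.re + ω * Complex.I)]
      congr 1
      push_cast
      ring
    obtain ⟨ω, hω, he⟩ := hper.exists_mem_Ioc Real.two_pi_pos ζ.im (-Real.pi)
    rw [show -Real.pi + 2 * Real.pi = Real.pi by ring] at hω
    simp only [Complex.re_add_im] at he
    rw [he]
    exact eq_zero_of_modeCoeff_eq_zero (continuous_ellipticDeriv_line hD hsU h hζ)
      (fun n => hh n _ hζ) (Set.Ioc_subset_Icc_self hω)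
  have hP := hzero 1 fun n ρ hρ => (h0 n ρ hρ).1
  -- The modes of `∂_ω` are `i n` times those of `D`; the zeroth mode of `D` itself stays free,
  -- which is why only constancy follows.
  have hQ := hzero Complex.I fun n ρ hρ => by
    rw [modeCoeff_ellipticDeriv_I hD hsU n hρ, mul_assoc, (h0 n ρ hρ).2, mul_zero]
  have hd : ∀ ζ : ℂ, ζ.re ∈ s → HasFDerivAt (fun ζ => D (ellipticMap R ζ)) (0 : ℂ →L[ℝ] ℂ) ζ :=
    fun ζ hζ => by
    convert hasFDerivAt_comp_ellipticMap ((hD _ (hsU ζ hζ)).1.differentiableAt (by norm_num))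
      using 1
    ext h
    have e1 := hP ζ hζ
    have e2 := hQ ζ hζ
    simp only [ellipticDeriv] at e1 e2
    have : h * (R * Complex.sinh ζ) = h.re • (1 * (R * Complex.sinh ζ)) +
        h.im • (Complex.I * (R * Complex.sinh ζ)) := by
      conv_lhs => rw [← Complex.re_add_im h]
      simp only [Complex.real_smul]
      ring
    change (0 : ℂ) = fderiv ℝ D (ellipticMap R ζ) (h * (R * Complex.sinh ζ))
    rw [this, map_add, map_smul, map_smul, e1, e2]
    simp
  have hconv : Convex ℝ {ζ : ℂ | ζ.re ∈ s} := by
    have := hs.convex.linear_preimage Complex.reLm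
    exact this
  exact (hso.preimage Complex.continuous_re).is_const_of_fderiv_eq_zero (𝕜 := ℝ)
    (f := fun ζ => D (ellipticMap R ζ)) hconv.isPreconnected
    (fun ζ hζ => (hd ζ hζ).differentiableAt.differentiableWithinAt)
    (fun ζ hζ => (hd ζ hζ).fderiv) hζ hξ

end Strip

/-! ### Uniqueness for the transmission problem. -/

theorem tendsto_ellipticMap_cobounded {R : ℝ} (hR : 0 < R) {D : ℂ → ℂ}
    (hD : Tendsto D (Bornology.cobounded ℂ) (𝓝 0)) {ε : ℝ} (hε : 0 < ε) :
    ∀ᶠ ρ : ℝ in atTop, ∀ ω : ℝ, ‖D (ellipticMap R (ρ + ω * Complex.I))‖ < ε := by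
  have h1 : ∀ᶠ w in Bornology.cobounded ℂ, ‖D w‖ < ε := by
    have := hD.norm
    rw [norm_zero] at this
    exact this.eventually_lt_const hε
  rw [← comap_norm_atTop, eventually_comap] at h1
  obtain ⟨r, hr⟩ := eventually_atTop.1 h1
  have hcosh : Tendsto Real.cosh atTop atTop := by
    refine tendsto_atTop_mono' _ ?_ tendsto_id
    filter_upwards [eventually_ge_atTop 0] with x hx
    exact (Real.self_le_sinh_iff.2 hx).trans (Real.sinh_lt_cosh x).le
  -- The focal sum and the triangle inequality give `|R cosh ζ| ≥ R (cosh ρ - 1)`, uniformly in `ω`.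
  have h2 : Tendsto (fun ρ : ℝ => R * (Real.cosh ρ - 1)) atTop atTop :=
    (tendsto_atTop_add_const_right _ (-1) hcosh).const_mul_atTop hR
  filter_upwards [h2.eventually_ge_atTop r] with ρ hρ ω
  refine hr _ ?_ _ rfl
  refine hρ.trans ?_
  have h3 := focalSum_ellipticMap hR (ρ + ω * Complex.I)
  rw [focalSum] at h3
  have h4 := norm_sub_le (ellipticMap R (ρ + ω * Complex.I)) R
  have h5 := norm_add_le (ellipticMap R (ρ + ω * Complex.I)) R
  rw [Complex.norm_real, Real.norm_of_nonneg hR.le] at h4 h5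
  simp only [Complex.add_re, Complex.ofReal_re, Complex.mul_re, Complex.I_re, mul_zero,
    Complex.ofReal_im, Complex.I_im, mul_one, sub_self, add_zero] at h3
  linarith

theorem tendsto_modeCoeff_atTop {R : ℝ} (hR : 0 < R) {D : ℂ → ℂ}
    (hD : Tendsto D (Bornology.cobounded ℂ) (𝓝 0)) (n : ℤ) :
    Tendsto (modeCoeff (fun ζ => D (ellipticMap R ζ)) n) atTop (𝓝 0) := by
  rw [Metric.tendsto_nhds]
  intro ε hε
  have hπ := Real.pi_pos
  filter_upwards [tendsto_ellipticMap_cobounded hR hD (ε := ε / (4 * Real.pi)) (by positivity)]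
    with ρ hρ
  rw [dist_zero_right, modeCoeff]
  refine (intervalIntegral.norm_integral_le_of_norm_le_const (C := ε / (4 * Real.pi))
    fun ω _ => ?_).trans_lt ?_
  · rw [norm_mul, show -((n : ℂ) * (ω * Complex.I)) = ((-(n * ω) : ℝ) : ℂ) * Complex.I by
      push_cast; ring, Complex.norm_exp_ofReal_mul_I, mul_one]
    exact (hρ ω).le
  · rw [show Real.pi - -Real.pi = 2 * Real.pi by ring, abs_of_pos (by positivity)]
    field_simp
    linarith

/-- The modes of a transmission problem with nonreal contrast are trivial. -/
theorem eq_zero_of_mode_transmission {κ a b : ℂ} {εm E : ℝ} (hκ : κ.im ≠ 0)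
    (hE : 1 < E) (h1 : κ * (a * E + b * (E : ℂ)⁻¹) = -εm * (a * E - b * (E : ℂ)⁻¹))
    (h2 : κ * (-a * (E : ℂ)⁻¹ - b * E) = -εm * (a * (E : ℂ)⁻¹ - b * E)) : a = 0 ∧ b = 0 := by
  have hEi : E⁻¹ < 1 := inv_lt_one_of_one_lt₀ hE
  have hE0 : 0 < E⁻¹ := by positivity
  -- The imaginary part is `p Im κ`, since `εm q` is real.
  have key : ∀ p q : ℝ, 0 < p → κ * p + εm * q ≠ 0 := fun p q hp h => by
    have := congrArg Complex.im h
    simp at this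
    rcases this with h | h
    · exact hκ h
    · exact hp.ne' h
  -- Adding and subtracting the two equations decouples them into the symmetric and antisymmetric
  -- combinations of `a` and `b`.
  have e1 : (a + b) * (κ * ((E + E⁻¹ : ℝ) : ℂ) + εm * ((E - E⁻¹ : ℝ) : ℂ)) = 0 := by
    push_cast
    linear_combination h1 - h2
  have e2 : (a - b) * (κ * ((E - E⁻¹ : ℝ) : ℂ) + εm * ((E + E⁻¹ : ℝ) : ℂ)) = 0 := by
    push_cast
    linear_combination h1 + h2
  have e3 := (mul_eq_zero.1 e1).resolve_right (key _ _ (by linarith))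
  have e4 := (mul_eq_zero.1 e2).resolve_right (key _ _ (by linarith))
  exact ⟨by linear_combination (e3 + e4) / 2, by linear_combination (e3 - e4) / 2⟩

theorem tendsto_ellipticDeriv {R : ℝ} {D : ℂ → ℂ} {U : Set ℂ} {s : Set ℝ} {ζ₀ : ℂ}
    (hsU : ∀ ζ : ℂ, ζ.re ∈ s → ellipticMap R ζ ∈ U) {g : ℂ →L[ℝ] ℂ}
    (hg : Tendsto (fderiv ℝ D) (𝓝[U] (ellipticMap R ζ₀)) (𝓝 g)) :
    Tendsto (ellipticDeriv R D 1) (𝓝[{ζ | ζ.re ∈ s}] ζ₀) (𝓝 (g (R * Complex.sinh ζ₀))) := by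
  have h1 : Tendsto (ellipticMap R) (𝓝[{ζ | ζ.re ∈ s}] ζ₀) (𝓝[U] (ellipticMap R ζ₀)) := by
    refine tendsto_nhdsWithin_iff.2
      ⟨(continuous_ellipticMap R).continuousAt.tendsto.mono_left nhdsWithin_le_nhds, ?_⟩
    filter_upwards [self_mem_nhdsWithin] with ζ hζ
    exact hsU ζ hζ
  have h2 : Tendsto (fun ζ => R * Complex.sinh ζ) (𝓝[{ζ | ζ.re ∈ s}] ζ₀)
      (𝓝 (R * Complex.sinh ζ₀)) := by
    have : Continuous fun ζ : ℂ => R * Complex.sinh ζ := by fun_prop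
    exact this.continuousAt.tendsto.mono_left nhdsWithin_le_nhds
  have h3 := (isBoundedBilinearMap_apply (𝕜 := ℝ) (E := ℂ)
    (F := ℂ)).continuous.tendsto (g, R * Complex.sinh ζ₀) |>.comp ((hg.comp h1).prodMk_nhds h2)
  have e : ellipticDeriv R D 1 = fun ζ => fderiv ℝ D (ellipticMap R ζ) (R * Complex.sinh ζ) := by
    ext ζ
    rw [ellipticDeriv, one_mul]
  rwa [e]

/-- Uniqueness for the transmission problem across an ellipse with nonreal contrast. -/
theorem eq_zero_of_transmission {R ρ₀ : ℝ} (hR : 0 < R) (hρ₀ : 0 < ρ₀) {κ : ℂ} {εm : ℝ}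
    (hεm : 0 < εm) (hκ : κ.im ≠ 0) {D : ℂ → ℂ} (hin : HarmonicOnNhd D (complexEllipse R ρ₀))
    (hout : HarmonicOnNhd D (closure (complexEllipse R ρ₀))ᶜ) (hc : Continuous D)
    (hflux : ∀ ω : ℝ, ∃ gIn gOut : ℂ →L[ℝ] ℂ,
      Tendsto (fderiv ℝ D) (𝓝[complexEllipse R ρ₀] (ellipticMap R (ρ₀ + ω * Complex.I))) (𝓝 gIn) ∧
      Tendsto (fderiv ℝ D) (𝓝[(closure (complexEllipse R ρ₀))ᶜ]
        (ellipticMap R (ρ₀ + ω * Complex.I))) (𝓝 gOut) ∧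
      εm * gOut (R * Complex.sinh (ρ₀ + ω * Complex.I)) =
        κ * gIn (R * Complex.sinh (ρ₀ + ω * Complex.I)))
    (hdec : Tendsto D (Bornology.cobounded ℂ) (𝓝 0)) : D = 0 := by
  -- The symmetric strip covers the ellipse twice, with the line `Re ζ = 0` over the focal segment.
  -- Harmonicity across that segment makes the mode constants the same on both halves.
  have hinU : ∀ ζ : ℂ, ζ.re ∈ Set.Ioo (-ρ₀) ρ₀ → ellipticMap R ζ ∈ complexEllipse R ρ₀ :=
    fun ζ hζ => (ellipticMap_mem_complexEllipse hR hρ₀.le).2 (abs_lt.2 hζ)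
  have houtU : ∀ ζ : ℂ, ζ.re ∈ Set.Ioi ρ₀ → ellipticMap R ζ ∈ (closure (complexEllipse R ρ₀))ᶜ :=
    fun ζ hζ h => by
      rw [ellipticMap_mem_closure_complexEllipse hR hρ₀] at h
      exact absurd ((le_abs_self _).trans h) (not_le.2 hζ)
  choose gIn gOut hgIn hgOut hg using hflux
  set f := fun n => modeCoeff (fun ζ => D (ellipticMap R ζ)) n with hf
  set r := fun n => modeCoeff (ellipticDeriv R D 1) n with hr
  choose C C' hC using exists_modeCoeff_of_harmonicOnNhd hin Set.ordConnected_Ioo hinU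
  choose B B' hB using exists_modeCoeff_of_harmonicOnNhd hout Set.ordConnected_Ioi houtU
  have hfc : ∀ n, Continuous (f n) := fun n =>
    continuous_modeCoeff (hc.comp (continuous_ellipticMap R)) n
  have hfneg : ∀ n ρ, f (-n) (-ρ) = f n ρ := fun n ρ => by
    simp only [hf]
    rw [← modeCoeff_neg]
    simp only [ellipticMap_neg]
  have hrneg : ∀ n ρ, r (-n) (-ρ) = -r n ρ := fun n ρ => by
    simp only [hr]
    rw [← modeCoeff_neg]
    simp only [ellipticDeriv_neg, modeCoeff, neg_mul, intervalIntegral.integral_neg]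
  have h0mem : (0 : ℝ) ∈ Set.Ioo (-ρ₀) ρ₀ := ⟨by linarith, hρ₀⟩
  -- On the line `ρ = 0` the symmetry `ζ ↦ -ζ` relates the modes `n` and `-n` of one and the same
  -- line, so it becomes a relation between the constants.
  have hCneg : ∀ n, C (-n) = -C n ∧ C' (-n) = -C' n := fun n => by
    have e1 := hC n 0 h0mem
    have e2 := hC (-n) 0 h0mem
    have e3 := hfneg n 0
    have e4 := hrneg n 0
    simp only [hf, hr, neg_zero] at e3 e4
    rw [e3, e4] at e2
    simp only [Complex.ofReal_zero, mul_zero, neg_zero, Complex.exp_zero, mul_one] at e1 e2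
    push_cast at e2
    constructor
    · linear_combination -e2.1 - e1.1
    · linear_combination -e2.2 - e1.2
  set rin := fun n => modeCoeff (fun ζ => gIn ζ.im (R * Complex.sinh ζ)) n ρ₀ with hrin
  set rout := fun n => modeCoeff (fun ζ => gOut ζ.im (R * Complex.sinh ζ)) n ρ₀ with hrout
  have hcl_in : ρ₀ ∈ closure (Set.Ioo 0 ρ₀) := by
    rw [closure_Ioo hρ₀.ne]
    exact ⟨hρ₀.le, le_rfl⟩
  have hcl_out : ρ₀ ∈ closure (Set.Ioi ρ₀) := by
    rw [closure_Ioi]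
    exact Set.self_mem_Ici
  have hinU' : ∀ ζ : ℂ, ζ.re ∈ Set.Ioo 0 ρ₀ → ellipticMap R ζ ∈ complexEllipse R ρ₀ :=
    fun ζ hζ => hinU ζ ⟨by linarith [hζ.1], hζ.2⟩
  have hlin : ∀ n, Tendsto (r n) (𝓝[Set.Ioo 0 ρ₀] ρ₀) (𝓝 (rin n)) := fun n => by
    refine tendsto_modeCoeff (isCompact_Icc (a := ρ₀ / 2) (b := ρ₀)) ?_ ?_ hcl_in
      (continuousOn_ellipticDeriv hin hinU' 1) (fun ω => ?_) n
    · rintro x ⟨h1, h2⟩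
      rcases h2.eq_or_lt with h | h
      · exact Or.inl h
      · exact Or.inr ⟨by linarith, h⟩
    · filter_upwards [self_mem_nhdsWithin, mem_nhdsWithin_of_mem_nhds (Ioi_mem_nhds
        (show ρ₀ / 2 < ρ₀ by linarith))] with x h1 h2
      exact ⟨h2.le, h1.2.le⟩
    · simpa using tendsto_ellipticDeriv hinU' (hgIn ω)
  have hlout : ∀ n, Tendsto (r n) (𝓝[>] ρ₀) (𝓝 (rout n)) := fun n => by
    refine tendsto_modeCoeff (isCompact_Icc (a := ρ₀) (b := ρ₀ + 1)) ?_ ?_ hcl_out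
      (continuousOn_ellipticDeriv hout houtU 1) (fun ω => ?_) n
    · rintro x ⟨h1, h2⟩
      rcases h1.eq_or_lt with h | h
      · exact Or.inl h.symm
      · exact Or.inr h
    · exact mem_nhdsWithin.2 ⟨Set.Iio (ρ₀ + 1), isOpen_Iio, by simp, fun x hx =>
        ⟨(Set.mem_Ioi.1 hx.2).le, (Set.mem_Iio.1 hx.1).le⟩⟩
    · simpa using tendsto_ellipticDeriv houtU (hgOut ω)
  have hfluxmode : ∀ n, εm * rout n = κ * rin n := fun n => by
    simp only [hrin, hrout, modeCoeff]
    rw [← intervalIntegral.integral_const_mul, ← intervalIntegral.integral_const_mul]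
    refine intervalIntegral.integral_congr fun ω _ => ?_
    have := hg ω
    simp only [Complex.add_im, Complex.ofReal_im, Complex.mul_im, Complex.ofReal_re, Complex.I_im,
      mul_one, Complex.I_re, mul_zero, add_zero, zero_add]
    rw [← mul_assoc, this, mul_assoc]
  have hne_in : (𝓝[Set.Ioo 0 ρ₀] ρ₀).NeBot := mem_closure_iff_nhdsWithin_neBot.1 hcl_in
  have hexp : ∀ (c z : ℂ) (l : Filter ℝ), l ≤ 𝓝 ρ₀ →
      Tendsto (fun ρ : ℝ => c * Complex.exp (z * ρ)) l (𝓝 (c * Complex.exp (z * ρ₀))) :=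
    fun c z l hl => by
    have : Continuous fun ρ : ℝ => c * Complex.exp (z * ρ) := by fun_prop
    exact this.continuousAt.tendsto.mono_left hl
  have hfl : ∀ (n : ℤ) (l : Filter ℝ), l ≤ 𝓝 ρ₀ →
      Tendsto (fun ρ => (n : ℂ) * f n ρ) l (𝓝 (n * f n ρ₀)) := fun n l hl =>
    ((hfc n).continuousAt.tendsto.mono_left hl).const_mul _
  have hinC : ∀ n, rin n + n * f n ρ₀ = C n * Complex.exp (n * ρ₀) ∧
      rin n - n * f n ρ₀ = C' n * Complex.exp (-n * ρ₀) := fun n => by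
    constructor
    · refine tendsto_nhds_unique ((hlin n).add (hfl n _ nhdsWithin_le_nhds))
        ((hexp (C n) n _ nhdsWithin_le_nhds).congr' ?_)
      filter_upwards [self_mem_nhdsWithin] with ρ hρ
      exact (hC n ρ ⟨by linarith [hρ.1], hρ.2⟩).1.symm
    · refine tendsto_nhds_unique ((hlin n).sub (hfl n _ nhdsWithin_le_nhds))
        ((hexp (C' n) (-n) _ nhdsWithin_le_nhds).congr' ?_)
      filter_upwards [self_mem_nhdsWithin] with ρ hρ
      rw [neg_mul]
      exact (hC n ρ ⟨by linarith [hρ.1], hρ.2⟩).2.symm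
  have houtB : ∀ n, rout n + n * f n ρ₀ = B n * Complex.exp (n * ρ₀) ∧
      rout n - n * f n ρ₀ = B' n * Complex.exp (-n * ρ₀) := fun n => by
    constructor
    · refine tendsto_nhds_unique ((hlout n).add (hfl n _ nhdsWithin_le_nhds))
        ((hexp (B n) n _ nhdsWithin_le_nhds).congr' ?_)
      filter_upwards [self_mem_nhdsWithin] with ρ hρ
      exact (hB n ρ hρ).1.symm
    · refine tendsto_nhds_unique ((hlout n).sub (hfl n _ nhdsWithin_le_nhds))
        ((hexp (B' n) (-n) _ nhdsWithin_le_nhds).congr' ?_)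
      filter_upwards [self_mem_nhdsWithin] with ρ hρ
      rw [neg_mul]
      exact (hB n ρ hρ).2.symm
  -- the growing modes vanish outside
  have hdecay : ∀ c : ℝ, 0 < c → Tendsto (fun ρ : ℝ => Complex.exp (-(c * ρ))) atTop (𝓝 0) :=
    fun c hc => by
    have h1 : Tendsto (fun ρ : ℝ => Real.exp (-(c * ρ))) atTop (𝓝 0) :=
      Real.tendsto_exp_neg_atTop_nhds_zero.comp (tendsto_id.const_mul_atTop hc)
    have h2 := (Complex.continuous_ofReal.tendsto 0).comp h1
    simpa [Function.comp_def] using h2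
  -- The difference of the two mode relations eliminates the normal derivative, so only the decay of
  -- `D`, not of its gradient, is needed.
  have hgrow : ∀ (c : ℝ) (p q y : ℂ) (m : ℤ), 0 < c →
      (∀ ρ ∈ Set.Ioi ρ₀, p * Complex.exp (c * ρ) - q * Complex.exp (-(c * ρ)) = y * f m ρ) →
      p = 0 := fun c p q y m hc h => by
    have h1 : Tendsto (fun ρ : ℝ => (y * f m ρ + q * Complex.exp (-(c * ρ))) *
        Complex.exp (-(c * ρ))) atTop (𝓝 ((y * 0 + q * 0) * 0)) :=
      (((tendsto_modeCoeff_atTop hR hdec m).const_mul y).add ((hdecay c hc).const_mul q)).mul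
        (hdecay c hc)
    have h2 : Tendsto (fun _ : ℝ => p) atTop (𝓝 ((y * 0 + q * 0) * 0)) := by
      refine h1.congr' ?_
      filter_upwards [eventually_gt_atTop ρ₀] with ρ hρ
      rw [← h ρ hρ, sub_add_cancel, mul_assoc, ← Complex.exp_add]
      simp
    have := tendsto_nhds_unique tendsto_const_nhds h2
    simpa using this
  have hB0 : ∀ n : ℤ, 0 < n → B n = 0 := fun n hn => by
    refine hgrow n (B n) (B' n) (2 * n) n (by exact_mod_cast hn) fun ρ hρ => ?_
    obtain ⟨h1, h2⟩ := hB n ρ hρ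
    push_cast
    rw [← h1, ← h2]
    simp only [hf]
    ring
  have hB0' : ∀ n : ℤ, 0 < n → B' (-n) = 0 := fun n hn => by
    refine hgrow n (B' (-n)) (B (-n)) (2 * n) (-n) (by exact_mod_cast hn) fun ρ hρ => ?_
    obtain ⟨h1, h2⟩ := hB (-n) ρ hρ
    push_cast at h1 h2 ⊢
    rw [show -(-(n : ℂ) * (ρ : ℂ)) = n * ρ by ring] at h2
    rw [show -(n : ℂ) * (ρ : ℂ) = -(n * ρ) by ring] at h1
    rw [← h1, ← h2]
    simp only [hf]
    ring
  -- Without growing outer modes, `rout = -|m| f` at the frequencies `m = ±n`. Inserting this in the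
  -- flux condition and expressing `rin` and `f` through `C n`, `C' n` gives two equations for these
  -- two unknowns, with `E = e^{nρ₀} > 1`.
  have hpos : ∀ n : ℤ, 0 < n → C n = 0 ∧ C' n = 0 := fun n hn => by
    have hn' : (0 : ℝ) < n := by exact_mod_cast hn
    have hE : Complex.exp (n * ρ₀) = (Real.exp (n * ρ₀) : ℂ) := by push_cast; rfl
    have hE' : Complex.exp (-n * ρ₀) = ((Real.exp (n * ρ₀) : ℝ) : ℂ)⁻¹ := by
      rw [neg_mul, Complex.exp_neg, hE]
    obtain ⟨i1, i2⟩ := hinC n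
    obtain ⟨i3, i4⟩ := hinC (-n)
    obtain ⟨o1, -⟩ := houtB n
    obtain ⟨-, o4⟩ := houtB (-n)
    rw [(hCneg n).1] at i3
    rw [(hCneg n).2] at i4
    rw [hB0 n hn, zero_mul] at o1
    rw [hB0' n hn, zero_mul] at o4
    have f1 := hfluxmode n
    have f2 := hfluxmode (-n)
    push_cast at i3 i4 o4
    rw [neg_neg] at i4
    rw [hE] at i1 i4
    rw [hE'] at i2 i3
    refine eq_zero_of_mode_transmission (εm := εm) (E := Real.exp (n * ρ₀)) hκ
      (Real.one_lt_exp_iff.2 (by positivity)) ?_ ?_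
    · linear_combination (-κ) * (i1 + i2) - εm * (i1 - i2) - 2 * f1 + 2 * εm * o1
    · linear_combination (-κ) * (i3 + i4) + εm * (i3 - i4) - 2 * f2 + 2 * εm * o4
  have hC0 : ∀ n, C n = 0 ∧ C' n = 0 := fun n => by
    rcases lt_trichotomy n 0 with h | rfl | h
    · have := hpos (-n) (by omega)
      rw [(hCneg n).1, (hCneg n).2] at this
      exact ⟨neg_eq_zero.1 this.1, neg_eq_zero.1 this.2⟩
    · have := hCneg 0
      rw [neg_zero] at this
      exact ⟨self_eq_neg.1 this.1, self_eq_neg.1 this.2⟩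
    · exact hpos n h
  -- For `n = 0` this excludes a logarithmic outer mode: no flux leaves the ellipse, because the
  -- inner zeroth modes vanish by oddness.
  have hBzero : ∀ n, B n = 0 ∧ B' n = 0 := fun n => by
    obtain ⟨i1, i2⟩ := hinC n
    rw [(hC0 n).1, zero_mul] at i1
    rw [(hC0 n).2, zero_mul] at i2
    have hr0 : rin n = 0 := by linear_combination (i1 + i2) / 2
    have hf0 : n * f n ρ₀ = 0 := by linear_combination (i1 - i2) / 2
    have f1 := hfluxmode n
    rw [hr0, mul_zero] at f1
    have ho : rout n = 0 := (mul_eq_zero.1 f1).resolve_left (by exact_mod_cast hεm.ne')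
    obtain ⟨o1, o2⟩ := houtB n
    rw [ho, hf0, add_zero] at o1
    rw [ho, hf0, sub_zero] at o2
    exact ⟨(mul_eq_zero.1 o1.symm).resolve_right (Complex.exp_ne_zero _),
      (mul_eq_zero.1 o2.symm).resolve_right (Complex.exp_ne_zero _)⟩
  have hconst_in : ∀ ζ ξ : ℂ, ζ.re ∈ Set.Ioo (-ρ₀) ρ₀ → ξ.re ∈ Set.Ioo (-ρ₀) ρ₀ →
      D (ellipticMap R ζ) = D (ellipticMap R ξ) := fun ζ ξ hζ hξ => by
    refine eq_of_modeCoeff_eq_zero hin Set.ordConnected_Ioo isOpen_Ioo hinU (fun n ρ hρ => ?_) hζ hξ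
    obtain ⟨h1, h2⟩ := hC n ρ hρ
    rw [(hC0 n).1, zero_mul] at h1
    rw [(hC0 n).2, zero_mul] at h2
    exact ⟨by linear_combination (h1 + h2) / 2, by linear_combination (h1 - h2) / 2⟩
  have hconst_out : ∀ ζ ξ : ℂ, ζ.re ∈ Set.Ioi ρ₀ → ξ.re ∈ Set.Ioi ρ₀ →
      D (ellipticMap R ζ) = D (ellipticMap R ξ) := fun ζ ξ hζ hξ => by
    refine eq_of_modeCoeff_eq_zero hout Set.ordConnected_Ioi isOpen_Ioi houtU (fun n ρ hρ => ?_)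
      hζ hξ
    obtain ⟨h1, h2⟩ := hB n ρ hρ
    rw [(hBzero n).1, zero_mul] at h1
    rw [(hBzero n).2, zero_mul] at h2
    exact ⟨by linear_combination (h1 + h2) / 2, by linear_combination (h1 - h2) / 2⟩
  -- The outer constant is zero by decay; continuity across the interface then transfers this to the
  -- inner constant.
  have hzero_out : ∀ ζ : ℂ, ζ.re ∈ Set.Ioi ρ₀ → D (ellipticMap R ζ) = 0 := fun ζ hζ => by
    by_contra hne
    obtain ⟨ρ, hρ, hρ'⟩ := ((tendsto_ellipticMap_cobounded hR hdec (norm_pos_iff.2 hne)).and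
      (eventually_gt_atTop ρ₀)).exists
    have := hρ 0
    rw [hconst_out _ ζ (by simpa using hρ') hζ] at this
    exact lt_irrefl _ this
  have hVc : ∀ ω : ℝ, Continuous fun ρ : ℝ => D (ellipticMap R (ρ + ω * Complex.I)) := fun ω =>
    hc.comp ((continuous_ellipticMap R).comp (by fun_prop))
  have hzero_bd : ∀ ω : ℝ, D (ellipticMap R (ρ₀ + ω * Complex.I)) = 0 := fun ω => by
    refine tendsto_nhds_unique ((hVc ω).continuousAt.tendsto.mono_left
      (nhdsWithin_le_nhds (s := Set.Ioi ρ₀))) (tendsto_const_nhds.congr' ?_)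
    filter_upwards [self_mem_nhdsWithin] with ρ hρ
    exact (hzero_out _ (by simpa using hρ)).symm
  have hzero_in : ∀ ζ : ℂ, ζ.re ∈ Set.Ioo (-ρ₀) ρ₀ → D (ellipticMap R ζ) = 0 := fun ζ hζ => by
    rw [← hzero_bd 0]
    refine tendsto_nhds_unique (tendsto_const_nhds.congr' ?_)
      ((hVc 0).continuousAt.tendsto.mono_left (nhdsWithin_le_nhds (s := Set.Ioo 0 ρ₀)))
    filter_upwards [self_mem_nhdsWithin] with ρ hρ
    exact hconst_in _ _ hζ (by simpa using ⟨by linarith [hρ.1], hρ.2⟩)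
  ext w
  obtain ⟨ζ, h0, -, rfl⟩ := exists_ellipticMap_eq hR w
  rcases lt_trichotomy ζ.re ρ₀ with h | h | h
  · exact hzero_in ζ ⟨by linarith, h⟩
  · rw [← Complex.re_add_im ζ, h]
    exact hzero_bd _
  · exact hzero_out ζ h

/-! ### Transfer between the plane and ℂ, and uniqueness of the dipole solution. -/

section Transfer

variable {E E' F : Type*} [NormedAddCommGroup E] [InnerProductSpace ℝ E]
  [NormedAddCommGroup E'] [InnerProductSpace ℝ E']
  [NormedAddCommGroup F] [NormedSpace ℝ F]

theorem HarmonicOnNhd.comp_linearIsometryEquiv [FiniteDimensional ℝ E]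
    [FiniteDimensional ℝ E'] (J : E ≃ₗᵢ[ℝ] E') {f : E' → F} {s : Set E'}
    (h : HarmonicOnNhd f s) : HarmonicOnNhd (f ∘ J) (J ⁻¹' s) :=
  fun _ hx => HarmonicAt.comp_linearIsometryEquiv J (h _ hx)

theorem fderiv_comp_linearIsometryEquiv (J : E ≃ₗᵢ[ℝ] E') (f : E' → F) (x : E) :
    fderiv ℝ (f ∘ J) x = (fderiv ℝ f (J x)).comp (J.toContinuousLinearEquiv : E →L[ℝ] E') :=
  J.toContinuousLinearEquiv.comp_right_fderiv

theorem tendsto_fderiv_comp_linearIsometryEquiv (J : E ≃ₗᵢ[ℝ] E') {f : E' → F} {s : Set E'} {p : E}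
    {g : E' →L[ℝ] F} (h : Tendsto (fderiv ℝ f) (𝓝[s] (J p)) (𝓝 g)) :
    Tendsto (fderiv ℝ (f ∘ J)) (𝓝[J ⁻¹' s] p)
      (𝓝 (g.comp (J.toContinuousLinearEquiv : E →L[ℝ] E'))) := by
  have h1 : Tendsto J (𝓝[J ⁻¹' s] p) (𝓝[s] (J p)) :=
    tendsto_nhdsWithin_iff.2 ⟨J.continuous.continuousAt.tendsto.mono_left nhdsWithin_le_nhds,
      self_mem_nhdsWithin⟩
  have h2 : Continuous fun g : E' →L[ℝ] F => g.comp (J.toContinuousLinearEquiv : E →L[ℝ] E') :=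
    by fun_prop
  have h3 := (h2.tendsto g).comp (h.comp h1)
  refine h3.congr fun x => ?_
  rw [fderiv_comp_linearIsometryEquiv]
  rfl

theorem tendsto_cobounded_linearIsometryEquiv (J : E ≃ₗᵢ[ℝ] E') :
    Tendsto J (Bornology.cobounded E) (Bornology.cobounded E') := by
  rw [← tendsto_norm_atTop_iff_cobounded]
  simpa using tendsto_norm_cobounded_atTop (E := E)

end Transfer

theorem planeToComplex_preimage_symm {s : Set ℂ} :
    planeToComplex.symm ⁻¹' (planeToComplex ⁻¹' s) = s := by
  ext; simp

theorem ellipticPoint_notMem_closure {R ρ₀ ρ ω : ℝ} (hR : 0 < R) (hρ₀ : 0 < ρ₀) (hρ : ρ₀ < ρ) :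
    ellipticPoint R ρ ω ∉ closure (ellipseDomain R ρ₀) := by
  rw [closure_ellipseDomain hR hρ₀, Set.mem_preimage, planeToComplex_ellipticPoint,
    ellipticMap_mem_closure_complexEllipse hR hρ₀]
  simpa using hρ.trans_le (le_abs_self ρ)

theorem ellipticPoint_mem_closure {R ρ₀ ω : ℝ} (hR : 0 < R) (hρ₀ : 0 < ρ₀) :
    ellipticPoint R ρ₀ ω ∈ closure (ellipseDomain R ρ₀) := by
  rw [closure_ellipseDomain hR hρ₀, Set.mem_preimage, planeToComplex_ellipticPoint,
    ellipticMap_mem_closure_complexEllipse hR hρ₀]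
  simp [abs_of_pos hρ₀]

/-- The dipole solution is unique when the contrast is nonreal. -/
theorem IsDipoleSolution.eqOn {R ρ₀ ρz ωz εm : ℝ} (hR : 0 < R) (hρ₀ : 0 < ρ₀) (hρz : ρ₀ < ρz)
    (hεm : 0 < εm) {a : Plane} {κ : ℂ} (hκ : κ.im ≠ 0) {u v : Plane → ℂ}
    (hu : IsDipoleSolution R ρ₀ κ εm a (ellipticPoint R ρz ωz) u)
    (hv : IsDipoleSolution R ρ₀ κ εm a (ellipticPoint R ρz ωz) v) :
    Set.EqOn u v {ellipticPoint R ρz ωz}ᶜ := by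
  classical
  set z := ellipticPoint R ρz ωz with hz
  have hzΩ : z ∉ closure (ellipseDomain R ρ₀) := ellipticPoint_notMem_closure hR hρ₀ hρz
  obtain ⟨wu, hwu, hwu'⟩ := hu.source
  obtain ⟨wv, hwv, hwv'⟩ := hv.source
  -- The dipole terms cancel, so `u - v` agrees with the harmonic `wu - wv` in a punctured
  -- neighbourhood of `z`. Overwriting the irrelevant value at `z` removes the singularity.
  set d : Plane → ℂ := Function.update (u - v) z ((wu - wv) z) with hd
  have hdz : d =ᶠ[𝓝 z] wu - wv := by
    have h := hwu'.and hwv'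
    rw [eventually_nhdsWithin_iff] at h
    filter_upwards [h] with x hx
    by_cases hxz : x = z
    · rw [hxz, hd, Function.update_self]
    · obtain ⟨h1, h2⟩ := hx hxz
      rw [hd, Function.update_of_ne hxz, Pi.sub_apply, Pi.sub_apply, h1, h2]
      ring
  have hdne : ∀ x, x ≠ z → d =ᶠ[𝓝 x] u - v := fun x hx => by
    filter_upwards [isOpen_ne.mem_nhds hx] with y hy
    rw [hd, Function.update_of_ne hy]
  have hharm_z : HarmonicAt d z := (harmonicAt_congr_nhds hdz).2 (hwu.sub hwv)
  have hin : HarmonicOnNhd d (ellipseDomain R ρ₀) := fun x hx => by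
    have hxz : x ≠ z := fun h => hzΩ (h ▸ subset_closure hx)
    exact (harmonicAt_congr_nhds (hdne x hxz)).2
      ((hu.harmonic_inside x hx).sub (hv.harmonic_inside x hx))
  have hout : HarmonicOnNhd d (closure (ellipseDomain R ρ₀))ᶜ := fun x hx => by
    by_cases hxz : x = z
    · rw [hxz]; exact hharm_z
    · have hx' : x ∈ (closure (ellipseDomain R ρ₀) ∪ {z})ᶜ := by
        rintro (h | h)
        · exact hx h
        · exact hxz h
      exact (harmonicAt_congr_nhds (hdne x hxz)).2
        ((hu.harmonic_outside x hx').sub (hv.harmonic_outside x hx'))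
  have hc : Continuous d := continuous_iff_continuousAt.2 fun x => by
    by_cases hxz : x = z
    · rw [hxz]; exact hharm_z.1.continuousAt
    · have hx : ({z}ᶜ : Set Plane) ∈ 𝓝 x := isOpen_ne.mem_nhds hxz
      exact ((hu.continuous_potential.continuousAt hx).sub
        (hv.continuous_potential.continuousAt hx)).congr (hdne x hxz).symm
  have hdec : Tendsto d (Bornology.cobounded Plane) (𝓝 0) := by
    have h1 : (u - v) =O[Bornology.cobounded Plane] fun x => ‖x‖⁻¹ := hu.decay.sub hv.decay
    have h2 : Tendsto (fun x : Plane => ‖x‖⁻¹) (Bornology.cobounded Plane) (𝓝 0) :=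
      tendsto_inv_atTop_zero.comp tendsto_norm_cobounded_atTop
    refine (h1.trans_tendsto h2).congr' ?_
    have h3 : ({z}ᶜ : Set Plane) ∈ Bornology.cobounded Plane :=
      Bornology.IsBounded.compl (Bornology.isBounded_singleton)
    filter_upwards [h3] with x hx
    rw [hd, Function.update_of_ne hx]
  have hsub : ∀ x ∈ (closure (ellipseDomain R ρ₀) ∪ {z})ᶜ ∪ ellipseDomain R ρ₀,
      fderiv ℝ u x - fderiv ℝ v x = fderiv ℝ d x := fun x hx => by
    have hxz : x ≠ z := by
      rintro rfl
      rcases hx with h | h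
      · exact h (Or.inr rfl)
      · exact hzΩ (subset_closure h)
    rw [(hdne x hxz).fderiv_eq, fderiv_sub]
    · rcases hx with h | h
      · exact (hu.harmonic_outside x h).1.differentiableAt (by norm_num)
      · exact (hu.harmonic_inside x h).1.differentiableAt (by norm_num)
    · rcases hx with h | h
      · exact (hv.harmonic_outside x h).1.differentiableAt (by norm_num)
      · exact (hv.harmonic_inside x h).1.differentiableAt (by norm_num)
  have hD : d ∘ planeToComplex.symm = 0 := by
    refine eq_zero_of_transmission hR hρ₀ hεm hκ ?_ ?_ ?_ ?_ ?_
    · have := HarmonicOnNhd.comp_linearIsometryEquiv planeToComplex.symm hin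
      rwa [ellipseDomain_eq_preimage hR hρ₀, planeToComplex_preimage_symm] at this
    · have := HarmonicOnNhd.comp_linearIsometryEquiv planeToComplex.symm hout
      rwa [closure_ellipseDomain hR hρ₀, ← Set.preimage_compl, planeToComplex_preimage_symm] at this
    · exact hc.comp planeToComplex.symm.continuous
    · intro ω
      obtain ⟨ui, uo, hui, huo, hu'⟩ := hu.continuous_flux ω
      obtain ⟨vi, vo, hvi, hvo, hv'⟩ := hv.continuous_flux ω
      have hp : planeToComplex.symm (ellipticMap R (ρ₀ + ω * Complex.I)) =
          ellipticPoint R ρ₀ ω := by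
        rw [← planeToComplex_ellipticPoint, LinearIsometryEquiv.symm_apply_apply]
      have hpz : ellipticPoint R ρ₀ ω ≠ z := fun h => hzΩ (h ▸ ellipticPoint_mem_closure hR hρ₀)
      have h1 : Tendsto (fderiv ℝ d) (𝓝[ellipseDomain R ρ₀] (ellipticPoint R ρ₀ ω))
          (𝓝 (ui - vi)) := by
        refine (hui.sub hvi).congr' ?_
        filter_upwards [self_mem_nhdsWithin] with x hx
        exact hsub x (Or.inr hx)
      have h2 : Tendsto (fderiv ℝ d) (𝓝[(closure (ellipseDomain R ρ₀))ᶜ] (ellipticPoint R ρ₀ ω))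
          (𝓝 (uo - vo)) := by
        refine (huo.sub hvo).congr' ?_
        filter_upwards [self_mem_nhdsWithin, mem_nhdsWithin_of_mem_nhds (isOpen_ne.mem_nhds hpz)]
          with x hx hxz
        refine hsub x (Or.inl ?_)
        rintro (h | h)
        · exact hx h
        · exact hxz h
      rw [← hp] at h1 h2
      have h3 := tendsto_fderiv_comp_linearIsometryEquiv planeToComplex.symm h1
      have h4 := tendsto_fderiv_comp_linearIsometryEquiv planeToComplex.symm h2
      rw [ellipseDomain_eq_preimage hR hρ₀, planeToComplex_preimage_symm] at h3
      rw [closure_ellipseDomain hR hρ₀, ← Set.preimage_compl, planeToComplex_preimage_symm] at h4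
      refine ⟨_, _, h3, h4, ?_⟩
      -- `R sinh ζ` represents `∂x/∂ρ`, the unit normal times the scale factor. That factor is
      -- common to both sides of the flux condition.
      have hν : planeToComplex.symm (R * Complex.sinh (ρ₀ + ω * Complex.I)) =
          scaleFactor R ρ₀ ω • ellipseNormal R ρ₀ ω := by
        rw [LinearIsometryEquiv.symm_apply_eq, map_smul, planeToComplex_ellipseNormal, smul_smul,
          mul_inv_cancel₀ (scaleFactor_pos hR hρ₀ ω).ne', one_smul]
      have happ : ∀ g : Plane →L[ℝ] ℂ,
          g.comp (planeToComplex.symm.toContinuousLinearEquiv : ℂ →L[ℝ] Plane)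
            (R * Complex.sinh (ρ₀ + ω * Complex.I)) =
          scaleFactor R ρ₀ ω * g (ellipseNormal R ρ₀ ω) := fun g => by
        change g (planeToComplex.symm (R * Complex.sinh (ρ₀ + ω * Complex.I))) = _
        rw [hν, map_smul, Complex.real_smul]
      rw [happ, happ]
      simp only [sub_apply]
      linear_combination (scaleFactor R ρ₀ ω : ℂ) * (hu' - hv')
    · exact hdec.comp (tendsto_cobounded_linearIsometryEquiv planeToComplex.symm)
  intro x hx
  have h1 := congrFun hD (planeToComplex x)
  simp only [Function.comp_apply, LinearIsometryEquiv.symm_apply_apply, Pi.zero_apply] at h1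
  rw [hd, Function.update_of_ne hx, Pi.sub_apply] at h1
  exact sub_eq_zero.1 h1

/-! ### Chebyshev series, holomorphic inside an ellipse. -/

/-- The series `∑ cₙ Tₙ(w / R)` in Chebyshev polynomials. -/
noncomputable def chebSeries (R : ℝ) (c : ℕ → ℂ) (w : ℂ) : ℂ :=
  ∑' n : ℕ, c n * (Polynomial.Chebyshev.T ℂ n).eval (w / R)

/-- Since `Tₙ (cosh ζ) = cosh (nζ)`, the even modes are polynomials in `w`, and regularity across
the focal segment is automatic. -/
theorem chebyshev_eval_ellipticMap {R : ℝ} (hR : 0 < R) (n : ℕ) (ζ : ℂ) :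
    (Polynomial.Chebyshev.T ℂ n).eval (ellipticMap R ζ / R) = Complex.cosh (n * ζ) := by
  have hR' : (R : ℂ) ≠ 0 := by exact_mod_cast hR.ne'
  rw [ellipticMap, mul_div_cancel_left₀ _ hR', Polynomial.Chebyshev.T_complex_cosh]
  simp

theorem norm_cosh_natCast_mul_le (n : ℕ) (ζ : ℂ) :
    ‖Complex.cosh (n * ζ)‖ ≤ Real.exp (|ζ.re| * n) := by
  have h : ∀ x : ℂ, |x.re| ≤ |ζ.re| * n → ‖Complex.exp x‖ ≤ Real.exp (|ζ.re| * n) := fun x hx => by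
    rw [Complex.norm_exp]
    exact Real.exp_le_exp.2 ((le_abs_self _).trans hx)
  have h1 : |((n : ℂ) * ζ).re| ≤ |ζ.re| * n := by simp [abs_mul, mul_comm]
  have h2 : |(-((n : ℂ) * ζ)).re| ≤ |ζ.re| * n := by simp [abs_mul, mul_comm]
  rw [Complex.cosh, norm_div, Complex.norm_ofNat, div_le_iff₀ two_pos]
  linarith [norm_add_le (Complex.exp (n * ζ)) (Complex.exp (-(n * ζ))), h _ h1, h _ h2]

theorem norm_sinh_natCast_mul_le (n : ℕ) (ζ : ℂ) :
    ‖Complex.sinh (n * ζ)‖ ≤ Real.exp (|ζ.re| * n) := by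
  have h : ∀ x : ℂ, |x.re| ≤ |ζ.re| * n → ‖Complex.exp x‖ ≤ Real.exp (|ζ.re| * n) := fun x hx => by
    rw [Complex.norm_exp]
    exact Real.exp_le_exp.2 ((le_abs_self _).trans hx)
  have h1 : |((n : ℂ) * ζ).re| ≤ |ζ.re| * n := by simp [abs_mul, mul_comm]
  have h2 : |(-((n : ℂ) * ζ)).re| ≤ |ζ.re| * n := by simp [abs_mul, mul_comm]
  rw [Complex.sinh, norm_div, Complex.norm_ofNat, div_le_iff₀ two_pos]
  linarith [norm_sub_le (Complex.exp (n * ζ)) (Complex.exp (-(n * ζ))), h _ h1, h _ h2]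

theorem summable_mul_exp_neg (M : ℝ) {b : ℝ} (hb : 0 < b) :
    Summable fun n : ℕ => M * Real.exp (-b * n) := by
  have h := (summable_geometric_of_lt_one (Real.exp_pos (-b)).le
    (by rw [Real.exp_lt_one_iff]; linarith)).mul_left M
  refine h.congr fun n => ?_
  rw [← Real.exp_nat_mul, mul_comm (n : ℝ)]

section Cheb

variable {R M b : ℝ} {c : ℕ → ℂ}

theorem norm_mul_cosh_le (hc : ∀ n, ‖c n‖ ≤ M * Real.exp (-b * n)) {b' : ℝ} {ζ : ℂ}
    (hζ : |ζ.re| ≤ b') (n : ℕ) :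
    ‖c n * Complex.cosh (n * ζ)‖ ≤ M * Real.exp (-(b - b') * n) := by
  rw [norm_mul, show -(b - b') * (n : ℝ) = -b * n + b' * n by ring, Real.exp_add, ← mul_assoc]
  exact mul_le_mul (hc n) ((norm_cosh_natCast_mul_le n ζ).trans
    (Real.exp_le_exp.2 (by gcongr))) (norm_nonneg _) ((norm_nonneg _).trans (hc n))

theorem hasSum_chebSeries (hR : 0 < R) (hc : ∀ n, ‖c n‖ ≤ M * Real.exp (-b * n)) {ζ : ℂ}
    (hζ : |ζ.re| < b) :
    HasSum (fun n : ℕ => c n * Complex.cosh (n * ζ)) (chebSeries R c (ellipticMap R ζ)) := by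
  have h : Summable fun n : ℕ => c n * Complex.cosh (n * ζ) :=
    Summable.of_norm_bounded (summable_mul_exp_neg M (sub_pos.2 hζ))
      (norm_mul_cosh_le hc le_rfl)
  simpa only [chebSeries, chebyshev_eval_ellipticMap hR] using h.hasSum

/-- The terms are bounded by a geometric series on every strictly smaller confocal ellipse, and
holomorphy is local. -/
theorem differentiableOn_chebSeries (hR : 0 < R) (hb : 0 < b)
    (hc : ∀ n, ‖c n‖ ≤ M * Real.exp (-b * n)) :
    DifferentiableOn ℂ (chebSeries R c) (complexEllipse R b) := by
  intro w hw
  obtain ⟨ζ, h0, -, rfl⟩ := exists_ellipticMap_eq hR w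
  rw [ellipticMap_mem_complexEllipse hR hb.le] at hw
  obtain ⟨b', h1, h2⟩ := exists_between hw
  have hb' : 0 ≤ b' := (abs_nonneg _).trans h1.le
  have hd : DifferentiableOn ℂ (chebSeries R c) (complexEllipse R b') := by
    refine Complex.differentiableOn_tsum_of_summable_norm (summable_mul_exp_neg M (sub_pos.2 h2))
      (fun n => ?_) (isOpen_complexEllipse R b') fun n w hw => ?_
    · refine Differentiable.differentiableOn (Differentiable.const_mul ?_ _)
      exact (Polynomial.differentiable (Polynomial.Chebyshev.T ℂ n)).comp (g := fun w => _) (f := fun w : ℂ => w / R) (by fun_prop)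
    · obtain ⟨ξ, -, -, rfl⟩ := exists_ellipticMap_eq hR w
      rw [ellipticMap_mem_complexEllipse hR hb'] at hw
      rw [chebyshev_eval_ellipticMap hR]
      exact norm_mul_cosh_le hc hw.le n
  exact (hd.differentiableAt ((isOpen_complexEllipse R b').mem_nhds
    ((ellipticMap_mem_complexEllipse hR hb').2 h1))).differentiableWithinAt

/-- The series is differentiated termwise in `ζ`, where the terms are hyperbolic cosines; the chain
rule identifies the sum without derivatives of Chebyshev polynomials. -/
theorem hasSum_deriv_chebSeries (hR : 0 < R) (hc : ∀ n, ‖c n‖ ≤ M * Real.exp (-b * n)) {ζ : ℂ}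
    (hζ : |ζ.re| < b) :
    HasSum (fun n : ℕ => c n * (n * Complex.sinh (n * ζ)))
      (deriv (chebSeries R c) (ellipticMap R ζ) * (R * Complex.sinh ζ)) := by
  obtain ⟨b', h1, h2⟩ := exists_between hζ
  have hb : 0 < b := (abs_nonneg _).trans_lt hζ
  have hopen : IsOpen {ζ : ℂ | |ζ.re| < b'} :=
    isOpen_lt (continuous_abs.comp Complex.continuous_re) continuous_const
  have hderiv : ∀ n : ℕ, ∀ ζ : ℂ, HasDerivAt (fun ζ : ℂ => c n * Complex.cosh (n * ζ))
      (c n * (n * Complex.sinh (n * ζ))) ζ := fun n ζ => by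
    have h : HasDerivAt (fun ζ : ℂ => (n : ℂ) * ζ) n ζ := by
      simpa using (hasDerivAt_id ζ).const_mul (n : ℂ)
    simpa [mul_comm] using h.ccosh.const_mul (c n)
  have h := Complex.hasSum_deriv_of_summable_norm (summable_mul_exp_neg M (sub_pos.2 h2))
    (fun n => (show Differentiable ℂ (fun ζ : ℂ => c n * Complex.cosh (n * ζ)) from
      fun ζ => (hderiv n ζ).differentiableAt).differentiableOn) hopen
    (fun n ξ (hξ : |ξ.re| < b') => norm_mul_cosh_le hc hξ.le n) h1
  simp only [(hderiv _ ζ).deriv] at h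
  have hcheb : HasDerivAt (chebSeries R c) (deriv (chebSeries R c) (ellipticMap R ζ))
      (ellipticMap R ζ) :=
    ((differentiableOn_chebSeries hR hb hc).differentiableAt ((isOpen_complexEllipse R b).mem_nhds
      ((ellipticMap_mem_complexEllipse hR hb.le).2 hζ))).hasDerivAt
  have heq : (fun ζ : ℂ => ∑' n : ℕ, c n * Complex.cosh (n * ζ)) =
      chebSeries R c ∘ ellipticMap R := by
    ext ξ
    simp only [Function.comp_apply, chebSeries, chebyshev_eval_ellipticMap hR]
  rwa [heq, (hcheb.comp ζ (hasDerivAt_ellipticMap R ζ)).deriv] at h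

end Cheb

/-! ### Series in `e^{-ζ}`, holomorphic outside an ellipse. -/

/-- The holomorphic function on the complement of the focal segment that is `e^{-ζ}` in elliptic
coordinates. -/
noncomputable def inverseJoukowski (R : ℝ) (w : ℂ) : ℂ :=
  w / R * (1 - (1 - (R / w) ^ 2) ^ (2⁻¹ : ℂ))

theorem cosh_ne_zero_of_re_pos {ζ : ℂ} (h : 0 < ζ.re) : Complex.cosh ζ ≠ 0 := fun h0 => by
  have h1 := norm_cosh_sub_one ζ
  have h2 := norm_cosh_add_one ζ
  rw [h0] at h1 h2
  simp at h1 h2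
  linarith [Real.one_lt_cosh.2 h.ne']

/-- This selects the branch in `inverseJoukowski`: the principal square root of `tanh² ζ` is `tanh
ζ`. The reason is that `sinh ζ conj (cosh ζ)` has real part `sinh (2 Re ζ) / 2`. -/
theorem tanh_re_pos {ζ : ℂ} (h : 0 < ζ.re) : 0 < (Complex.sinh ζ / Complex.cosh ζ).re := by
  have hc := cosh_ne_zero_of_re_pos h
  have e : Complex.sinh ζ * conj (Complex.cosh ζ) =
      (Complex.sinh (2 * ζ.re) + Complex.sinh (2 * (ζ.im * Complex.I))) / 2 := by
    have hζ : ζ + conj ζ = 2 * ζ.re := by rw [Complex.add_conj]; push_cast; ring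
    have hζ' : ζ - conj ζ = 2 * (ζ.im * Complex.I) := by rw [Complex.sub_conj]; push_cast; ring
    rw [← Complex.cosh_conj, ← hζ, ← hζ', Complex.sinh_add, Complex.sinh_sub]
    ring
  have e2 : Complex.sinh ζ / Complex.cosh ζ =
      ((Complex.normSq (Complex.cosh ζ))⁻¹ : ℝ) * (Complex.sinh ζ * conj (Complex.cosh ζ)) := by
    rw [div_eq_mul_inv, Complex.inv_def]
    ring
  rw [e2, Complex.re_ofReal_mul, e]
  refine mul_pos (inv_pos.2 (Complex.normSq_pos.2 hc)) ?_
  have h3 : Complex.sinh (2 * (ζ.im * Complex.I)) = ((Real.sin (2 * ζ.im) : ℝ) : ℂ) * Complex.I := by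
    rw [← mul_assoc, Complex.sinh_mul_I]; push_cast; rfl
  have h4 : Complex.sinh (2 * ζ.re) = ((Real.sinh (2 * ζ.re) : ℝ) : ℂ) := by push_cast; rfl
  have h5 : (((Real.sinh (2 * ζ.re) : ℝ) : ℂ) + ((Real.sin (2 * ζ.im) : ℝ) : ℂ) * Complex.I) / 2 =
      ((Real.sinh (2 * ζ.re) / 2 : ℝ) : ℂ) + ((Real.sin (2 * ζ.im) / 2 : ℝ) : ℂ) * Complex.I := by
    push_cast
    ring
  rw [h3, h4, h5, Complex.add_re, Complex.ofReal_re, Complex.re_ofReal_mul, Complex.I_re, mul_zero, add_zero]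
  have := Real.sinh_pos_iff.2 (show 0 < 2 * ζ.re by linarith)
  positivity

theorem one_sub_sq_div_ellipticMap {R : ℝ} (hR : 0 < R) {ζ : ℂ} (h : 0 < ζ.re) :
    1 - (R / ellipticMap R ζ) ^ 2 = (Complex.sinh ζ / Complex.cosh ζ) ^ 2 := by
  have hc := cosh_ne_zero_of_re_pos h
  have hR' : (R : ℂ) ≠ 0 := by exact_mod_cast hR.ne'
  rw [ellipticMap]
  field_simp
  rw [Complex.cosh_sq]
  ring

/-- `e^{-ζ} = cosh ζ - sinh ζ = cosh ζ (1 - tanh ζ)`, and `tanh ζ` is the principal root of `1 -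
(R/w)²`. -/
theorem inverseJoukowski_ellipticMap {R : ℝ} (hR : 0 < R) {ζ : ℂ} (h : 0 < ζ.re) :
    inverseJoukowski R (ellipticMap R ζ) = Complex.exp (-ζ) := by
  have hc := cosh_ne_zero_of_re_pos h
  have hR' : (R : ℂ) ≠ 0 := by exact_mod_cast hR.ne'
  rw [inverseJoukowski, one_sub_sq_div_ellipticMap hR h, Complex.sq_cpow_two_inv (tanh_re_pos h),
    ellipticMap, mul_div_cancel_left₀ _ hR', ← Complex.cosh_sub_sinh]
  field_simp

/-- The exterior of the ellipse of elliptic radius `ρ`. -/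
def complexExterior (R ρ : ℝ) : Set ℂ := {w | 2 * R * Real.cosh ρ < focalSum R w}

theorem isOpen_complexExterior (R ρ : ℝ) : IsOpen (complexExterior R ρ) :=
  isOpen_lt continuous_const (continuous_focalSum R)

theorem ellipticMap_mem_complexExterior {R : ℝ} (hR : 0 < R) {ρ : ℝ} (hρ : 0 ≤ ρ) {ζ : ℂ} :
    ellipticMap R ζ ∈ complexExterior R ρ ↔ ρ < |ζ.re| := by
  have := (focalSum_ellipticMap_le hR hρ ζ).not
  rw [not_le, not_le] at this
  exact this

theorem differentiableOn_inverseJoukowski {R : ℝ} (hR : 0 < R) :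
    DifferentiableOn ℂ (inverseJoukowski R) (complexExterior R 0) := by
  intro w hw
  obtain ⟨ζ, h0, -, rfl⟩ := exists_ellipticMap_eq hR w
  rw [ellipticMap_mem_complexExterior hR le_rfl, abs_of_nonneg h0] at hw
  have hR' : (R : ℂ) ≠ 0 := by exact_mod_cast hR.ne'
  have hw0 : ellipticMap R ζ ≠ 0 := mul_ne_zero hR' (cosh_ne_zero_of_re_pos hw)
  have hslit : 1 - (R / ellipticMap R ζ) ^ 2 ∈ Complex.slitPlane := by
    rw [one_sub_sq_div_ellipticMap hR hw, Complex.mem_slitPlane_iff]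
    have := tanh_re_pos hw
    set t := Complex.sinh ζ / Complex.cosh ζ
    by_cases him : t.im = 0
    · left
      simp [sq, him]
      positivity
    · right
      simp only [sq, Complex.mul_im]
      intro h
      have : 2 * (t.re * t.im) = 0 := by linarith
      simp [him] at this
      linarith
  refine DifferentiableAt.differentiableWithinAt ?_
  unfold inverseJoukowski
  refine DifferentiableAt.mul (by fun_prop) ((differentiableAt_const _).sub ?_)
  refine DifferentiableAt.cpow ?_ (differentiableAt_const _) hslit
  refine (differentiableAt_const _).sub (DifferentiableAt.pow ?_ 2)
  exact (differentiableAt_const _).div differentiableAt_id hw0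

/-- The series `∑ cₙ e^{-nζ}` as a function of `w = R cosh ζ`. -/
noncomputable def invSeries (R : ℝ) (c : ℕ → ℂ) (w : ℂ) : ℂ :=
  ∑' n : ℕ, c n * inverseJoukowski R w ^ n

section Inv

variable {R M b : ℝ} {c : ℕ → ℂ}

theorem norm_mul_exp_pow_le (hc : ∀ n, ‖c n‖ ≤ M * Real.exp (b * n)) {b' : ℝ} {ζ : ℂ}
    (hζ : b' ≤ ζ.re) (n : ℕ) :
    ‖c n * Complex.exp (-ζ) ^ n‖ ≤ M * Real.exp (-(b' - b) * n) := by
  rw [norm_mul, norm_pow, Complex.norm_exp, ← Real.exp_nat_mul,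
    show -(b' - b) * (n : ℝ) = b * n + n * -b' by ring, Real.exp_add, ← mul_assoc]
  refine mul_le_mul (hc n) (Real.exp_le_exp.2 ?_) (Real.exp_pos _).le
    ((norm_nonneg _).trans (hc n))
  rw [Complex.neg_re]
  gcongr

theorem hasSum_invSeries (hR : 0 < R) (hc : ∀ n, ‖c n‖ ≤ M * Real.exp (b * n)) {ζ : ℂ}
    (h0 : 0 < ζ.re) (hζ : b < ζ.re) :
    HasSum (fun n : ℕ => c n * Complex.exp (-ζ) ^ n) (invSeries R c (ellipticMap R ζ)) := by
  have h : Summable fun n : ℕ => c n * Complex.exp (-ζ) ^ n :=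
    Summable.of_norm_bounded (summable_mul_exp_neg M (sub_pos.2 hζ))
      (norm_mul_exp_pow_le hc le_rfl)
  simpa only [invSeries, inverseJoukowski_ellipticMap hR h0] using h.hasSum

theorem differentiableOn_invSeries (hR : 0 < R) (hc : ∀ n, ‖c n‖ ≤ M * Real.exp (b * n)) {ρ : ℝ}
    (hρ : 0 ≤ ρ) (hb : b ≤ ρ) :
    DifferentiableOn ℂ (invSeries R c) (complexExterior R ρ) := by
  intro w hw
  obtain ⟨ζ, h0, -, rfl⟩ := exists_ellipticMap_eq hR w
  rw [ellipticMap_mem_complexExterior hR hρ, abs_of_nonneg h0] at hw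
  obtain ⟨b', h1, h2⟩ := exists_between hw
  have hb' : 0 ≤ b' := hρ.trans h1.le
  have hd : DifferentiableOn ℂ (invSeries R c) (complexExterior R b') := by
    refine Complex.differentiableOn_tsum_of_summable_norm
      (summable_mul_exp_neg M (sub_pos.2 (hb.trans_lt h1)))
      (fun n => ?_) (isOpen_complexExterior R b') fun n w hw => ?_
    · refine DifferentiableOn.const_mul (DifferentiableOn.pow ?_ n) _
      refine (differentiableOn_inverseJoukowski hR).mono fun w hw => ?_
      refine lt_of_le_of_lt ?_ (show 2 * R * Real.cosh b' < focalSum R w from hw)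
      have := (Real.cosh_le_cosh (x := 0) (y := b')).2 (by simp)
      gcongr
    · obtain ⟨ξ, hξ, -, rfl⟩ := exists_ellipticMap_eq hR w
      rw [ellipticMap_mem_complexExterior hR hb', abs_of_nonneg hξ] at hw
      rw [inverseJoukowski_ellipticMap hR (hb'.trans_lt hw)]
      exact norm_mul_exp_pow_le hc hw.le n
  exact (hd.differentiableAt ((isOpen_complexExterior R b').mem_nhds
    ((ellipticMap_mem_complexExterior hR hb').2 (by rwa [abs_of_nonneg h0])))).differentiableWithinAt

theorem isBigO_invSeries (hR : 0 < R) (hc : ∀ n, ‖c n‖ ≤ M * Real.exp (b * n)) (hc0 : c 0 = 0) :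
    invSeries R c =O[Bornology.cobounded ℂ] fun w => ‖w‖⁻¹ := by
  -- The shift by one leaves a margin for a convergent majorant at `b'` and keeps `b'` positive.
  set b' := max b 0 + 1 with hb'
  have hb0 : 0 < b' := by positivity
  have hbb : 0 < b' - b := by linarith [le_max_left b 0]
  have hs := summable_mul_exp_neg M hbb
  refine Asymptotics.IsBigO.of_bound
    ((∑' n : ℕ, M * Real.exp (-(b' - b) * n)) * Real.exp b' * R) ?_
  filter_upwards [tendsto_norm_cobounded_atTop.eventually_gt_atTop (R * Real.cosh b')] with w hw
  obtain ⟨ζ, h0, -, rfl⟩ := exists_ellipticMap_eq hR w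
  have hfs := focalSum_ellipticMap hR ζ
  have htri : 2 * ‖ellipticMap R ζ‖ ≤ focalSum R (ellipticMap R ζ) := by
    have := norm_add_le (ellipticMap R ζ - R) (ellipticMap R ζ + R)
    rw [show ellipticMap R ζ - R + (ellipticMap R ζ + R) = 2 * ellipticMap R ζ by ring, norm_mul,
      Complex.norm_ofNat] at this
    exact this
  have hρ : b' < ζ.re := by
    have h1 : R * Real.cosh b' < R * Real.cosh ζ.re := by linarith
    have h2 := Real.cosh_lt_cosh.1 (lt_of_mul_lt_mul_left h1 hR.le)
    rwa [abs_of_pos hb0, abs_of_nonneg h0] at h2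
  have hζ0 : 0 < ζ.re := hb0.trans hρ
  have hsum := hasSum_invSeries hR hc hζ0 (by linarith)
  have hw0 : 0 < ‖ellipticMap R ζ‖ := lt_trans (by positivity) hw
  -- From the focal sum, `|w| ≤ R cosh ρ ≤ R e^ρ`.
  have hdec : Real.exp (-ζ.re) ≤ R * ‖ellipticMap R ζ‖⁻¹ := by
    rw [Real.exp_neg, ← div_eq_mul_inv, inv_eq_one_div, div_le_div_iff₀ (Real.exp_pos _) hw0]
    have h1 : Real.cosh ζ.re ≤ Real.exp ζ.re := by
      rw [← Real.cosh_add_sinh]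
      linarith [Real.sinh_nonneg_iff.2 h0]
    nlinarith
  rw [norm_inv, norm_norm, mul_assoc _ R]
  -- As `c 0 = 0`, each surviving term has `n ≥ 1`, so one factor `e^{-ρ}` can be split off, the
  -- other `n - 1` being estimated at `b' < ρ`.
  have hbound : ∀ n : ℕ, ‖c n * Complex.exp (-ζ) ^ n‖ ≤
      M * Real.exp (-(b' - b) * n) * (Real.exp b' * Real.exp (-ζ.re)) := fun n => by
    have hM : 0 ≤ M * Real.exp (b * n) := (norm_nonneg _).trans (hc n)
    rcases Nat.eq_zero_or_pos n with rfl | hn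
    · rw [hc0, zero_mul, norm_zero]
      simp only [Nat.cast_zero, mul_zero, Real.exp_zero, mul_one] at hM ⊢
      positivity
    · refine (norm_mul_exp_pow_le hc le_rfl n).trans ?_
      rw [show -(ζ.re - b) * (n : ℝ) = b * n + -ζ.re * n by ring,
        show -(b' - b) * (n : ℝ) = b * n + -b' * n by ring, Real.exp_add, Real.exp_add,
        ← Real.exp_add b', ← mul_assoc, ← mul_assoc, mul_assoc (M * _), ← Real.exp_add]
      refine mul_le_mul_of_nonneg_left (Real.exp_le_exp.2 ?_) hM
      have : (1 : ℝ) ≤ n := by exact_mod_cast hn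
      nlinarith
  have h1 := tsum_of_norm_bounded (hs.hasSum.mul_right (Real.exp b' * Real.exp (-ζ.re))) hbound
  rw [hsum.tsum_eq] at h1
  refine h1.trans ?_
  have hS : 0 ≤ ∑' n : ℕ, M * Real.exp (-(b' - b) * n) := tsum_nonneg fun n => by
    have hM : 0 ≤ M := by simpa using (norm_nonneg _).trans (hc 0)
    positivity
  rw [← mul_assoc]
  gcongr

end Inv

/-! ### Dipole expansion and the transmission system for the coefficients. -/

/-- The coefficients of the expansion of `A / (w - R cosh ζz)` in Chebyshev polynomials. -/
noncomputable def dipoleCoeff (R : ℝ) (A ζz : ℂ) (n : ℕ) : ℂ :=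
  (if n = 0 then 1 / 2 else 1) * (-2 * A / (R * Complex.sinh ζz)) * Complex.exp (-(n * ζz))

theorem norm_dipoleCoeff_le (R : ℝ) (A ζz : ℂ) (n : ℕ) :
    ‖dipoleCoeff R A ζz n‖ ≤ ‖-2 * A / (R * Complex.sinh ζz)‖ * Real.exp (-ζz.re * n) := by
  have h : ‖(if n = 0 then 1 / 2 else 1 : ℂ)‖ ≤ 1 := by
    split_ifs <;> norm_num
  rw [dipoleCoeff, norm_mul, norm_mul, Complex.norm_exp]
  have e : (-((n : ℂ) * ζz)).re = -ζz.re * n := by simp [mul_comm]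
  rw [e]
  refine mul_le_mul_of_nonneg_right ?_ (Real.exp_pos _).le
  exact mul_le_of_le_one_left (norm_nonneg _) h

theorem sinh_ne_zero_of_re_pos {ζ : ℂ} (h : 0 < ζ.re) : Complex.sinh ζ ≠ 0 := fun h0 => by
  have := tanh_re_pos h
  rw [h0, zero_div, Complex.zero_re] at this
  exact lt_irrefl _ this

/-- With `x = e^{ζ - ζz}` and `y = e^{-ζ - ζz}`, the difference `cosh ζ - cosh ζz` equals
`-(e^{ζz}/2)(1 - x)(1 - y)`. Its reciprocal is a combination of two geometric series because `(1 -
x)⁻¹ + (1 - y)⁻¹ - 1 = (1 - xy)/((1 - x)(1 - y))` and `xy = e^{-2ζz}`. The `-1` accounts for the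
halved zeroth coefficient. -/
theorem hasSum_dipoleCoeff {R : ℝ} (hR : 0 < R) (A : ℂ) {ζz ζ : ℂ} (hζ : |ζ.re| < ζz.re) :
    HasSum (fun n : ℕ => dipoleCoeff R A ζz n * Complex.cosh (n * ζ))
      (A / (ellipticMap R ζ - ellipticMap R ζz)) := by
  obtain ⟨h1, h2⟩ := abs_lt.1 hζ
  have hz : 0 < ζz.re := (abs_nonneg _).trans_lt hζ
  have hR' : (R : ℂ) ≠ 0 := by exact_mod_cast hR.ne'
  have hsz := sinh_ne_zero_of_re_pos hz
  set B := -2 * A / (R * Complex.sinh ζz) with hB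
  set x := Complex.exp (ζ - ζz) with hx
  set y := Complex.exp (-ζ - ζz) with hy
  have hx1 : ‖x‖ < 1 := by
    rw [hx, Complex.norm_exp, Real.exp_lt_one_iff, Complex.sub_re]; linarith
  have hy1 : ‖y‖ < 1 := by
    rw [hy, Complex.norm_exp, Real.exp_lt_one_iff, Complex.sub_re, Complex.neg_re]; linarith
  have hx0 : 1 - x ≠ 0 := fun h => by
    rw [← sub_eq_zero.1 h, norm_one] at hx1; exact lt_irrefl _ hx1
  have hy0 : 1 - y ≠ 0 := fun h => by
    rw [← sub_eq_zero.1 h, norm_one] at hy1; exact lt_irrefl _ hy1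
  have hs := (((hasSum_geometric_of_norm_lt_one hx1).add
    (hasSum_geometric_of_norm_lt_one hy1)).mul_left (B / 2)).sub (hasSum_ite_eq (0 : ℕ) (B / 2))
  have hfun : (fun n : ℕ => dipoleCoeff R A ζz n * Complex.cosh (n * ζ)) =
      fun n : ℕ => B / 2 * (x ^ n + y ^ n) - if n = 0 then B / 2 else 0 := by
    ext n
    rcases eq_or_ne n 0 with rfl | hn
    · simp [dipoleCoeff]
      ring
    · rw [dipoleCoeff, if_neg hn, if_neg hn, ← hB, hx, hy, ← Complex.exp_nat_mul,
        ← Complex.exp_nat_mul, mul_sub, mul_sub, Complex.exp_sub, Complex.exp_sub, Complex.cosh,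
        Complex.exp_neg (n * ζz)]
      field_simp
      ring
  rw [hfun]
  suffices h : A / (ellipticMap R ζ - ellipticMap R ζz) =
      B / 2 * ((1 - x)⁻¹ + (1 - y)⁻¹) - B / 2 by
    rw [h]
    exact hs
  set E := Complex.exp ζ with hE
  set Z := Complex.exp ζz with hZ
  have hE0 : E ≠ 0 := Complex.exp_ne_zero _
  have hZ0 : Z ≠ 0 := Complex.exp_ne_zero _
  have hxE : x = E / Z := by rw [hx, Complex.exp_sub]
  have hyE : y = 1 / (E * Z) := by
    rw [hy, Complex.exp_sub, Complex.exp_neg, ← hE, ← hZ]; field_simp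
  have hchE : Complex.cosh ζ = (E + E⁻¹) / 2 := by rw [Complex.cosh, Complex.exp_neg]
  have hchZ : Complex.cosh ζz = (Z + Z⁻¹) / 2 := by rw [Complex.cosh, Complex.exp_neg]
  have hshZ : Complex.sinh ζz = (Z - Z⁻¹) / 2 := by rw [Complex.sinh, Complex.exp_neg]
  have hden : ellipticMap R ζ - ellipticMap R ζz = -(R * Z / 2) * ((1 - x) * (1 - y)) := by
    rw [ellipticMap, ellipticMap, hchE, hchZ, hxE, hyE]
    field_simp
    ring
  have hB' : A = -(R * Complex.sinh ζz) * B / 2 := by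
    rw [hB]; field_simp
  rw [hden, hB', hshZ]
  field_simp
  rw [hxE, hyE]
  field_simp
  ring

/-- The coefficients of the field inside the ellipse. -/
noncomputable def innerCoeff (κ : ℂ) (εm ρ₀ : ℝ) (β : ℕ → ℂ) (n : ℕ) : ℂ :=
  εm * ((εm + κ) * β n - (εm - κ) * Real.exp (-(2 * ρ₀) * n) * conj (β n)) /
    ((εm + κ) ^ 2 - (εm - κ) ^ 2 * (Real.exp (-(2 * ρ₀) * n) : ℂ) ^ 2)

/-- The coefficients of the scattered field outside the ellipse. -/
noncomputable def outerCoeff (κ : ℂ) (εm ρ₀ : ℝ) (g : ℕ → ℂ) (n : ℕ) : ℂ :=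
  (εm - κ) * (Real.exp (2 * ρ₀ * n) - Real.exp (-(2 * ρ₀) * n) : ℝ) * g n / (4 * εm)

/-- The denominator factors into two real combinations of `εm` and `κ`, and these are linearly
independent over ℝ for nonreal `κ`. The closed interval includes the limit `X = 0`, so compactness
gives a bound uniform in `n`. -/
theorem innerCoeff_den_ne_zero {κ : ℂ} {εm : ℝ} (hεm : 0 < εm) (hκ : κ.im ≠ 0) {X : ℝ}
    (hX : X ∈ Set.Icc (0 : ℝ) 1) : (εm + κ) ^ 2 - (εm - κ) ^ 2 * (X : ℂ) ^ 2 ≠ 0 := by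
  have key : ∀ p q : ℝ, (p ≠ 0 ∨ q ≠ 0) → εm * p + κ * q ≠ 0 := fun p q hpq h => by
    have him := congrArg Complex.im h
    have hre := congrArg Complex.re h
    simp at him hre
    have hq : q = 0 := him.resolve_left hκ
    subst hq
    simp at hre
    rcases hre with h | h
    · exact hεm.ne' h
    · simp [h] at hpq
  have e : (εm + κ) ^ 2 - (εm - κ) ^ 2 * (X : ℂ) ^ 2 =
      (εm * ((1 + X : ℝ) : ℂ) + κ * ((1 - X : ℝ) : ℂ)) *
        (εm * ((1 - X : ℝ) : ℂ) + κ * ((1 + X : ℝ) : ℂ)) := by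
    push_cast
    ring
  have hX1 : (1 + X : ℝ) ≠ 0 := by linarith [hX.1]
  rw [e]
  exact mul_ne_zero (key _ _ (Or.inl hX1)) (key _ _ (Or.inr hX1))

theorem exp_neg_mem_Icc {ρ₀ : ℝ} (hρ₀ : 0 < ρ₀) (n : ℕ) :
    Real.exp (-(2 * ρ₀) * n) ∈ Set.Icc (0 : ℝ) 1 :=
  ⟨(Real.exp_pos _).le, Real.exp_le_one_iff.2 (by
    have : (0 : ℝ) ≤ n := n.cast_nonneg
    nlinarith)⟩

section Coeff

variable {κ : ℂ} {εm ρ₀ : ℝ} {β : ℕ → ℂ} {M b : ℝ}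

/-- This is the equation for the coefficient of `e^{nζ}` in the reflection identity. Conjugating `β`
but not `κ` gives its companion; together they are the 2 × 2 system that `innerCoeff` solves. -/
theorem innerCoeff_eq (hεm : 0 < εm) (hκ : κ.im ≠ 0) (hρ₀ : 0 < ρ₀) (n : ℕ) :
    (εm + κ) * innerCoeff κ εm ρ₀ β n +
      (εm - κ) * Real.exp (-(2 * ρ₀) * n) * innerCoeff κ εm ρ₀ (fun n => conj (β n)) n =
      εm * β n := by
  have h := innerCoeff_den_ne_zero hεm hκ (exp_neg_mem_Icc hρ₀ n)
  rw [innerCoeff, innerCoeff, Complex.conj_conj, ← mul_div_assoc, ← mul_div_assoc, ← add_div,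
    div_eq_iff h]
  ring

theorem exists_norm_innerCoeff_le (hεm : 0 < εm) (hκ : κ.im ≠ 0) (hρ₀ : 0 < ρ₀)
    (hβ : ∀ n, ‖β n‖ ≤ M * Real.exp (-b * n)) :
    ∃ M', ∀ n, ‖innerCoeff κ εm ρ₀ β n‖ ≤ M' * Real.exp (-b * n) := by
  have hcont : ContinuousOn (fun X : ℝ => ‖((εm + κ) ^ 2 - (εm - κ) ^ 2 * (X : ℂ) ^ 2)⁻¹‖)
      (Set.Icc 0 1) := by
    refine ContinuousOn.norm (ContinuousOn.inv₀ (Continuous.continuousOn (by fun_prop)) ?_)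
    exact fun X hX => innerCoeff_den_ne_zero hεm hκ hX
  obtain ⟨C, hC⟩ := isCompact_Icc.exists_bound_of_continuousOn hcont
  refine ⟨εm * (‖(εm : ℂ) + κ‖ + ‖(εm : ℂ) - κ‖) * C * M, fun n => ?_⟩
  have hX := exp_neg_mem_Icc hρ₀ n
  have hC' := hC _ hX
  rw [norm_norm] at hC'
  have hC0 : 0 ≤ C := (norm_nonneg _).trans hC'
  rw [innerCoeff, div_eq_mul_inv, norm_mul, norm_mul, Complex.norm_real,
    Real.norm_of_nonneg hεm.le]
  have h1 : ‖(εm + κ) * β n - (εm - κ) * Real.exp (-(2 * ρ₀) * n) * conj (β n)‖ ≤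
      (‖(εm : ℂ) + κ‖ + ‖(εm : ℂ) - κ‖) * ‖β n‖ := by
    refine (norm_sub_le _ _).trans ?_
    rw [norm_mul, norm_mul, norm_mul, RCLike.norm_conj, add_mul, Complex.norm_real,
      Real.norm_of_nonneg hX.1]
    have := mul_le_of_le_one_right (norm_nonneg ((εm : ℂ) - κ)) hX.2
    have h2 := norm_nonneg (β n)
    gcongr
  calc εm * ‖(εm + κ) * β n - (εm - κ) * Real.exp (-(2 * ρ₀) * n) * conj (β n)‖ * _
      ≤ εm * ((‖(εm : ℂ) + κ‖ + ‖(εm : ℂ) - κ‖) * (M * Real.exp (-b * n))) * C := by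
        have h2 := h1.trans (mul_le_mul_of_nonneg_left (hβ n) (by positivity))
        exact mul_le_mul (mul_le_mul_of_nonneg_left h2 hεm.le) hC' (norm_nonneg _)
          (mul_nonneg hεm.le ((norm_nonneg _).trans h2))
    _ = _ := by ring

/-- The factor `e^{2ρ₀ n}` comes from the reflection in the interface. It shows that the scattered
field continues across the interface down to elliptic radius `2ρ₀ - b`, as long as this is positive.
-/
theorem norm_outerCoeff_le (hεm : 0 < εm) (hρ₀ : 0 < ρ₀) {g : ℕ → ℂ}
    (hg : ∀ n, ‖g n‖ ≤ M * Real.exp (-b * n)) (n : ℕ) :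
    ‖outerCoeff κ εm ρ₀ g n‖ ≤ ‖(εm : ℂ) - κ‖ / (4 * εm) * M * Real.exp ((2 * ρ₀ - b) * n) := by
  have hX := exp_neg_mem_Icc hρ₀ n
  have h1 : ‖((Real.exp (2 * ρ₀ * n) - Real.exp (-(2 * ρ₀) * n) : ℝ) : ℂ)‖ ≤
      Real.exp (2 * ρ₀ * n) := by
    rw [Complex.norm_real, Real.norm_of_nonneg]
    · linarith [hX.1]
    · have : 1 ≤ Real.exp (2 * ρ₀ * n) := Real.one_le_exp (by positivity)
      linarith [hX.2]
  have h4 : ‖(4 * εm : ℂ)‖ = 4 * εm := by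
    rw [norm_mul, Complex.norm_ofNat, Complex.norm_real, Real.norm_of_nonneg hεm.le]
  rw [outerCoeff, norm_div, norm_mul, norm_mul, h4,
    show (2 * ρ₀ - b) * (n : ℝ) = 2 * ρ₀ * n + -b * n by ring, Real.exp_add]
  have := hg n
  calc ‖(εm : ℂ) - κ‖ * ‖((Real.exp (2 * ρ₀ * n) - Real.exp (-(2 * ρ₀) * n) : ℝ) : ℂ)‖ * ‖g n‖ /
        (4 * εm)
      ≤ ‖(εm : ℂ) - κ‖ * Real.exp (2 * ρ₀ * n) * (M * Real.exp (-b * n)) / (4 * εm) := by gcongr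
    _ = _ := by ring

end Coeff

/-! ### Inner and scattered fields, and the reflection identity. -/

/-- The field inside the ellipse. -/
noncomputable def innerField (R : ℝ) (κ : ℂ) (εm ρ₀ : ℝ) (β : ℕ → ℂ) (w : ℂ) : ℂ :=
  chebSeries R (innerCoeff κ εm ρ₀ β) w +
    conj (chebSeries R (fun n => conj (innerCoeff κ εm ρ₀ (fun n => conj (β n)) n)) w)

/-- The scattered field outside the ellipse. -/
noncomputable def scatteredField (R : ℝ) (κ : ℂ) (εm ρ₀ : ℝ) (β : ℕ → ℂ) (w : ℂ) : ℂ :=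
  invSeries R (outerCoeff κ εm ρ₀ (innerCoeff κ εm ρ₀ fun n => conj (β n))) w +
    conj (invSeries R (fun n => conj (outerCoeff κ εm ρ₀ (innerCoeff κ εm ρ₀ β) n)) w)

/-- The field of a dipole with moment `A` at `wz`. -/
noncomputable def complexDipole (A wz w : ℂ) : ℂ := ((A / (w - wz)).re : ℂ)

section Field

variable {R : ℝ} {κ : ℂ} {εm ρ₀ : ℝ} {β : ℕ → ℂ} {M b : ℝ}

theorem exists_norm_coeffs_le (hεm : 0 < εm) (hκ : κ.im ≠ 0) (hρ₀ : 0 < ρ₀)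
    (hβ : ∀ n, ‖β n‖ ≤ M * Real.exp (-b * n)) :
    ∃ M', (∀ n, ‖innerCoeff κ εm ρ₀ β n‖ ≤ M' * Real.exp (-b * n)) ∧
      ∀ n, ‖innerCoeff κ εm ρ₀ (fun n => conj (β n)) n‖ ≤ M' * Real.exp (-b * n) := by
  obtain ⟨M₁, h₁⟩ := exists_norm_innerCoeff_le hεm hκ hρ₀ hβ
  obtain ⟨M₂, h₂⟩ := exists_norm_innerCoeff_le (β := fun n => conj (β n)) hεm hκ hρ₀
    (fun n => by rw [RCLike.norm_conj]; exact hβ n)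
  refine ⟨max M₁ M₂, fun n => (h₁ n).trans ?_, fun n => (h₂ n).trans ?_⟩
  · gcongr; exact le_max_left _ _
  · gcongr; exact le_max_right _ _

theorem harmonicOnNhd_innerField (hR : 0 < R) (hεm : 0 < εm) (hκ : κ.im ≠ 0) (hρ₀ : 0 < ρ₀)
    (hb : 0 < b) (hβ : ∀ n, ‖β n‖ ≤ M * Real.exp (-b * n)) :
    HarmonicOnNhd (innerField R κ εm ρ₀ β) (complexEllipse R b) := by
  obtain ⟨M', h₁, h₂⟩ := exists_norm_coeffs_le hεm hκ hρ₀ hβ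
  exact ((differentiableOn_chebSeries hR hb h₁).harmonicOnNhd (isOpen_complexEllipse R b)).add
    ((differentiableOn_chebSeries hR hb (fun n => by
      rw [RCLike.norm_conj]; exact h₂ n)).harmonicOnNhd_conj (isOpen_complexEllipse R b))

theorem harmonicOnNhd_scatteredField (hR : 0 < R) (hεm : 0 < εm) (hκ : κ.im ≠ 0) (hρ₀ : 0 < ρ₀)
    (hβ : ∀ n, ‖β n‖ ≤ M * Real.exp (-b * n)) {ρ : ℝ} (hρ : 0 ≤ ρ) (hρb : 2 * ρ₀ - b ≤ ρ) :
    HarmonicOnNhd (scatteredField R κ εm ρ₀ β) (complexExterior R ρ) := by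
  obtain ⟨M', h₁, h₂⟩ := exists_norm_coeffs_le hεm hκ hρ₀ hβ
  exact ((differentiableOn_invSeries hR (norm_outerCoeff_le hεm hρ₀ h₂) hρ hρb).harmonicOnNhd
    (isOpen_complexExterior R ρ)).add
    ((differentiableOn_invSeries hR (fun n => by
      rw [RCLike.norm_conj]; exact norm_outerCoeff_le hεm hρ₀ h₁ n) hρ hρb).harmonicOnNhd_conj
      (isOpen_complexExterior R ρ))

theorem isBigO_scatteredField (hR : 0 < R) (hεm : 0 < εm) (hκ : κ.im ≠ 0) (hρ₀ : 0 < ρ₀)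
    (hβ : ∀ n, ‖β n‖ ≤ M * Real.exp (-b * n)) :
    scatteredField R κ εm ρ₀ β =O[Bornology.cobounded ℂ] fun w => ‖w‖⁻¹ := by
  obtain ⟨M', h₁, h₂⟩ := exists_norm_coeffs_le hεm hκ hρ₀ hβ
  refine (isBigO_invSeries hR (norm_outerCoeff_le hεm hρ₀ h₂) (by simp [outerCoeff])).add ?_
  refine Asymptotics.IsBigO.congr_left (f₁ := fun w => conj (invSeries R (fun n => conj
    (outerCoeff κ εm ρ₀ (innerCoeff κ εm ρ₀ β) n)) w)) ?_ fun w => rfl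
  refine Asymptotics.IsBigO.of_norm_left ?_
  simp only [RCLike.norm_conj]
  exact (isBigO_invSeries hR (fun n => by
    rw [RCLike.norm_conj]; exact norm_outerCoeff_le hεm hρ₀ h₁ n) (by simp [outerCoeff])).norm_left

theorem hasSum_innerField (hR : 0 < R) (hεm : 0 < εm) (hκ : κ.im ≠ 0) (hρ₀ : 0 < ρ₀)
    (hβ : ∀ n, ‖β n‖ ≤ M * Real.exp (-b * n)) {ζ : ℂ} (hζ : |ζ.re| < b) :
    HasSum (fun n : ℕ => innerCoeff κ εm ρ₀ β n * Complex.cosh (n * ζ) +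
      innerCoeff κ εm ρ₀ (fun n => conj (β n)) n * Complex.cosh (n * conj ζ))
      (innerField R κ εm ρ₀ β (ellipticMap R ζ)) := by
  obtain ⟨M', h₁, h₂⟩ := exists_norm_coeffs_le hεm hκ hρ₀ hβ
  have hs := Complex.hasSum_conj'.2 (hasSum_chebSeries hR
    (c := fun n => conj (innerCoeff κ εm ρ₀ (fun n => conj (β n)) n)) (fun n => by
    rw [RCLike.norm_conj]; exact h₂ n) hζ)
  simp only [map_mul, Complex.conj_conj, ← Complex.cosh_conj, map_natCast] at hs
  exact (hasSum_chebSeries hR h₁ hζ).add hs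

theorem hasSum_scatteredField (hR : 0 < R) (hεm : 0 < εm) (hκ : κ.im ≠ 0) (hρ₀ : 0 < ρ₀)
    (hβ : ∀ n, ‖β n‖ ≤ M * Real.exp (-b * n)) {ζ : ℂ} (hζ : 0 < ζ.re) (hζb : 2 * ρ₀ - b < ζ.re) :
    HasSum (fun n : ℕ =>
      outerCoeff κ εm ρ₀ (innerCoeff κ εm ρ₀ fun n => conj (β n)) n * Complex.exp (-ζ) ^ n +
      outerCoeff κ εm ρ₀ (innerCoeff κ εm ρ₀ β) n * Complex.exp (-conj ζ) ^ n)
      (scatteredField R κ εm ρ₀ β (ellipticMap R ζ)) := by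
  obtain ⟨M', h₁, h₂⟩ := exists_norm_coeffs_le hεm hκ hρ₀ hβ
  have hs := Complex.hasSum_conj'.2 (hasSum_invSeries hR
    (c := fun n => conj (outerCoeff κ εm ρ₀ (innerCoeff κ εm ρ₀ β) n)) (fun n => by
    rw [RCLike.norm_conj]; exact norm_outerCoeff_le hεm hρ₀ h₁ n) hζ hζb)
  simp only [map_mul, map_pow, Complex.conj_conj, ← Complex.exp_conj, map_neg] at hs
  exact (hasSum_invSeries hR (norm_outerCoeff_le hεm hρ₀ h₂) hζ hζb).add hs

/-- The reflection identity between the fields on both sides of the interface. It contains the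
continuity of the potential and of the flux. -/
theorem reflection_identity (hR : 0 < R) (hεm : 0 < εm) (hκ : κ.im ≠ 0) (hρ₀ : 0 < ρ₀)
    (hβ : ∀ n, ‖β n‖ ≤ M * Real.exp (-b * n)) {ζ A wz : ℂ} (hζ : 0 < ζ.re)
    (hζb : 2 * ρ₀ - b < ζ.re) (hζb' : ζ.re < b)
    (hA : HasSum (fun n : ℕ => β n * Complex.cosh (n * ζ)) (A / (ellipticMap R ζ - wz))) :
    2 * εm * (scatteredField R κ εm ρ₀ β (ellipticMap R ζ) +
        complexDipole A wz (ellipticMap R ζ)) =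
      (εm + κ) * innerField R κ εm ρ₀ β (ellipticMap R ζ) +
      (εm - κ) * innerField R κ εm ρ₀ β (ellipticMap R (2 * ρ₀ - conj ζ)) := by
  have h1 := hasSum_scatteredField hR hεm hκ hρ₀ hβ hζ hζb
  have h2 := hasSum_innerField hR hεm hκ hρ₀ hβ
    (show |ζ.re| < b from abs_lt.2 ⟨by linarith, hζb'⟩)
  have h3 := hasSum_innerField hR hεm hκ hρ₀ hβ (ζ := 2 * ρ₀ - conj ζ) (by
    have : (2 * ρ₀ - conj ζ : ℂ).re = 2 * ρ₀ - ζ.re := by simp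
    rw [this, abs_lt]
    constructor <;> linarith)
  have h4 : HasSum (fun n : ℕ => (β n * Complex.cosh (n * ζ) +
      conj (β n) * Complex.cosh (n * conj ζ)) / 2) (complexDipole A wz (ellipticMap R ζ)) := by
    have hs := Complex.hasSum_conj'.2 hA
    simp only [map_mul, ← Complex.cosh_conj, map_natCast] at hs
    have := (hA.add hs).div_const 2
    rw [Complex.add_conj] at this
    have e : complexDipole A wz (ellipticMap R ζ) =
        ((2 * (A / (ellipticMap R ζ - wz)).re : ℝ) : ℂ) / 2 := by
      rw [complexDipole]; push_cast; ring
    rwa [e]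
  have h5 := (h1.add h4).mul_left (2 * (εm : ℂ))
  have h6 := (h2.mul_left (εm + κ)).add (h3.mul_left (εm - κ))
  rw [← h5.tsum_eq, ← h6.tsum_eq]
  -- The identity holds mode by mode, as an algebraic relation between `e^{±nζ}`, `e^{±n conj ζ}`
  -- and `e^{±2nρ₀}`.
  refine tsum_congr fun n => ?_
  have r1 := innerCoeff_eq (β := β) hεm hκ hρ₀ n
  have r2 := innerCoeff_eq (β := fun n => conj (β n)) hεm hκ hρ₀ n
  simp only [Complex.conj_conj] at r2
  change _ + _ * innerCoeff κ εm ρ₀ β n = _ at r2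
  have hε : (εm : ℂ) ≠ 0 := by exact_mod_cast hεm.ne'
  rw [outerCoeff, outerCoeff]
  have e0 : conj (2 * ρ₀ - conj ζ : ℂ) = 2 * ρ₀ - ζ := by
    apply Complex.ext <;> simp
  rw [e0]
  set g := innerCoeff κ εm ρ₀ β n
  set k := innerCoeff κ εm ρ₀ (fun n => conj (β n)) n
  set E := Complex.exp (n * ζ) with hE
  set E' := Complex.exp (n * conj ζ) with hE'
  set Y := Complex.exp (2 * ρ₀ * n) with hY
  have hE0 : E ≠ 0 := Complex.exp_ne_zero _
  have hE0' : E' ≠ 0 := Complex.exp_ne_zero _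
  have hY0 : Y ≠ 0 := Complex.exp_ne_zero _
  have eY : ((Real.exp (2 * ρ₀ * n) : ℝ) : ℂ) = Y := by rw [hY]; push_cast; rfl
  have eY' : ((Real.exp (-(2 * ρ₀) * n) : ℝ) : ℂ) = Y⁻¹ := by
    rw [hY, ← Complex.exp_neg]; push_cast; congr 1; ring
  have c1 : Complex.cosh (n * ζ) = (E + E⁻¹) / 2 := by rw [Complex.cosh, Complex.exp_neg]
  have c2 : Complex.cosh (n * conj ζ) = (E' + E'⁻¹) / 2 := by rw [Complex.cosh, Complex.exp_neg]
  have c3 : Complex.cosh (n * (2 * ρ₀ - conj ζ)) = (Y * E'⁻¹ + Y⁻¹ * E') / 2 := by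
    rw [Complex.cosh, hY, hE', ← Complex.exp_neg, ← Complex.exp_neg, ← Complex.exp_add,
      ← Complex.exp_add]
    congr 3 <;> ring
  have c4 : Complex.cosh (n * (2 * ρ₀ - ζ)) = (Y * E⁻¹ + Y⁻¹ * E) / 2 := by
    rw [Complex.cosh, hY, hE, ← Complex.exp_neg, ← Complex.exp_neg, ← Complex.exp_add,
      ← Complex.exp_add]
    congr 3 <;> ring
  have c5 : Complex.exp (-ζ) ^ n = E⁻¹ := by
    rw [← Complex.exp_nat_mul, hE, ← Complex.exp_neg]; congr 1; ring
  have c6 : Complex.exp (-conj ζ) ^ n = E'⁻¹ := by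
    rw [← Complex.exp_nat_mul, hE', ← Complex.exp_neg]; congr 1; ring
  rw [Complex.ofReal_sub, eY, eY', c1, c2, c3, c4, c5, c6]
  rw [eY'] at r1 r2
  have hc1 : 2 * (εm : ℂ) * ((εm - κ) * (Y - Y⁻¹) * k / (4 * εm) * E⁻¹) =
      (εm - κ) * (Y - Y⁻¹) * k * E⁻¹ / 2 := by field_simp; ring
  have hc2 : 2 * (εm : ℂ) * ((εm - κ) * (Y - Y⁻¹) * g / (4 * εm) * E'⁻¹) =
      (εm - κ) * (Y - Y⁻¹) * g * E'⁻¹ / 2 := by field_simp; ring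
  -- The terms growing with `Re ζ` match by the system for the inner coefficients. The decaying ones
  -- leave `(εm - κ)(Y - Y⁻¹)/2` times an inner coefficient, which is how `outerCoeff` was chosen.
  linear_combination hc1 + hc2 - (E + E⁻¹) / 2 * r1 - (E' + E'⁻¹) / 2 * r2

end Field

/-! ### The explicit dipole solution. -/

theorem dipoleField_eq {a z x : Plane} (hx : x ≠ z) :
    dipoleField a z x = 1 / (2 * Real.pi) *
      (planeToComplex a / (planeToComplex x - planeToComplex z)).re := by
  have hy : x - z ≠ 0 := sub_ne_zero.2 hx
  set y := x - z with hyd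
  have hn : ‖y‖ ^ 2 ≠ 0 := by positivity
  -- Half the logarithm of the squared norm has derivative `⟨y, a⟩ / |y|²`, which is `Re (a / y)` in
  -- complex notation.
  have hf : fundamentalSolution = fun y : Plane =>
      1 / (2 * Real.pi) * (1 / 2 * Real.log (‖y‖ ^ 2)) := by
    ext y
    rw [fundamentalSolution, Real.log_pow]
    push_cast
    ring
  have h1 := (((hasStrictFDerivAt_norm_sq y).hasFDerivAt.log hn).const_mul (1 / 2)).const_mul
    (1 / (2 * Real.pi))
  rw [dipoleField, ← hyd, hf, h1.fderiv, ← map_sub, ← hyd]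
  have hnorm : ‖y‖ ^ 2 = y 0 ^ 2 + y 1 ^ 2 := by
    rw [EuclideanSpace.real_norm_sq_eq]
    simp [Fin.sum_univ_two]
  have hns : Complex.normSq (planeToComplex y) = y 0 ^ 2 + y 1 ^ 2 := by
    rw [planeToComplex_apply, Complex.normSq_add_mul_I]
  have hin : inner ℝ y a = y 0 * a 0 + y 1 * a 1 := by
    simp [PiLp.inner_apply, Fin.sum_univ_two]
    ring
  rw [Complex.div_re, hns, planeToComplex_apply a, planeToComplex_apply y]
  simp [hnorm, hin]
  ring

/-- The explicit dipole solution, in the complex plane. -/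
noncomputable def complexSolution (R ρ₀ : ℝ) (κ : ℂ) (εm : ℝ) (A ζz : ℂ) (w : ℂ) : ℂ :=
  open Classical in
  if w ∈ closure (complexEllipse R ρ₀) then
    innerField R κ εm ρ₀ (dipoleCoeff R A ζz) w
  else scatteredField R κ εm ρ₀ (dipoleCoeff R A ζz) w + complexDipole A (ellipticMap R ζz) w

theorem harmonicOnNhd_complexDipole (A wz : ℂ) : HarmonicOnNhd (complexDipole A wz) {wz}ᶜ := by
  have h : DifferentiableOn ℂ (fun w => A / (w - wz)) {wz}ᶜ := fun w hw => by
    refine DifferentiableAt.differentiableWithinAt ?_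
    exact (differentiableAt_const _).div (by fun_prop) (sub_ne_zero.2 hw)
  have h1 := (h.harmonicOnNhd isOpen_compl_singleton).comp_CLM
    (Complex.ofRealCLM.comp Complex.reCLM)
  exact h1

section Solution

variable {R ρ₀ εm : ℝ} {κ A ζz : ℂ}

theorem harmonicOnNhd_innerField_dipole (hR : 0 < R) (hεm : 0 < εm) (hκ : κ.im ≠ 0) (hρ₀ : 0 < ρ₀)
    (hζz : ρ₀ < ζz.re) :
    HarmonicOnNhd (innerField R κ εm ρ₀ (dipoleCoeff R A ζz)) (complexEllipse R ζz.re) :=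
  harmonicOnNhd_innerField hR hεm hκ hρ₀ (hρ₀.trans hζz) (norm_dipoleCoeff_le R A ζz)

theorem harmonicOnNhd_scatteredField_dipole (hR : 0 < R) (hεm : 0 < εm) (hκ : κ.im ≠ 0)
    (hρ₀ : 0 < ρ₀) :
    HarmonicOnNhd (scatteredField R κ εm ρ₀ (dipoleCoeff R A ζz))
      (complexExterior R (max 0 (2 * ρ₀ - ζz.re))) :=
  harmonicOnNhd_scatteredField hR hεm hκ hρ₀ (norm_dipoleCoeff_le R A ζz) (le_max_left _ _)
    (le_max_right _ _)

theorem reflection_identity_dipole (hR : 0 < R) (hεm : 0 < εm) (hκ : κ.im ≠ 0) (hρ₀ : 0 < ρ₀)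
    {ζ : ℂ} (hζ : 0 < ζ.re) (hζb : 2 * ρ₀ - ζz.re < ζ.re) (hζb' : ζ.re < ζz.re) :
    2 * εm * (scatteredField R κ εm ρ₀ (dipoleCoeff R A ζz) (ellipticMap R ζ) +
        complexDipole A (ellipticMap R ζz) (ellipticMap R ζ)) =
      (εm + κ) * innerField R κ εm ρ₀ (dipoleCoeff R A ζz) (ellipticMap R ζ) +
      (εm - κ) * innerField R κ εm ρ₀ (dipoleCoeff R A ζz) (ellipticMap R (2 * ρ₀ - conj ζ)) :=
  reflection_identity hR hεm hκ hρ₀ (norm_dipoleCoeff_le R A ζz) hζ hζb hζb'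
    (hasSum_dipoleCoeff hR A (abs_lt.2 ⟨by linarith, hζb'⟩))

theorem harmonicOnNhd_outerField (hR : 0 < R) (hεm : 0 < εm) (hκ : κ.im ≠ 0) (hρ₀ : 0 < ρ₀) :
    HarmonicOnNhd (fun w => scatteredField R κ εm ρ₀ (dipoleCoeff R A ζz) w +
        complexDipole A (ellipticMap R ζz) w)
      (complexExterior R (max 0 (2 * ρ₀ - ζz.re)) ∩ {ellipticMap R ζz}ᶜ) := fun w hw =>
  HarmonicAt.add (harmonicOnNhd_scatteredField_dipole hR hεm hκ hρ₀ w hw.1)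
    (harmonicOnNhd_complexDipole A _ w hw.2)

theorem mem_outer_of_re_eq (hR : 0 < R) (hρ₀ : 0 < ρ₀) (hζz : ρ₀ < ζz.re) {ζ : ℂ}
    (hζ : ζ.re = ρ₀) : ellipticMap R ζ ∈
      complexExterior R (max 0 (2 * ρ₀ - ζz.re)) ∩ {ellipticMap R ζz}ᶜ := by
  constructor
  · rw [ellipticMap_mem_complexExterior hR (le_max_left _ _), hζ, abs_of_pos hρ₀, max_lt_iff]
    exact ⟨hρ₀, by linarith⟩
  · intro h
    have h1 := focalSum_ellipticMap hR ζ
    rw [Set.mem_singleton_iff.1 h, focalSum_ellipticMap hR, hζ] at h1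
    have h2 := Real.cosh_lt_cosh.2 (show |ρ₀| < |ζz.re| by
      rwa [abs_of_pos hρ₀, abs_of_pos (hρ₀.trans hζz)])
    nlinarith

/-- The reflection `ζ ↦ 2ρ₀ - conj ζ` fixes the interface, and there the weights `εm + κ` and `εm -
κ` add up to `2 εm`. -/
theorem outerField_eq_innerField (hR : 0 < R) (hεm : 0 < εm) (hκ : κ.im ≠ 0) (hρ₀ : 0 < ρ₀)
    (hζz : ρ₀ < ζz.re) {ζ : ℂ} (hζ : ζ.re = ρ₀) :
    scatteredField R κ εm ρ₀ (dipoleCoeff R A ζz) (ellipticMap R ζ) +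
        complexDipole A (ellipticMap R ζz) (ellipticMap R ζ) =
      innerField R κ εm ρ₀ (dipoleCoeff R A ζz) (ellipticMap R ζ) := by
  have h := reflection_identity_dipole (A := A) hR hεm hκ hρ₀ (ζ := ζ) (ζz := ζz)
    (by linarith) (by linarith) (by linarith)
  have e : (2 * ρ₀ - conj ζ : ℂ) = ζ := by
    apply Complex.ext
    · simp [hζ]; ring
    · simp
  rw [e] at h
  have hε : (2 * εm : ℂ) ≠ 0 := by
    have : (εm : ℂ) ≠ 0 := by exact_mod_cast hεm.ne'
    simpa using this
  exact mul_left_cancel₀ hε (by linear_combination h)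

/-- Differentiate the reflection identity across the interface. The reflection reverses the
direction, so the weights are subtracted and give `2κ`. Both fields extend past the interface, so
these are ordinary derivatives. -/
theorem flux_outerField_eq (hR : 0 < R) (hεm : 0 < εm) (hκ : κ.im ≠ 0) (hρ₀ : 0 < ρ₀)
    (hζz : ρ₀ < ζz.re) (ω : ℝ) :
    εm * ellipticDeriv R (fun w => scatteredField R κ εm ρ₀ (dipoleCoeff R A ζz) w +
        complexDipole A (ellipticMap R ζz) w) 1 (ρ₀ + ω * Complex.I) =
      κ * ellipticDeriv R (innerField R κ εm ρ₀ (dipoleCoeff R A ζz)) 1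
        (ρ₀ + ω * Complex.I) := by
  set U := fun w => scatteredField R κ εm ρ₀ (dipoleCoeff R A ζz) w +
        complexDipole A (ellipticMap R ζz) w with hU
  set V := innerField R κ εm ρ₀ (dipoleCoeff R A ζz) with hV
  set ζ₀ : ℂ := ρ₀ + ω * Complex.I with hζ₀
  have hre : ζ₀.re = ρ₀ := by simp [hζ₀]
  have hdU : DifferentiableAt ℝ U (ellipticMap R ζ₀) :=
    (harmonicOnNhd_outerField hR hεm hκ hρ₀ _ (mem_outer_of_re_eq hR hρ₀ hζz hre)).1.differentiableAt
      (by norm_num)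
  have hdV : DifferentiableAt ℝ V (ellipticMap R ζ₀) :=
    (harmonicOnNhd_innerField_dipole hR hεm hκ hρ₀ hζz _
      ((ellipticMap_mem_complexEllipse hR (hρ₀.trans hζz).le).2 (by
        rwa [hre, abs_of_pos hρ₀]))).1.differentiableAt (by norm_num)
  have hγ : HasDerivAt (fun t : ℝ => (t + ω * Complex.I : ℂ)) 1 ρ₀ := by
    simpa using (Complex.ofRealCLM.hasDerivAt (x := ρ₀)).add_const (ω * Complex.I)
  have hγ' : HasDerivAt (fun t : ℝ => (2 * ρ₀ - t + ω * Complex.I : ℂ)) (-1) ρ₀ := by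
    simpa using ((Complex.ofRealCLM.hasDerivAt (x := ρ₀)).const_sub (2 * ρ₀ : ℂ)).add_const
      (ω * Complex.I)
  have e : (2 * ρ₀ - ρ₀ + ω * Complex.I : ℂ) = ζ₀ := by rw [hζ₀]; ring
  have h1 := (hasDerivAt_comp_ellipticMap (γ := fun t : ℝ => (t + ω * Complex.I : ℂ)) hdU
    hγ).const_mul (2 * (εm : ℂ))
  have h2 := (hasDerivAt_comp_ellipticMap (γ := fun t : ℝ => (t + ω * Complex.I : ℂ)) hdV
    hγ).const_mul ((εm : ℂ) + κ)
  have h3 := (hasDerivAt_comp_ellipticMap (γ := fun t : ℝ => (2 * ρ₀ - t + ω * Complex.I : ℂ))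
    (by simpa only [e] using hdV) hγ').const_mul ((εm : ℂ) - κ)
  have h4 := (h2.add h3).congr_of_eventuallyEq (f₁ := fun t : ℝ =>
      2 * (εm : ℂ) * U (ellipticMap R (t + ω * Complex.I))) (by
    filter_upwards [Ioo_mem_nhds (show max 0 (2 * ρ₀ - ζz.re) < ρ₀ from
      max_lt hρ₀ (by linarith)) hζz] with t ht
    have ht1 := max_lt_iff.1 ht.1
    have h := reflection_identity_dipole (A := A) hR hεm hκ hρ₀ (ζ := t + ω * Complex.I)
      (ζz := ζz) (by simpa using ht1.1) (by simpa using ht1.2) (by simpa using ht.2)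
    rw [Pi.add_apply]
    simp only [hU, hV]
    rw [h]
    congr 3
    apply congrArg
    simp
    ring)
  have h5 := h1.unique h4
  have hneg : ellipticDeriv R V (-1) ζ₀ = -ellipticDeriv R V 1 ζ₀ := by
    simp [ellipticDeriv]
  simp only [e] at h5
  rw [hneg] at h5
  linear_combination h5 / 2

end Solution

theorem HarmonicAt.continuousAt_fderiv {u : ℂ → ℂ} {z : ℂ} (h : HarmonicAt u z) :
    ContinuousAt (fderiv ℝ u) z :=
  (h.1.fderiv_right (m := 1) (by norm_num)).continuousAt

theorem isBigO_complexDipole (A wz : ℂ) :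
    complexDipole A wz =O[Bornology.cobounded ℂ] fun w => ‖w‖⁻¹ := by
  refine Asymptotics.IsBigO.of_bound (2 * ‖A‖) ?_
  filter_upwards [tendsto_norm_cobounded_atTop.eventually_gt_atTop (2 * ‖wz‖)] with w hw
  have hw0 : 0 < ‖w‖ := lt_of_le_of_lt (by positivity) hw
  have h1 : ‖w‖ / 2 ≤ ‖w - wz‖ := by linarith [norm_sub_norm_le w wz]
  have h2 : 0 < ‖w - wz‖ := by linarith
  rw [complexDipole, Complex.norm_real, norm_inv, norm_norm, Real.norm_eq_abs]
  refine (Complex.abs_re_le_norm _).trans ?_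
  rw [norm_div, ← div_eq_mul_inv, div_le_div_iff₀ h2 hw0]
  nlinarith [norm_nonneg A]

section Solution

variable {R ρ₀ εm : ℝ} {κ A ζz : ℂ}

theorem complexSolution_eventuallyEq_inner {w : ℂ} (hw : w ∈ complexEllipse R ρ₀) :
    complexSolution R ρ₀ κ εm A ζz =ᶠ[𝓝 w] innerField R κ εm ρ₀ (dipoleCoeff R A ζz) := by
  filter_upwards [(isOpen_complexEllipse R ρ₀).mem_nhds hw] with v hv
  rw [complexSolution, if_pos (subset_closure hv)]

theorem complexSolution_eventuallyEq_outer {w : ℂ} (hw : w ∈ (closure (complexEllipse R ρ₀))ᶜ) :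
    complexSolution R ρ₀ κ εm A ζz =ᶠ[𝓝 w]
      fun w => scatteredField R κ εm ρ₀ (dipoleCoeff R A ζz) w +
        complexDipole A (ellipticMap R ζz) w := by
  filter_upwards [isClosed_closure.isOpen_compl.mem_nhds hw] with v hv
  rw [complexSolution, if_neg hv]

theorem compl_closure_subset_complexExterior (hR : 0 < R) (hρ₀ : 0 < ρ₀) (hζz : ρ₀ < ζz.re) :
    (closure (complexEllipse R ρ₀))ᶜ ⊆ complexExterior R (max 0 (2 * ρ₀ - ζz.re)) := by
  intro w hw
  obtain ⟨ζ, -, -, rfl⟩ := exists_ellipticMap_eq hR w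
  rw [Set.mem_compl_iff, ellipticMap_mem_closure_complexEllipse hR hρ₀, not_le] at hw
  rw [ellipticMap_mem_complexExterior hR (le_max_left _ _)]
  exact (max_lt hρ₀ (by linarith)).trans hw

theorem harmonicOnNhd_complexSolution_inside (hR : 0 < R) (hεm : 0 < εm) (hκ : κ.im ≠ 0)
    (hρ₀ : 0 < ρ₀) (hζz : ρ₀ < ζz.re) :
    HarmonicOnNhd (complexSolution R ρ₀ κ εm A ζz) (complexEllipse R ρ₀) := fun w hw => by
  refine (harmonicAt_congr_nhds (complexSolution_eventuallyEq_inner hw)).2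
    (harmonicOnNhd_innerField_dipole hR hεm hκ hρ₀ hζz w ?_)
  obtain ⟨ζ, -, -, rfl⟩ := exists_ellipticMap_eq hR w
  rw [ellipticMap_mem_complexEllipse hR hρ₀.le] at hw
  rw [ellipticMap_mem_complexEllipse hR (hρ₀.trans hζz).le]
  exact hw.trans hζz

theorem harmonicOnNhd_complexSolution_outside (hR : 0 < R) (hεm : 0 < εm) (hκ : κ.im ≠ 0)
    (hρ₀ : 0 < ρ₀) (hζz : ρ₀ < ζz.re) :
    HarmonicOnNhd (complexSolution R ρ₀ κ εm A ζz)
      (closure (complexEllipse R ρ₀) ∪ {ellipticMap R ζz})ᶜ := fun w hw => by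
  have hw1 : w ∈ (closure (complexEllipse R ρ₀))ᶜ := fun h => hw (Or.inl h)
  have hw2 : w ≠ ellipticMap R ζz := fun h => hw (Or.inr h)
  exact (harmonicAt_congr_nhds (complexSolution_eventuallyEq_outer hw1)).2
    (harmonicOnNhd_outerField hR hεm hκ hρ₀ w
      ⟨compl_closure_subset_complexExterior hR hρ₀ hζz hw1, hw2⟩)

theorem continuousOn_complexSolution (hR : 0 < R) (hεm : 0 < εm) (hκ : κ.im ≠ 0)
    (hρ₀ : 0 < ρ₀) (hζz : ρ₀ < ζz.re) :
    ContinuousOn (complexSolution R ρ₀ κ εm A ζz) {ellipticMap R ζz}ᶜ := fun w hw => by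
  refine ContinuousAt.continuousWithinAt ?_
  obtain ⟨ζ, h0, -, rfl⟩ := exists_ellipticMap_eq hR w
  rcases lt_trichotomy ζ.re ρ₀ with h | h | h
  · exact (harmonicOnNhd_complexSolution_inside hR hεm hκ hρ₀ hζz _
      ((ellipticMap_mem_complexEllipse hR hρ₀.le).2 (abs_lt.2 ⟨by linarith, h⟩))).1.continuousAt
  · have hout := harmonicOnNhd_outerField (A := A) hR hεm hκ hρ₀ _ (mem_outer_of_re_eq hR hρ₀ hζz h)
    have hin := harmonicOnNhd_innerField_dipole (A := A) hR hεm hκ hρ₀ hζz (ellipticMap R ζ)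
      ((ellipticMap_mem_complexEllipse hR (hρ₀.trans hζz).le).2 (by rwa [h, abs_of_pos hρ₀]))
    have hval := outerField_eq_innerField (A := A) hR hεm hκ hρ₀ hζz h
    have ho := hout.1.continuousAt.tendsto
    simp only [hval] at ho
    have hmem : ellipticMap R ζ ∈ closure (complexEllipse R ρ₀) :=
      (ellipticMap_mem_closure_complexEllipse hR hρ₀).2 (by rw [h, abs_of_pos hρ₀])
    rw [ContinuousAt]
    conv_rhs => rw [complexSolution, if_pos hmem]
    classical
    exact hin.1.continuousAt.tendsto.if' ho
  · refine (harmonicOnNhd_complexSolution_outside hR hεm hκ hρ₀ hζz _ ?_).1.continuousAt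
    rintro (h' | h')
    · rw [ellipticMap_mem_closure_complexEllipse hR hρ₀] at h'
      linarith [le_abs_self ζ.re]
    · exact hw h'

theorem flux_complexSolution (hR : 0 < R) (hεm : 0 < εm) (hκ : κ.im ≠ 0)
    (hρ₀ : 0 < ρ₀) (hζz : ρ₀ < ζz.re) (ω : ℝ) : ∃ gIn gOut : ℂ →L[ℝ] ℂ,
      Tendsto (fderiv ℝ (complexSolution R ρ₀ κ εm A ζz))
        (𝓝[complexEllipse R ρ₀] (ellipticMap R (ρ₀ + ω * Complex.I))) (𝓝 gIn) ∧
      Tendsto (fderiv ℝ (complexSolution R ρ₀ κ εm A ζz)) (𝓝[(closure (complexEllipse R ρ₀))ᶜ]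
        (ellipticMap R (ρ₀ + ω * Complex.I))) (𝓝 gOut) ∧
      εm * gOut (R * Complex.sinh (ρ₀ + ω * Complex.I)) =
        κ * gIn (R * Complex.sinh (ρ₀ + ω * Complex.I)) := by
  have hre : (ρ₀ + ω * Complex.I : ℂ).re = ρ₀ := by simp
  have hout := harmonicOnNhd_outerField (A := A) hR hεm hκ hρ₀ _
    (mem_outer_of_re_eq hR hρ₀ hζz hre)
  have hin := harmonicOnNhd_innerField_dipole (A := A) hR hεm hκ hρ₀ hζz
    (ellipticMap R (ρ₀ + ω * Complex.I))
    ((ellipticMap_mem_complexEllipse hR (hρ₀.trans hζz).le).2 (by rwa [hre, abs_of_pos hρ₀]))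
  have hflux := flux_outerField_eq (A := A) hR hεm hκ hρ₀ hζz ω
  simp only [ellipticDeriv, one_mul] at hflux
  refine ⟨_, _, ?_, ?_, hflux⟩
  · refine ((HarmonicAt.continuousAt_fderiv hin).tendsto.mono_left nhdsWithin_le_nhds).congr' ?_
    filter_upwards [self_mem_nhdsWithin] with w hw
    exact (complexSolution_eventuallyEq_inner hw).fderiv_eq.symm
  · refine ((HarmonicAt.continuousAt_fderiv hout).tendsto.mono_left nhdsWithin_le_nhds).congr' ?_
    filter_upwards [self_mem_nhdsWithin] with w hw
    exact (complexSolution_eventuallyEq_outer hw).fderiv_eq.symm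

theorem isBigO_complexSolution (hR : 0 < R) (hεm : 0 < εm) (hκ : κ.im ≠ 0) (hρ₀ : 0 < ρ₀) :
    complexSolution R ρ₀ κ εm A ζz =O[Bornology.cobounded ℂ] fun w => ‖w‖⁻¹ := by
  refine ((isBigO_scatteredField hR hεm hκ hρ₀ (norm_dipoleCoeff_le R A ζz)).add
    (isBigO_complexDipole A (ellipticMap R ζz))).congr' ?_ EventuallyEq.rfl
  have h : (closure (complexEllipse R ρ₀))ᶜ ∈ Bornology.cobounded ℂ :=
    (isCompact_closure_complexEllipse hR hρ₀).isBounded.compl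
  filter_upwards [h] with w hw
  rw [complexSolution, if_neg hw]

end Solution

/-- The explicit dipole solution in the plane. -/
noncomputable def planeSolution (R ρ₀ : ℝ) (κ : ℂ) (εm : ℝ) (a : Plane) (ζz : ℂ) : Plane → ℂ :=
  complexSolution R ρ₀ κ εm (planeToComplex a / (2 * Real.pi * εm)) ζz ∘ planeToComplex

theorem isDipoleSolution_planeSolution {R ρ₀ ρz ωz εm : ℝ} (hR : 0 < R) (hρ₀ : 0 < ρ₀)
    (hρz : ρ₀ < ρz) (hεm : 0 < εm) (a : Plane) {κ : ℂ} (hκ : κ.im ≠ 0) :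
    IsDipoleSolution R ρ₀ κ εm a (ellipticPoint R ρz ωz)
      (planeSolution R ρ₀ κ εm a (ρz + ωz * Complex.I)) := by
  set ζz : ℂ := ρz + ωz * Complex.I with hζz
  have hre : ρ₀ < ζz.re := by simpa [hζz] using hρz
  have hz : planeToComplex (ellipticPoint R ρz ωz) = ellipticMap R ζz :=
    planeToComplex_ellipticPoint R ρz ωz
  have hpre : planeToComplex ⁻¹' {ellipticMap R ζz} = {ellipticPoint R ρz ωz} := by
    ext x
    rw [Set.mem_preimage, ← hz]
    simp
  refine ⟨?_, ?_, ?_, ?_, ?_, ?_⟩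
  · rw [ellipseDomain_eq_preimage hR hρ₀]
    exact HarmonicOnNhd.comp_linearIsometryEquiv planeToComplex
      (harmonicOnNhd_complexSolution_inside hR hεm hκ hρ₀ hre)
  · have h := HarmonicOnNhd.comp_linearIsometryEquiv planeToComplex
      (harmonicOnNhd_complexSolution_outside (A := planeToComplex a / (2 * Real.pi * εm))
        hR hεm hκ hρ₀ hre)
    rw [Set.preimage_compl, Set.preimage_union, hpre, ← closure_ellipseDomain hR hρ₀] at h
    exact h
  · have hzext : ellipticMap R ζz ∈ (closure (complexEllipse R ρ₀))ᶜ := by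
      rw [Set.mem_compl_iff, ellipticMap_mem_closure_complexEllipse hR hρ₀, not_le]
      exact hre.trans_le (le_abs_self _)
    refine ⟨scatteredField R κ εm ρ₀ (dipoleCoeff R (planeToComplex a / (2 * Real.pi * εm)) ζz) ∘
      planeToComplex, ?_, ?_⟩
    · refine HarmonicAt.comp_linearIsometryEquiv planeToComplex ?_
      rw [hz]
      exact harmonicOnNhd_scatteredField_dipole hR hεm hκ hρ₀ _
        (compl_closure_subset_complexExterior hR hρ₀ hre hzext)
    · have h1 := complexSolution_eventuallyEq_outer (κ := κ) (εm := εm)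
        (A := planeToComplex a / (2 * Real.pi * εm)) (ζz := ζz) hzext
      rw [← hz] at h1
      have h2 := planeToComplex.continuous.continuousAt.eventually h1
      filter_upwards [nhdsWithin_le_nhds h2, self_mem_nhdsWithin] with x hx hxz
      rw [planeSolution, Function.comp_apply, hx, Function.comp_apply, dipoleField_eq hxz,
        complexDipole]
      congr 2
      -- The moment `a / (2π εm)` absorbs both the constant of the fundamental solution and the
      -- permittivity of the matrix.
      have e : planeToComplex a / (2 * Real.pi * εm) /
          (planeToComplex x - planeToComplex (ellipticPoint R ρz ωz)) =
          ((1 / (2 * Real.pi * εm) : ℝ) : ℂ) * (planeToComplex a /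
          (planeToComplex x - planeToComplex (ellipticPoint R ρz ωz))) := by
        push_cast
        ring
      rw [e, Complex.re_ofReal_mul]
      field_simp
  · have h := (continuousOn_complexSolution (A := planeToComplex a / (2 * Real.pi * εm))
      hR hεm hκ hρ₀ hre).comp planeToComplex.continuous.continuousOn
      (s := planeToComplex ⁻¹' {ellipticMap R ζz}ᶜ) (fun x hx => hx)
    rwa [Set.preimage_compl, hpre] at h
  · intro ω
    obtain ⟨gIn, gOut, h1, h2, h3⟩ := flux_complexSolution
      (A := planeToComplex a / (2 * Real.pi * εm)) hR hεm hκ hρ₀ hre ω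
    rw [← planeToComplex_ellipticPoint] at h1 h2
    have h4 := tendsto_fderiv_comp_linearIsometryEquiv planeToComplex h1
    have h5 := tendsto_fderiv_comp_linearIsometryEquiv planeToComplex h2
    rw [← ellipseDomain_eq_preimage hR hρ₀] at h4
    rw [Set.preimage_compl, ← closure_ellipseDomain hR hρ₀] at h5
    refine ⟨_, _, h4, h5, ?_⟩
    have happ : ∀ g : ℂ →L[ℝ] ℂ,
        g.comp (planeToComplex.toContinuousLinearEquiv : Plane →L[ℝ] ℂ) (ellipseNormal R ρ₀ ω) =
          ((scaleFactor R ρ₀ ω)⁻¹ : ℝ) * g (R * Complex.sinh (ρ₀ + ω * Complex.I)) := fun g => by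
      change g (planeToComplex (ellipseNormal R ρ₀ ω)) = _
      rw [planeToComplex_ellipseNormal, map_smul, Complex.real_smul]
    rw [happ, happ]
    linear_combination (((scaleFactor R ρ₀ ω)⁻¹ : ℝ) : ℂ) * h3
  · have h := (isBigO_complexSolution (A := planeToComplex a / (2 * Real.pi * εm)) (ζz := ζz)
      hR hεm hκ hρ₀).comp_tendsto (tendsto_cobounded_linearIsometryEquiv planeToComplex)
    refine h.congr_right fun x => ?_
    simp

/-! ### Dirichlet integrals in elliptic coordinates. -/

theorem det_restrictScalars_toSpanSingleton (c : ℂ) :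
    ((ContinuousLinearMap.toSpanSingleton ℂ c).restrictScalars ℝ : ℂ →L[ℝ] ℂ).det = ‖c‖ ^ 2 := by
  rw [ContinuousLinearMap.det]
  have : (((ContinuousLinearMap.toSpanSingleton ℂ c).restrictScalars ℝ : ℂ →L[ℝ] ℂ) : ℂ →ₗ[ℝ] ℂ) =
      ((LinearMap.toSpanSingleton ℂ ℂ c).restrictScalars ℝ) := rfl
  rw [this, LinearMap.det_restrictScalars, Algebra.norm_complex_eq]
  simp [Complex.normSq_eq_norm_sq]

/-- The points of the ellipse that are missed have `ρ = 0` or `ω = π`, hence lie on the real axis, a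
null set. -/
theorem image_ellipticMap_ae_eq {R : ℝ} (hR : 0 < R) {ρ₀ : ℝ} (hρ₀ : 0 < ρ₀) :
    (ellipticMap R '' {ζ | ζ.re ∈ Set.Ioo 0 ρ₀ ∧ ζ.im ∈ Set.Ioo (-Real.pi) Real.pi} : Set ℂ)
      =ᵐ[volume] complexEllipse R ρ₀ := by
  have hnull : volume (LinearMap.ker Complex.imLm : Set ℂ) = 0 := by
    refine Measure.addHaar_submodule _ _ fun h => ?_
    have : (Complex.I : ℂ) ∈ LinearMap.ker Complex.imLm := h ▸ Submodule.mem_top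
    simp at this
  refine (LE.le.eventuallyLE ?_).antisymm ?_
  · rintro _ ⟨ζ, ⟨h, -⟩, rfl⟩
    rw [ellipticMap_mem_complexEllipse hR hρ₀.le, abs_of_pos h.1]
    exact h.2
  · rw [ae_le_set]
    refine measure_mono_null (fun w hw => ?_) hnull
    obtain ⟨ζ, h0, him, rfl⟩ := exists_ellipticMap_eq hR w
    have hlt := (ellipticMap_mem_complexEllipse hR hρ₀.le).1 hw.1
    rw [abs_of_nonneg h0] at hlt
    have him' : (ellipticMap R ζ).im = R * (Real.sinh ζ.re * Real.sin ζ.im) := by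
      rw [ellipticMap, Complex.im_ofReal_mul]
      conv_lhs => rw [← Complex.re_add_im ζ, Complex.cosh_add, Complex.cosh_mul_I, Complex.sinh_mul_I]
      simp [Complex.sinh_ofReal_re, Complex.sin_ofReal_re]
    simp only [SetLike.mem_coe, LinearMap.mem_ker, Complex.imLm_coe, him']
    rcases h0.eq_or_lt with h0 | h0
    · simp [← h0]
    · rcases him.2.eq_or_lt with h1 | h1
      · simp [h1]
      · exact absurd ⟨ζ, ⟨⟨h0, hlt⟩, him.1, h1⟩, rfl⟩ hw.2

/-- Integration over an ellipse in elliptic coordinates. -/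
theorem integral_complexEllipse {R : ℝ} (hR : 0 < R) {ρ₀ b : ℝ} (hρ₀ : 0 < ρ₀) (hb : ρ₀ < b)
    {f : ℂ → ℂ} (hf : ContinuousOn f (complexEllipse R b)) :
    ∫ w in complexEllipse R ρ₀, ‖f w‖ ^ 2 = ∫ ρ in (0 : ℝ)..ρ₀, ∫ ω in (-Real.pi)..Real.pi,
      ‖f (ellipticMap R (ρ + ω * Complex.I)) * (R * Complex.sinh (ρ + ω * Complex.I))‖ ^ 2 := by
  have hπ := Real.pi_pos
  set S : Set ℂ := {ζ | ζ.re ∈ Set.Ioo 0 ρ₀ ∧ ζ.im ∈ Set.Ioo (-Real.pi) Real.pi} with hS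
  have hSm : MeasurableSet S :=
    (Complex.measurable_re measurableSet_Ioo).inter (Complex.measurable_im measurableSet_Ioo)
  set T : Set (ℝ × ℝ) := Set.Ioo 0 ρ₀ ×ˢ Set.Ioo (-Real.pi) Real.pi with hT
  have hpre : S = Complex.equivRealProd ⁻¹' T := rfl
  set h : ℝ × ℝ → ℝ := fun p =>
    ‖f (ellipticMap R (p.1 + p.2 * Complex.I)) * (R * Complex.sinh (p.1 + p.2 * Complex.I))‖ ^ 2
    with hh
  have hcont : ContinuousOn h (Set.Icc 0 ρ₀ ×ˢ Set.Icc (-Real.pi) Real.pi) := by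
    have hc := continuous_ellipticMap R
    refine ContinuousOn.pow (ContinuousOn.norm (ContinuousOn.mul ?_ ?_)) 2
    · refine hf.comp (Continuous.continuousOn (by fun_prop)) fun p hp => ?_
      rw [ellipticMap_mem_complexEllipse hR (by linarith)]
      have := hp.1
      simp only [Set.mem_Icc] at this
      simp only [Complex.add_re, Complex.ofReal_re, Complex.mul_re, Complex.I_re, mul_zero,
        Complex.ofReal_im, Complex.I_im, mul_one, sub_self, add_zero]
      rw [abs_of_nonneg this.1]
      linarith
    · exact Continuous.continuousOn (by fun_prop)
  have hinj : Set.InjOn (ellipticMap R) S :=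
    fun ζ hζ ξ hξ h => ellipticMap_injOn hR ⟨hζ.1.1, hζ.2⟩ ⟨hξ.1.1, hξ.2⟩ h
  have hint : IntegrableOn h T (volume.prod volume) :=
    ((hcont.integrableOn_compact (isCompact_Icc.prod isCompact_Icc)).mono_set
      (Set.prod_mono Set.Ioo_subset_Icc_self Set.Ioo_subset_Icc_self))
  rw [← setIntegral_congr_set (image_ellipticMap_ae_eq hR hρ₀),
    integral_image_eq_integral_abs_det_fderiv_smul volume hSm
      (f' := fun ζ => (ContinuousLinearMap.toSpanSingleton ℂ (R * Complex.sinh ζ)).restrictScalars ℝ)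
      (fun ζ _ => (((hasDerivAt_ellipticMap R ζ).hasFDerivAt).restrictScalars ℝ).hasFDerivWithinAt) hinj]
  have hg : ∀ ζ : ℂ, |((ContinuousLinearMap.toSpanSingleton ℂ (R * Complex.sinh ζ)).restrictScalars ℝ
      : ℂ →L[ℝ] ℂ).det| • ‖f (ellipticMap R ζ)‖ ^ 2 = h (Complex.equivRealProd ζ) := fun ζ => by
    rw [det_restrictScalars_toSpanSingleton, abs_of_nonneg (by positivity), hh]
    simp only [Complex.equivRealProd_apply, Complex.re_add_im, norm_mul, smul_eq_mul]
    ring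
  simp only [hg]
  rw [hpre, show ∫ ζ in Complex.equivRealProd ⁻¹' T, h (Complex.equivRealProd ζ) = ∫ p in T, h p from
    Complex.volume_preserving_equiv_real_prod.setIntegral_preimage_emb
      Complex.measurableEquivRealProd.measurableEmbedding h T, Measure.volume_eq_prod, hT, setIntegral_prod h hint,
    intervalIntegral.integral_of_le hρ₀.le, integral_Ioc_eq_integral_Ioo]
  simp only [intervalIntegral.integral_of_le (show -Real.pi ≤ Real.pi by linarith), integral_Ioc_eq_integral_Ioo, hh]

theorem integral_exp_int_mul (k : ℤ) :
    ∫ ω in (-Real.pi)..Real.pi, Complex.exp (k * (ω * Complex.I)) =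
      if k = 0 then 2 * (Real.pi : ℂ) else 0 := by
  split_ifs with hk
  · subst hk
    rw [show (fun ω : ℝ => Complex.exp (((0 : ℤ) : ℂ) * (ω * Complex.I))) = fun _ => 1 by ext; simp]
    simp
    ring
  · have hc : (k : ℂ) * Complex.I ≠ 0 := mul_ne_zero (by exact_mod_cast hk) Complex.I_ne_zero
    rw [show (fun ω : ℝ => Complex.exp (k * (ω * Complex.I))) =
      fun ω : ℝ => Complex.exp (k * Complex.I * ω) by ext; congr 1; ring, integral_exp_mul_complex hc,
      sub_eq_zero.2, zero_div]
    rw [Complex.exp_eq_exp_iff_exists_int]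
    exact ⟨k, by push_cast; ring⟩

/-- Only `e^{nζ}` or `e^{-nζ}` can meet the frequency `m`. The factor `n` combines with the sign
into `m`, and makes the formula valid for `n = 0` as well. -/
theorem natCast_mul_modeCoeff_sinh (n : ℕ) (m : ℤ) (ρ : ℝ) :
    n * modeCoeff (fun ζ => Complex.sinh (n * ζ)) m ρ =
      if n = m.natAbs then Real.pi * m * Complex.exp (m * ρ) else 0 := by
  have h : modeCoeff (fun ζ => Complex.sinh (n * ζ)) m ρ =
      Complex.exp (n * ρ) / 2 * (if (n : ℤ) - m = 0 then 2 * (Real.pi : ℂ) else 0) -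
      Complex.exp (-(n * ρ)) / 2 * (if -(n : ℤ) - m = 0 then 2 * (Real.pi : ℂ) else 0) := by
    rw [← integral_exp_int_mul, ← integral_exp_int_mul, ← intervalIntegral.integral_const_mul,
      ← intervalIntegral.integral_const_mul, ← intervalIntegral.integral_sub, modeCoeff]
    · refine intervalIntegral.integral_congr fun ω _ => ?_
      show Complex.sinh _ * _ = _ / 2 * _ - _ / 2 * _
      rw [Complex.sinh, div_mul_eq_mul_div, sub_mul, ← Complex.exp_add, ← Complex.exp_add,
        div_mul_eq_mul_div, div_mul_eq_mul_div, ← Complex.exp_add, ← Complex.exp_add, sub_div]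
      push_cast
      ring_nf
    all_goals exact Continuous.intervalIntegrable (by fun_prop) _ _
  rw [h]
  rcases Nat.eq_zero_or_pos n with rfl | hn
  · by_cases hm : m = 0
    · simp [hm]
    · simp [hm, eq_comm]
  · rcases m.natAbs_eq with hm | hm
    · by_cases e : n = m.natAbs
      · rw [← e] at hm
        subst hm
        rw [if_pos (by ring), if_neg (by omega), if_pos (by simp)]
        push_cast
        ring
      · rw [if_neg (by omega), if_neg (by omega), if_neg e]
        ring
    · by_cases e : n = m.natAbs
      · rw [← e] at hm
        subst hm
        rw [if_neg (by omega), if_pos (by ring), if_pos (by simp)]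
        push_cast
        ring_nf
      · rw [if_neg (by omega), if_neg (by omega), if_neg e]
        ring

section Energy

variable {R M b : ℝ} {c : ℕ → ℂ}

theorem summable_mul_exp_neg_mul_exp (M : ℝ) {b ρ : ℝ} (hρ : ρ < b) (k : ℕ) :
    Summable fun n : ℕ => (n : ℝ) ^ k * (M * Real.exp (-b * n) * Real.exp (ρ * n)) := by
  have := (Real.summable_pow_mul_exp_neg_nat_mul k (sub_pos.2 hρ)).mul_left M
  refine this.congr fun n => ?_
  rw [mul_assoc M, ← Real.exp_add]
  ring_nf

theorem modeCoeff_deriv_chebSeries (hR : 0 < R) (hc : ∀ n, ‖c n‖ ≤ M * Real.exp (-b * n)) {ρ : ℝ}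
    (hρ : |ρ| < b) (m : ℤ) :
    modeCoeff (fun ζ => deriv (chebSeries R c) (ellipticMap R ζ) * (R * Complex.sinh ζ)) m ρ =
      Real.pi * m * c m.natAbs * Complex.exp (m * ρ) := by
  have hsum : HasSum (fun n : ℕ => c n * (n * modeCoeff (fun ζ => Complex.sinh (n * ζ)) m ρ))
      (modeCoeff (fun ζ => deriv (chebSeries R c) (ellipticMap R ζ) * (R * Complex.sinh ζ)) m ρ) := by
    have h := intervalIntegral.hasSum_integral_of_dominated_convergence (μ := volume)
      (a := -Real.pi) (b := Real.pi)
      (F := fun (n : ℕ) (ω : ℝ) => c n * (n * Complex.sinh (n * (ρ + ω * Complex.I))) *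
        Complex.exp (-(m * (ω * Complex.I))))
      (f := fun ω : ℝ => deriv (chebSeries R c) (ellipticMap R (ρ + ω * Complex.I)) *
        (R * Complex.sinh (ρ + ω * Complex.I)) * Complex.exp (-(m * (ω * Complex.I))))
      (fun (n : ℕ) _ => (n : ℝ) ^ 1 * (M * Real.exp (-b * n) * Real.exp (|ρ| * n)))
      (fun n => Continuous.aestronglyMeasurable (by fun_prop)) ?_ ?_ ?_ ?_
    · refine (HasSum.congr_fun h fun n => ?_)
      rw [modeCoeff, ← intervalIntegral.integral_const_mul, ← intervalIntegral.integral_const_mul]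
      refine intervalIntegral.integral_congr fun ω _ => ?_
      ring
    · refine fun n => Eventually.of_forall fun ω _ => ?_
      have h1 := norm_sinh_natCast_mul_le n (ρ + ω * Complex.I)
      have hre : (ρ + ω * Complex.I : ℂ).re = ρ := by simp
      rw [hre] at h1
      have h2 : ‖Complex.exp (-(m * (ω * Complex.I)))‖ = 1 := by
        rw [show -((m : ℂ) * (ω * Complex.I)) = ((-(m * ω) : ℝ) : ℂ) * Complex.I by push_cast; ring]
        exact Complex.norm_exp_ofReal_mul_I _
      rw [norm_mul, norm_mul, norm_mul, h2, Complex.norm_natCast, pow_one]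
      calc ‖c n‖ * (n * ‖Complex.sinh (n * (ρ + ω * Complex.I))‖) * 1
          = n * (‖c n‖ * ‖Complex.sinh (n * (ρ + ω * Complex.I))‖) := by ring
        _ ≤ _ := by
          have := hc n
          have := (norm_nonneg (c n)).trans this
          gcongr
    · exact Eventually.of_forall fun _ _ => summable_mul_exp_neg_mul_exp M hρ 1
    · exact intervalIntegrable_const
    · refine Eventually.of_forall fun ω _ => ?_
      exact (hasSum_deriv_chebSeries hR hc (by simpa using hρ)).mul_right _
  rw [← hsum.tsum_eq, tsum_eq_single m.natAbs fun n hn => by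
    rw [natCast_mul_modeCoeff_sinh, if_neg hn, mul_zero], natCast_mul_modeCoeff_sinh, if_pos rfl]
  ring

theorem continuous_deriv_chebSeries_line (hR : 0 < R) (hc : ∀ n, ‖c n‖ ≤ M * Real.exp (-b * n))
    {ρ : ℝ} (hρ : |ρ| < b) : Continuous fun ω : ℝ =>
      deriv (chebSeries R c) (ellipticMap R (ρ + ω * Complex.I)) *
        (R * Complex.sinh (ρ + ω * Complex.I)) := by
  have hb : 0 < b := (abs_nonneg ρ).trans_lt hρ
  have hd := ((differentiableOn_chebSeries hR hb hc).deriv (isOpen_complexEllipse R b)).continuousOn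
  have he := continuous_ellipticMap R
  refine Continuous.mul (hd.comp_continuous (by fun_prop) fun ω => ?_) (by fun_prop)
  rw [ellipticMap_mem_complexEllipse hR hb.le]
  simpa using hρ

theorem hasSum_integral_line_deriv_chebSeries_sq (hR : 0 < R)
    (hc : ∀ n, ‖c n‖ ≤ M * Real.exp (-b * n)) {ρ : ℝ} (hρ : |ρ| < b) :
    HasSum (fun n : ℕ => Real.pi * n ^ 2 * ‖c n‖ ^ 2 * Real.cosh (2 * n * ρ))
      (∫ ω in (-Real.pi)..Real.pi, ‖deriv (chebSeries R c) (ellipticMap R (ρ + ω * Complex.I)) *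
        (R * Complex.sinh (ρ + ω * Complex.I))‖ ^ 2) := by
  have h := (hasSum_modeCoeff_sq (F := fun ζ => deriv (chebSeries R c) (ellipticMap R ζ) *
    (R * Complex.sinh ζ)) (continuous_deriv_chebSeries_line hR hc hρ)).nat_add_neg
  simp only [modeCoeff_deriv_chebSeries hR hc hρ] at h
  have h2 := h.mul_left (1 / (2 * Real.pi))
  have hπ := Real.pi_pos
  -- Folding `n` with `-n` counts the zeroth mode twice; this is harmless because that mode
  -- vanishes.
  simp only [Int.cast_zero, mul_zero, zero_mul, norm_zero, ne_eq, OfNat.ofNat_ne_zero,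
    not_false_eq_true, zero_pow, add_zero] at h2
  rw [show ∀ x : ℝ, 1 / (2 * Real.pi) * (2 * Real.pi * x) = x from fun x => by field_simp] at h2
  refine HasSum.congr_fun h2 fun n => ?_
  simp only [norm_mul, Complex.norm_exp, Int.natAbs_natCast, Int.natAbs_neg, Int.cast_neg, norm_neg,
    Int.cast_natCast, Complex.norm_natCast, Complex.norm_real, Real.norm_of_nonneg hπ.le]
  rw [Real.cosh_eq]
  have e1 : (n * (ρ : ℂ)).re = n * ρ := by simp
  have e2 : (-(n : ℂ) * (ρ : ℂ)).re = -(n * ρ) := by simp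
  rw [e1, e2, show 2 * n * ρ = n * ρ + n * ρ by ring, show -(n * ρ + n * ρ) = -(n * ρ) + -(n * ρ) by ring,
    Real.exp_add, Real.exp_add]
  field_simp

theorem hasSum_integral_deriv_chebSeries_sq (hR : 0 < R) (hc : ∀ n, ‖c n‖ ≤ M * Real.exp (-b * n))
    {ρ₀ : ℝ} (hρ₀ : 0 < ρ₀) (hb : ρ₀ < b) :
    HasSum (fun n : ℕ => Real.pi / 2 * (n * ‖c n‖ ^ 2 * Real.sinh (2 * n * ρ₀)))
      (∫ w in complexEllipse R ρ₀, ‖deriv (chebSeries R c) w‖ ^ 2) := by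
  have hb0 : 0 < b := hρ₀.trans hb
  rw [integral_complexEllipse hR hρ₀ hb
    ((differentiableOn_chebSeries hR hb0 hc).deriv (isOpen_complexEllipse R b)).continuousOn]
  have h := intervalIntegral.hasSum_integral_of_dominated_convergence (μ := volume)
    (a := 0) (b := ρ₀)
    (F := fun (n : ℕ) (ρ : ℝ) => Real.pi * n ^ 2 * ‖c n‖ ^ 2 * Real.cosh (2 * n * ρ))
    (f := fun ρ : ℝ => ∫ ω in (-Real.pi)..Real.pi,
      ‖deriv (chebSeries R c) (ellipticMap R (ρ + ω * Complex.I)) *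
        (R * Complex.sinh (ρ + ω * Complex.I))‖ ^ 2)
    (fun (n : ℕ) _ => Real.pi * ((n : ℝ) ^ 2 * (M ^ 2 * Real.exp (-(2 * b) * n) * Real.exp ((2 * ρ₀) * n))))
    (fun n => Continuous.aestronglyMeasurable (by fun_prop)) ?_ ?_ ?_ ?_
  · refine HasSum.congr_fun h fun n => ?_
    rcases Nat.eq_zero_or_pos n with rfl | hn
    · simp
    have hn' : (0 : ℝ) < n := by exact_mod_cast hn
    -- The integral of `cosh (2nρ)` over `[0, ρ₀]` is `sinh (2nρ₀) / (2n)`, which lowers the weight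
    -- from `n²` to `n`.
    rw [intervalIntegral.integral_const_mul, intervalIntegral.integral_comp_mul_left (f := Real.cosh) (by positivity),
      intervalIntegral.integral_eq_sub_of_hasDerivAt (fun x _ => Real.hasDerivAt_sinh x)
        (Real.continuous_cosh.intervalIntegrable _ _)]
    simp
    field_simp
  · refine fun n => Eventually.of_forall fun ρ hρ => ?_
    rw [Set.uIoc_of_le hρ₀.le] at hρ
    have hπ := Real.pi_pos
    have hM : 0 ≤ M * Real.exp (-b * n) := (norm_nonneg (c n)).trans (hc n)
    have hch : Real.cosh (2 * n * ρ) ≤ Real.exp ((2 * ρ₀) * n) := by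
      have h0 : 0 ≤ 2 * n * ρ := by have := hρ.1; positivity
      calc Real.cosh (2 * n * ρ) ≤ Real.exp (2 * n * ρ) := by
            rw [Real.cosh_eq]
            have : Real.exp (-(2 * n * ρ)) ≤ Real.exp (2 * n * ρ) := Real.exp_le_exp.2 (by linarith)
            linarith
        _ ≤ _ := by
            refine Real.exp_le_exp.2 ?_
            have := mul_le_mul_of_nonneg_left hρ.2 (show (0 : ℝ) ≤ 2 * n by positivity)
            linarith
    rw [Real.norm_of_nonneg (by have := Real.cosh_pos (2 * n * ρ); positivity), mul_assoc, mul_assoc,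
      show M ^ 2 * Real.exp (-(2 * b) * n) = (M * Real.exp (-b * n)) ^ 2 by
        rw [mul_pow, ← Real.exp_nat_mul]; ring_nf]
    have := hc n
    have := (Real.cosh_pos (2 * n * ρ)).le
    gcongr
  · refine Eventually.of_forall fun _ _ => (summable_mul_exp_neg_mul_exp (M ^ 2) ?_ 2).mul_left _
    linarith
  · exact intervalIntegrable_const
  · refine Eventually.of_forall fun ρ hρ => ?_
    rw [Set.uIoc_of_le hρ₀.le] at hρ
    exact hasSum_integral_line_deriv_chebSeries_sq hR hc (by rw [abs_of_pos hρ.1]; linarith [hρ.2])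

end Energy

/-! ### The energy of the solution as a series. -/

/-- The two partial derivatives have moduli `|G' + conj K'|` and `|G' - conj K'|`; the parallelogram
law removes the cross term, so both parts contribute separately to the energy. -/
theorem gradSq_comp_planeToComplex {G K : ℂ → ℂ} {x : Plane}
    (hG : DifferentiableAt ℂ G (planeToComplex x)) (hK : DifferentiableAt ℂ K (planeToComplex x)) :
    gradSq ((fun w => G w + conj (K w)) ∘ planeToComplex) x =
      2 * (‖deriv G (planeToComplex x)‖ ^ 2 + ‖deriv K (planeToComplex x)‖ ^ 2) := by
  have h0 : planeToComplex (EuclideanSpace.single 0 1) = 1 := by simp [planeToComplex_apply]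
  have h1 : planeToComplex (EuclideanSpace.single 1 1) = Complex.I := by simp [planeToComplex_apply]
  have hV : HasFDerivAt (fun w => G w + conj (K w))
      ((ContinuousLinearMap.toSpanSingleton ℂ (deriv G (planeToComplex x))).restrictScalars ℝ +
        (Complex.conjCLE : ℂ →L[ℝ] ℂ) ∘L
        (ContinuousLinearMap.toSpanSingleton ℂ (deriv K (planeToComplex x))).restrictScalars ℝ)
      (planeToComplex x) :=
    (hG.hasDerivAt.hasFDerivAt.restrictScalars ℝ).add
      (Complex.conjCLE.hasFDerivAt.comp _ (hK.hasDerivAt.hasFDerivAt.restrictScalars ℝ))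
  rw [gradSq, Fin.sum_univ_two, fderiv_comp_linearIsometryEquiv, hV.fderiv]
  simp only [ContinuousLinearMap.comp_apply, ContinuousLinearEquiv.coe_coe,
    LinearIsometryEquiv.coe_toContinuousLinearEquiv, add_apply, h0, h1,
    ContinuousLinearMap.coe_restrictScalars', ContinuousLinearMap.toSpanSingleton_apply, smul_eq_mul, one_mul,
    Complex.conjCLE_apply, map_mul, Complex.conj_I]
  rw [show Complex.I * deriv G (planeToComplex x) + -Complex.I * conj (deriv K (planeToComplex x)) =
    Complex.I * (deriv G (planeToComplex x) - conj (deriv K (planeToComplex x))) by ring, norm_mul,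
    Complex.norm_I, one_mul]
  have := parallelogram_law_with_norm ℝ (deriv G (planeToComplex x)) (conj (deriv K (planeToComplex x)))
  rw [RCLike.norm_conj] at this
  linarith

/-- The denominator is `P Q`, and the two numerators are `Q Re β ± i P Im β`. The parallelogram law
removes the cross terms, leaving the real part of `β` over the factor `P` and the imaginary part
over `Q`. -/
theorem norm_innerCoeff_sq_add {κ : ℂ} {εm ρ₀ : ℝ} (hεm : 0 < εm) (hκ : κ.im ≠ 0) (hρ₀ : 0 < ρ₀)
    (β : ℕ → ℂ) (n : ℕ) :
    ‖innerCoeff κ εm ρ₀ β n‖ ^ 2 + ‖innerCoeff κ εm ρ₀ (fun n => conj (β n)) n‖ ^ 2 =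
      2 * εm ^ 2 * ((β n).re ^ 2 / ‖εm + κ + (εm - κ) * Real.exp (-(2 * ρ₀) * n)‖ ^ 2 +
        (β n).im ^ 2 / ‖εm + κ - (εm - κ) * Real.exp (-(2 * ρ₀) * n)‖ ^ 2) := by
  have hden := innerCoeff_den_ne_zero hεm hκ (exp_neg_mem_Icc hρ₀ n)
  simp only [innerCoeff, Complex.conj_conj]
  set X : ℂ := (Real.exp (-(2 * ρ₀) * n) : ℂ) with hX
  set P : ℂ := εm + κ + (εm - κ) * X with hP
  set Q : ℂ := εm + κ - (εm - κ) * X with hQ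
  have hden' : P * Q ≠ 0 := by
    intro h
    apply hden
    rw [← h, hP, hQ]
    ring
  have hP0 : ‖P‖ ≠ 0 := norm_ne_zero_iff.2 (left_ne_zero_of_mul hden')
  have hQ0 : ‖Q‖ ≠ 0 := norm_ne_zero_iff.2 (right_ne_zero_of_mul hden')
  have hfac : (εm + κ : ℂ) ^ 2 - (εm - κ) ^ 2 * X ^ 2 = P * Q := by rw [hP, hQ]; ring
  have e1 : (εm + κ : ℂ) * β n - (εm - κ) * X * conj (β n) =
      Q * (β n).re + Complex.I * (P * (β n).im) := by
    conv_lhs => rw [← Complex.re_add_im (β n)]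
    simp only [map_add, map_mul, Complex.conj_ofReal, Complex.conj_I, hP, hQ]
    ring
  have e2 : (εm + κ : ℂ) * conj (β n) - (εm - κ) * X * β n =
      Q * (β n).re - Complex.I * (P * (β n).im) := by
    conv_lhs => rw [← Complex.re_add_im (β n)]
    simp only [map_add, map_mul, Complex.conj_ofReal, Complex.conj_I, hP, hQ]
    ring
  have hpar := parallelogram_law_with_norm ℝ (Q * (β n).re) (Complex.I * (P * (β n).im))
  simp only [hfac, e1, e2, norm_div, norm_mul, Complex.norm_real, Complex.norm_I, one_mul] at hpar ⊢
  rw [div_pow, div_pow, ← add_div, div_eq_iff (by positivity)]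
  rw [mul_pow, mul_pow, ← mul_add, hpar]
  simp only [mul_pow, Real.norm_eq_abs, sq_abs]
  field_simp

section Gradient

variable {R ρ₀ ρz ωz εm : ℝ} {κ : ℂ} {a : Plane} {u : Plane → ℂ}

theorem IsDipoleSolution.gradSq_eq (hR : 0 < R) (hρ₀ : 0 < ρ₀) (hρz : ρ₀ < ρz) (hεm : 0 < εm)
    (hκ : κ.im ≠ 0) (hu : IsDipoleSolution R ρ₀ κ εm a (ellipticPoint R ρz ωz) u) {β : ℕ → ℂ}
    (hβ : β = dipoleCoeff R (planeToComplex a / (2 * Real.pi * εm)) (ρz + ωz * Complex.I))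
    {x : Plane} (hx : x ∈ ellipseDomain R ρ₀) :
    gradSq u x = 2 * (‖deriv (chebSeries R (innerCoeff κ εm ρ₀ β)) (planeToComplex x)‖ ^ 2 +
      ‖deriv (chebSeries R fun n => conj (innerCoeff κ εm ρ₀ (fun n => conj (β n)) n))
        (planeToComplex x)‖ ^ 2) := by
  have hbd := norm_dipoleCoeff_le R (planeToComplex a / (2 * Real.pi * εm)) (ρz + ωz * Complex.I)
  rw [← hβ] at hbd
  rw [show (ρz + ωz * Complex.I : ℂ).re = ρz by simp] at hbd
  obtain ⟨M', h₁, h₂⟩ := exists_norm_coeffs_le hεm hκ hρ₀ hbd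
  have hz0 : 0 < ρz := hρ₀.trans hρz
  have hmem : ∀ y ∈ ellipseDomain R ρ₀, planeToComplex y ∈ complexEllipse R ρ₀ := fun y hy => by
    rwa [ellipseDomain_eq_preimage hR hρ₀] at hy
  have hmem' : planeToComplex x ∈ complexEllipse R ρz := by
    obtain ⟨ζ, -, -, hζ⟩ := exists_ellipticMap_eq hR (planeToComplex x)
    have h := hmem x hx
    rw [← hζ, ellipticMap_mem_complexEllipse hR hρ₀.le] at h
    rw [← hζ, ellipticMap_mem_complexEllipse hR hz0.le]
    exact h.trans hρz
  have heq : u =ᶠ[𝓝 x] innerField R κ εm ρ₀ β ∘ planeToComplex := by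
    filter_upwards [(isOpen_ellipseDomain hR hρ₀).mem_nhds hx] with y hy
    rw [IsDipoleSolution.eqOn hR hρ₀ hρz hεm hκ hu (isDipoleSolution_planeSolution hR hρ₀ hρz hεm a hκ)
      (fun h => ellipticPoint_notMem_closure hR hρ₀ hρz (h ▸ subset_closure hy)), hβ]
    exact (complexSolution_eventuallyEq_inner (hmem y hy)).eq_of_nhds
  have h0 : gradSq u x = gradSq (innerField R κ εm ρ₀ β ∘ planeToComplex) x := by
    simp only [gradSq, heq.fderiv_eq]
  rw [h0]
  exact gradSq_comp_planeToComplex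
    ((differentiableOn_chebSeries hR hz0 h₁).differentiableAt ((isOpen_complexEllipse R ρz).mem_nhds hmem'))
    ((differentiableOn_chebSeries hR hz0 fun n => by
      rw [RCLike.norm_conj]; exact h₂ n).differentiableAt ((isOpen_complexEllipse R ρz).mem_nhds hmem'))

theorem integrableOn_deriv_chebSeries_sq (hR : 0 < R) {M b : ℝ} {c : ℕ → ℂ}
    (hc : ∀ n, ‖c n‖ ≤ M * Real.exp (-b * n)) (hρ₀ : 0 < ρ₀) (hb : ρ₀ < b) :
    IntegrableOn (fun w => ‖deriv (chebSeries R c) w‖ ^ 2) (complexEllipse R ρ₀) := by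
  have hb0 : 0 < b := hρ₀.trans hb
  have hd := ((differentiableOn_chebSeries hR hb0 hc).deriv (isOpen_complexEllipse R b)).continuousOn
  refine (ContinuousOn.integrableOn_compact (isCompact_closure_complexEllipse hR hρ₀)
    ((hd.mono fun w hw => ?_).norm.pow 2)).mono_set subset_closure
  obtain ⟨ζ, -, -, rfl⟩ := exists_ellipticMap_eq hR w
  rw [ellipticMap_mem_closure_complexEllipse hR hρ₀] at hw
  rw [ellipticMap_mem_complexEllipse hR hb0.le]
  exact hw.trans_lt hb

/-- The gradient of the solution is square integrable on the ellipse, and its energy is a series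
over the elliptic harmonics. -/
theorem IsDipoleSolution.energy (hR : 0 < R) (hρ₀ : 0 < ρ₀) (hρz : ρ₀ < ρz) (hεm : 0 < εm)
    (hκ : κ.im ≠ 0) (hu : IsDipoleSolution R ρ₀ κ εm a (ellipticPoint R ρz ωz) u) {β : ℕ → ℂ}
    (hβ : β = dipoleCoeff R (planeToComplex a / (2 * Real.pi * εm)) (ρz + ωz * Complex.I)) :
    IntegrableOn (gradSq u) (ellipseDomain R ρ₀) ∧
    HasSum (fun n : ℕ => 2 * Real.pi * εm ^ 2 * (n * Real.sinh (2 * n * ρ₀) *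
      ((β n).re ^ 2 / ‖εm + κ + (εm - κ) * Real.exp (-(2 * ρ₀) * n)‖ ^ 2 +
        (β n).im ^ 2 / ‖εm + κ - (εm - κ) * Real.exp (-(2 * ρ₀) * n)‖ ^ 2)))
      (gradL2Sq (ellipseDomain R ρ₀) u) := by
  have hbd := norm_dipoleCoeff_le R (planeToComplex a / (2 * Real.pi * εm)) (ρz + ωz * Complex.I)
  rw [← hβ] at hbd
  rw [show (ρz + ωz * Complex.I : ℂ).re = ρz by simp] at hbd
  obtain ⟨M', h₁, h₂⟩ := exists_norm_coeffs_le hεm hκ hρ₀ hbd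
  have h₂' : ∀ n, ‖conj (innerCoeff κ εm ρ₀ (fun n => conj (β n)) n)‖ ≤ M' * Real.exp (-ρz * n) :=
    fun n => by rw [RCLike.norm_conj]; exact h₂ n
  have hg := fun x (hx : x ∈ ellipseDomain R ρ₀) => hu.gradSq_eq hR hρ₀ hρz hεm hκ hβ hx
  have hΩm : MeasurableSet (ellipseDomain R ρ₀) := (isOpen_ellipseDomain hR hρ₀).measurableSet
  have i₁ := integrableOn_deriv_chebSeries_sq hR h₁ hρ₀ hρz
  have i₂ := integrableOn_deriv_chebSeries_sq hR h₂' hρ₀ hρz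
  have hmp := planeToComplex.measurePreserving
  have hemb : MeasurableEmbedding planeToComplex := planeToComplex.toHomeomorph.measurableEmbedding
  constructor
  · refine IntegrableOn.congr_fun ?_ (fun x hx => (hg x hx).symm) hΩm
    rw [ellipseDomain_eq_preimage hR hρ₀]
    exact (hmp.integrableOn_comp_preimage hemb).2 ((i₁.add i₂).const_mul 2)
  · have e : gradL2Sq (ellipseDomain R ρ₀) u =
        2 * ((∫ w in complexEllipse R ρ₀, ‖deriv (chebSeries R (innerCoeff κ εm ρ₀ β)) w‖ ^ 2) +
        ∫ w in complexEllipse R ρ₀, ‖deriv (chebSeries R fun n =>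
          conj (innerCoeff κ εm ρ₀ (fun n => conj (β n)) n)) w‖ ^ 2) := by
      rw [gradL2Sq, setIntegral_congr_fun hΩm hg, ← integral_add i₁ i₂, ← integral_const_mul,
        ellipseDomain_eq_preimage hR hρ₀]
      exact hmp.setIntegral_preimage_emb hemb (fun w =>
        2 * (‖deriv (chebSeries R (innerCoeff κ εm ρ₀ β)) w‖ ^ 2 + ‖deriv (chebSeries R fun n =>
          conj (innerCoeff κ εm ρ₀ (fun n => conj (β n)) n)) w‖ ^ 2)) _
    rw [e]
    refine HasSum.congr_fun (((hasSum_integral_deriv_chebSeries_sq hR h₁ hρ₀ hρz).add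
      (hasSum_integral_deriv_chebSeries_sq hR h₂' hρ₀ hρz)).mul_left 2) fun n => ?_
    have := norm_innerCoeff_sq_add hεm hκ hρ₀ β n
    rw [RCLike.norm_conj]
    linear_combination (-Real.pi * n * Real.sinh (2 * n * ρ₀)) * this

end Gradient

/-! ### Asymptotics of the resonance series. -/

/-- The series that governs the energy of the solution with loss parameter `δ`. -/
noncomputable def resonanceSeries (q r δ : ℝ) : ℝ := ∑' n : ℕ, n * r ^ n / (δ + q ^ n) ^ 2

section ResonanceSeries

variable {q r δ : ℝ}

theorem summable_resonanceSeries (hq : 0 < q) (hr : 0 < r) (hr1 : r < 1) (hδ : 0 < δ) :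
    Summable fun n : ℕ => n * r ^ n / (δ + q ^ n) ^ 2 := by
  have h : Summable fun n : ℕ => (n : ℝ) ^ 1 * r ^ n :=
    summable_pow_mul_geometric_of_norm_lt_one 1 (by rwa [Real.norm_of_nonneg hr.le])
  refine Summable.of_nonneg_of_le (fun n => by positivity) (fun n => ?_) (h.mul_right (1 / δ ^ 2))
  rw [pow_one, div_eq_mul_one_div]
  gcongr
  have : 0 < q ^ n := by positivity
  linarith

theorem sum_le_resonanceSeries (hq : 0 < q) (hr : 0 < r) (hr1 : r < 1) (hδ : 0 < δ) (s : Finset ℕ) :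
    ∑ n ∈ s, n * r ^ n / (δ + q ^ n) ^ 2 ≤ resonanceSeries q r δ :=
  (summable_resonanceSeries hq hr hr1 hδ).sum_le_tsum _ fun n _ => by positivity

/-- Below the cut `δ` is dominated by `q^n`, so the denominator is at most `(2 q^n)²`. -/
theorem mul_pow_le_resonanceSeries_term (hq : 0 < q) (hq1 : q < 1) (hr : 0 < r) (hδ : 0 < δ) {n N : ℕ}
    (hN : δ ≤ q ^ N) (hn : n ≤ N) : n * (r / q ^ 2) ^ n / 4 ≤ n * r ^ n / (δ + q ^ n) ^ 2 := by
  have h1 : δ ≤ q ^ n := hN.trans (pow_le_pow_of_le_one hq.le hq1.le hn)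
  have h2 : (δ + q ^ n) ^ 2 ≤ (2 * q ^ n) ^ 2 := by gcongr; linarith
  calc n * (r / q ^ 2) ^ n / 4 = n * r ^ n / (2 * q ^ n) ^ 2 := by
        rw [div_pow]; field_simp; ring
    _ ≤ _ := by gcongr

/-- Up to `N` the `δ` in the denominator is dropped. Beyond `N` the denominator exceeds
`q^{2(N+1)}`, and `m + N + 1 ≤ (N + 1)(m + 1)` separates the tail into its size at the cut and a
series independent of `δ`. -/
theorem resonanceSeries_le (hq : 0 < q) (hr : 0 < r) (hr1 : r < 1) (hδ : 0 < δ) {N : ℕ}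
    (hN : q ^ (N + 1) < δ) :
    resonanceSeries q r δ ≤ ∑ n ∈ Finset.range (N + 1), n * (r / q ^ 2) ^ n +
      (N + 1) * (r / q ^ 2) ^ (N + 1) * ∑' m : ℕ, (m + 1) * r ^ m := by
  have hs := summable_resonanceSeries hq hr hr1 hδ
  have hK : Summable fun m : ℕ => ((m : ℝ) + 1) * r ^ m := by
    have h : Summable fun n : ℕ => (n : ℝ) ^ 1 * r ^ n :=
      summable_pow_mul_geometric_of_norm_lt_one 1 (by rwa [Real.norm_of_nonneg hr.le])
    refine (h.add (summable_geometric_of_lt_one hr.le hr1)).congr fun m => ?_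
    ring
  rw [resonanceSeries, ← hs.sum_add_tsum_nat_add (N + 1), ← tsum_mul_left]
  refine add_le_add (Finset.sum_le_sum fun n _ => ?_) ?_
  · rw [div_pow, ← mul_div_assoc, ← pow_mul, mul_comm 2 n, pow_mul]
    gcongr
    linarith
  · refine ((summable_nat_add_iff (N + 1)).2 hs).tsum_le_tsum (fun m => ?_)
      (hK.mul_left _)
    have hqm : 0 < q ^ (m + (N + 1)) := by positivity
    calc ((m + (N + 1) : ℕ) : ℝ) * r ^ (m + (N + 1)) / (δ + q ^ (m + (N + 1))) ^ 2
        ≤ ((N + 1) * (m + 1)) * r ^ (m + (N + 1)) / (q ^ (N + 1)) ^ 2 := by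
          gcongr
          · push_cast
            have : (0 : ℝ) ≤ N * m := by positivity
            nlinarith
          · linarith
      _ = _ := by
          rw [div_pow, pow_add, ← pow_mul q 2, ← pow_mul q, mul_comm (N + 1) 2]
          ring

/-- `N` is the mode at which `q^N` passes `δ`. The condition `δ < q` ensures `N ≥ 1`, so that `N + 1
≤ 2N` and `N` is comparable with `|log δ|`. -/
theorem exists_nat_of_lt (hq : 0 < q) (hq1 : q < 1) (hδ : 0 < δ) (hδq : δ < q) :
    ∃ N : ℕ, 1 ≤ N ∧ q ^ (N + 1) < δ ∧ δ ≤ q ^ N ∧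
      N * (-Real.log q) ≤ |Real.log δ| ∧ |Real.log δ| ≤ 2 * N * (-Real.log q) := by
  obtain ⟨N, h1, h2⟩ := exists_nat_pow_near_of_lt_one hδ (hδq.trans hq1).le hq hq1
  have hN : 1 ≤ N := by
    by_contra h
    have : N = 0 := by omega
    subst this
    rw [zero_add, pow_one] at h1
    linarith
  have hN' : (1 : ℝ) ≤ N := by exact_mod_cast hN
  have hlog : Real.log q < 0 := Real.log_neg hq hq1
  have l1 := Real.log_lt_log (by positivity) h1
  have l2 := Real.log_le_log hδ h2
  rw [Real.log_pow] at l1 l2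
  push_cast at l1
  rw [abs_of_neg (Real.log_neg hδ (hδq.trans hq1))]
  refine ⟨N, hN, h1, h2, by linarith, by nlinarith⟩

theorem eventually_pos_lt {c : ℝ} (hc : 0 < c) : ∀ᶠ δ in 𝓝[>] (0 : ℝ), 0 < δ ∧ δ < c := by
  filter_upwards [Ioo_mem_nhdsGT hc] with δ hδ using hδ

theorem resonanceSeries_bounds_of_lt (hq : 0 < q) (hq1 : q < 1) (hr : 0 < r) (hr1 : r < 1) {t : ℝ}
    (hrq : r = q ^ 2 * q ^ t) (ht : t < 0) :
    ∃ c C : ℝ, 0 < c ∧ ∀ᶠ δ in 𝓝[>] (0 : ℝ), c * (δ ^ t * |Real.log δ|) ≤ resonanceSeries q r δ ∧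
      resonanceSeries q r δ ≤ C * (δ ^ t * |Real.log δ|) := by
  set y := q ^ t with hy
  have hry : r / q ^ 2 = y := by rw [hrq]; field_simp
  have hy1 : 1 < y := Real.one_lt_rpow_of_pos_of_lt_one_of_neg hq hq1 ht
  have hy0 : 0 < y := by linarith
  set L := -Real.log q with hL
  have hL0 : 0 < L := by have := Real.log_neg hq hq1; linarith
  set K := ∑' m : ℕ, ((m : ℝ) + 1) * r ^ m with hK
  have hK0 : 0 ≤ K := tsum_nonneg fun m => by positivity
  -- Since `y > 1`, the term at `N` alone has the right order. The lower constant combines the `4`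
  -- of the term bound with `δ^t ≤ y^{N+1}` and `|log δ| ≤ 2NL`; the upper one adds the geometric
  -- sum up to `N` and the tail.
  refine ⟨1 / (8 * y * L), (y / (y - 1) + 2 * y * K) / L, by positivity, ?_⟩
  filter_upwards [eventually_pos_lt hq] with δ ⟨hδ, hδq⟩
  obtain ⟨N, hN, h1, h2, h3, h4⟩ := exists_nat_of_lt hq hq1 hδ hδq
  have hN' : (1 : ℝ) ≤ N := by exact_mod_cast hN
  have hpow : ∀ k : ℕ, (q ^ k) ^ t = y ^ k := fun k => by
    rw [hy, ← Real.rpow_natCast, ← Real.rpow_natCast, ← Real.rpow_mul hq.le, ← Real.rpow_mul hq.le, mul_comm]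
  have p1 : y ^ N ≤ δ ^ t := by
    rw [← hpow]
    exact Real.rpow_le_rpow_of_nonpos hδ h2 ht.le
  have p2 : δ ^ t ≤ y ^ (N + 1) := by
    rw [← hpow]
    exact Real.rpow_le_rpow_of_nonpos (by positivity) h1.le ht.le
  have hyN : 0 < y ^ N := by positivity
  constructor
  · have hl := sum_le_resonanceSeries hq hr hr1 hδ {N}
    rw [Finset.sum_singleton] at hl
    refine le_trans ?_ ((mul_pow_le_resonanceSeries_term hq hq1 hr hδ h2 le_rfl).trans hl)
    rw [hry]
    calc 1 / (8 * y * L) * (δ ^ t * |Real.log δ|) ≤ 1 / (8 * y * L) * (y ^ (N + 1) * (2 * N * L)) := by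
          gcongr
      _ = N * y ^ N / 4 := by field_simp; ring
  · refine (resonanceSeries_le hq hr hr1 hδ h1).trans ?_
    rw [hry]
    have hgeo : ∑ n ∈ Finset.range (N + 1), (n : ℝ) * y ^ n ≤ N * (y ^ (N + 1) / (y - 1)) := by
      calc ∑ n ∈ Finset.range (N + 1), (n : ℝ) * y ^ n ≤ ∑ n ∈ Finset.range (N + 1), (N : ℝ) * y ^ n := by
            refine Finset.sum_le_sum fun n hn => ?_
            have : n ≤ N := by have := Finset.mem_range.1 hn; omega
            gcongr
        _ = N * ((y ^ (N + 1) - 1) / (y - 1)) := by rw [← Finset.mul_sum, geom_sum_eq hy1.ne']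
        _ ≤ _ := by
            have : 0 < y - 1 := by linarith
            gcongr
            linarith
    have hy1' : 0 < y - 1 := by linarith
    calc ∑ n ∈ Finset.range (N + 1), (n : ℝ) * y ^ n + (N + 1) * y ^ (N + 1) * K
        ≤ N * (y ^ (N + 1) / (y - 1)) + (2 * N) * y ^ (N + 1) * K := by
          gcongr
          linarith
      _ = (y / (y - 1) + 2 * y * K) / L * (y ^ N * (N * L)) := by
          rw [pow_succ]
          field_simp
      _ ≤ _ := by gcongr

theorem resonanceSeries_bounds_of_eq (hq : 0 < q) (hq1 : q < 1) (hr : 0 < r) (hr1 : r < 1)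
    (hrq : r = q ^ 2) :
    ∃ c C : ℝ, 0 < c ∧ ∀ᶠ δ in 𝓝[>] (0 : ℝ), c * |Real.log δ| ^ 2 ≤ resonanceSeries q r δ ∧
      resonanceSeries q r δ ≤ C * |Real.log δ| ^ 2 := by
  have hry : r / q ^ 2 = 1 := by rw [hrq]; field_simp
  set L := -Real.log q with hL
  have hL0 : 0 < L := by have := Real.log_neg hq hq1; linarith
  set K := ∑' m : ℕ, ((m : ℝ) + 1) * r ^ m with hK
  have hK0 : 0 ≤ K := tsum_nonneg fun m => by positivity
  -- Now all terms up to `N` contribute and their sum is of order `N²`: by `|log δ| ≤ 2NL` the lower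
  -- constant yields at most `N²/8`, below `N(N+1)/8`.
  refine ⟨1 / (32 * L ^ 2), (2 + 2 * K) / L ^ 2, by positivity, ?_⟩
  filter_upwards [eventually_pos_lt hq] with δ ⟨hδ, hδq⟩
  obtain ⟨N, hN, h1, h2, h3, h4⟩ := exists_nat_of_lt hq hq1 hδ hδq
  have hN' : (1 : ℝ) ≤ N := by exact_mod_cast hN
  have hgauss : ∑ n ∈ Finset.range (N + 1), (n : ℝ) = N * (N + 1) / 2 := by
    have h := Finset.sum_range_id_mul_two (N + 1)
    have h' : ((∑ n ∈ Finset.range (N + 1), n : ℕ) : ℝ) * 2 = ((N : ℝ) + 1) * N := by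
      exact_mod_cast h
    push_cast at h'
    linarith
  constructor
  · refine le_trans ?_ (sum_le_resonanceSeries hq hr hr1 hδ (Finset.range (N + 1)))
    calc 1 / (32 * L ^ 2) * |Real.log δ| ^ 2 ≤ 1 / (32 * L ^ 2) * (2 * N * L) ^ 2 := by gcongr
      _ = (N : ℝ) * N / 2 / 4 := by field_simp; norm_num
      _ ≤ (N : ℝ) * (N + 1) / 2 / 4 := by gcongr; linarith
      _ = ∑ n ∈ Finset.range (N + 1), (n : ℝ) * (r / q ^ 2) ^ n / 4 := by
          rw [← hgauss, Finset.sum_div]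
          simp [hry]
      _ ≤ _ := Finset.sum_le_sum fun n hn => mul_pow_le_resonanceSeries_term hq hq1 hr hδ h2
          (by have := Finset.mem_range.1 hn; omega)
  · refine (resonanceSeries_le hq hr hr1 hδ h1).trans ?_
    simp only [hry, one_pow, mul_one, hgauss]
    calc (N : ℝ) * (N + 1) / 2 + (N + 1) * K ≤ 2 * (N : ℝ) ^ 2 + 2 * (N : ℝ) ^ 2 * K := by
          have : (N : ℝ) + 1 ≤ 2 * (N : ℝ) ^ 2 := by nlinarith
          gcongr
          nlinarith
      _ = (2 + 2 * K) / L ^ 2 * (N * L) ^ 2 := by field_simp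
      _ ≤ _ := by gcongr

theorem resonanceSeries_bounds_of_gt (hq : 0 < q) (hr : 0 < r) (hr1 : r < 1) (hrq : r < q ^ 2) :
    ∃ c C : ℝ, 0 < c ∧ ∀ᶠ δ in 𝓝[>] (0 : ℝ), c * 1 ≤ resonanceSeries q r δ ∧
      resonanceSeries q r δ ≤ C * 1 := by
  have hy1 : r / q ^ 2 < 1 := (div_lt_one (by positivity)).2 hrq
  have hy0 : 0 < r / q ^ 2 := by positivity
  have hsum : Summable fun n : ℕ => (n : ℝ) ^ 1 * (r / q ^ 2) ^ n :=
    summable_pow_mul_geometric_of_norm_lt_one 1 (by rwa [Real.norm_of_nonneg hy0.le])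
  refine ⟨r / (1 + q) ^ 2, ∑' n : ℕ, (n : ℝ) ^ 1 * (r / q ^ 2) ^ n, by positivity, ?_⟩
  filter_upwards [eventually_pos_lt one_pos] with δ ⟨hδ, hδ1⟩
  rw [mul_one, mul_one]
  constructor
  · refine le_trans ?_ (sum_le_resonanceSeries hq hr hr1 hδ {1})
    rw [Finset.sum_singleton, Nat.cast_one, one_mul, pow_one, pow_one]
    gcongr
  · refine (summable_resonanceSeries hq hr hr1 hδ).tsum_le_tsum (fun n => ?_) hsum
    rw [pow_one, div_pow, ← mul_div_assoc, ← pow_mul, mul_comm 2 n, pow_mul]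
    gcongr
    linarith

end ResonanceSeries

/-! ### Consequences of comparability for the dissipated energy. -/

theorem Comparable.of_bounds {f g : ℝ → ℝ} {c C : ℝ} (hc : 0 < c)
    (hg : ∀ᶠ δ in 𝓝[>] (0 : ℝ), 0 < g δ)
    (h : ∀ᶠ δ in 𝓝[>] (0 : ℝ), c * g δ ≤ f δ ∧ f δ ≤ C * g δ) : Comparable f g := by
  -- Halving and adding one make the inequalities strict.
  refine ⟨c / 2, C + 1, by positivity, ?_⟩
  filter_upwards [hg, h] with δ hgδ ⟨h1, h2⟩
  rw [lt_div_iff₀ hgδ, div_lt_iff₀ hgδ]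
  constructor <;> nlinarith

theorem Comparable.tendsto_mul_zero {f g : ℝ → ℝ} (h : Comparable f g)
    (hg : ∀ᶠ δ in 𝓝[>] (0 : ℝ), 0 < g δ)
    (h0 : Tendsto (fun δ => δ * g δ) (𝓝[>] 0) (𝓝 0)) :
    Tendsto (fun δ => δ * f δ) (𝓝[>] 0) (𝓝 0) := by
  obtain ⟨C₁, C₂, hC, h⟩ := h
  have h0' := h0.const_mul C₂
  rw [mul_zero] at h0'
  refine squeeze_zero' ?_ ?_ h0'
  · filter_upwards [h, hg, self_mem_nhdsWithin] with δ ⟨h1, _⟩ hgδ hδ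
    have h3 := (lt_div_iff₀ hgδ).1 h1
    have hδ' : (0 : ℝ) < δ := hδ
    have : 0 < f δ := (by positivity : 0 < C₁ * g δ).trans h3
    positivity
  · filter_upwards [h, hg, self_mem_nhdsWithin] with δ ⟨_, h2⟩ hgδ hδ
    have h3 := (div_lt_iff₀ hgδ).1 h2
    have hδ' : (0 : ℝ) < δ := hδ
    nlinarith

theorem Comparable.tendsto_mul_atTop {f g : ℝ → ℝ} (h : Comparable f g)
    (hg : ∀ᶠ δ in 𝓝[>] (0 : ℝ), 0 < g δ)
    (h0 : Tendsto (fun δ => δ * g δ) (𝓝[>] 0) atTop) :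
    Tendsto (fun δ => δ * f δ) (𝓝[>] 0) atTop := by
  obtain ⟨C₁, C₂, hC, h⟩ := h
  refine tendsto_atTop_mono' _ ?_ (h0.const_mul_atTop hC)
  filter_upwards [h, hg, self_mem_nhdsWithin] with δ ⟨h1, _⟩ hgδ hδ
  have h3 := (lt_div_iff₀ hgδ).1 h1
  have hδ' : (0 : ℝ) < δ := hδ
  nlinarith

theorem eventually_rpow_mul_abs_log_pos (t : ℝ) :
    ∀ᶠ δ in 𝓝[>] (0 : ℝ), 0 < δ ^ t * |Real.log δ| := by
  filter_upwards [Ioo_mem_nhdsGT one_pos] with δ hδ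
  have := Real.log_neg hδ.1 hδ.2
  have := abs_pos.2 this.ne
  have := Real.rpow_pos_of_pos hδ.1 t
  positivity

theorem tendsto_abs_log_nhdsGT_zero :
    Tendsto (fun δ : ℝ => |Real.log δ|) (𝓝[>] 0) atTop :=
  tendsto_abs_atBot_atTop.comp Real.tendsto_log_nhdsGT_zero

theorem tendsto_mul_rpow_mul_abs_log_atTop {t : ℝ} (ht : t ≤ -1) :
    Tendsto (fun δ : ℝ => δ * (δ ^ t * |Real.log δ|)) (𝓝[>] 0) atTop := by
  refine tendsto_atTop_mono' _ ?_ tendsto_abs_log_nhdsGT_zero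
  filter_upwards [Ioo_mem_nhdsGT one_pos] with δ hδ
  have h : 1 ≤ δ * δ ^ t := by
    rw [show δ * δ ^ t = δ ^ (1 + t) by rw [Real.rpow_add hδ.1, Real.rpow_one]]
    exact Real.one_le_rpow_of_pos_of_le_one_of_nonpos hδ.1 hδ.2.le (by linarith)
  nlinarith [abs_nonneg (Real.log δ)]

theorem tendsto_mul_rpow_mul_abs_log_zero {t : ℝ} (ht : -1 < t) :
    Tendsto (fun δ : ℝ => δ * (δ ^ t * |Real.log δ|)) (𝓝[>] 0) (𝓝 0) := by
  have h := (tendsto_log_mul_rpow_nhdsGT_zero (show 0 < 1 + t by linarith)).abs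
  rw [abs_zero] at h
  refine h.congr' ?_
  filter_upwards [self_mem_nhdsWithin] with δ hδ
  have hδ' : (0 : ℝ) < δ := hδ
  rw [abs_mul, abs_of_pos (Real.rpow_pos_of_pos hδ' _), Real.rpow_add hδ', Real.rpow_one]
  ring

theorem tendsto_mul_abs_log_sq_zero :
    Tendsto (fun δ : ℝ => δ * |Real.log δ| ^ 2) (𝓝[>] 0) (𝓝 0) := by
  have h := (tendsto_log_mul_rpow_nhdsGT_zero (show (0 : ℝ) < 1 / 2 by norm_num)).pow 2
  rw [zero_pow two_ne_zero] at h
  refine h.congr' ?_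
  filter_upwards [self_mem_nhdsWithin] with δ hδ
  have hδ' : (0 : ℝ) < δ := hδ
  rw [mul_pow, ← Real.sqrt_eq_rpow, Real.sq_sqrt hδ'.le, sq_abs]
  ring

/-! ### The two normalizations of the permittivity. -/

section Permittivity

variable {εm : ℝ} {κ : ℂ} {δ : ℝ}

theorem eq_of_spectralParameter_eq (hδ : 0 < δ)
    (h : spectralParameter κ εm = Complex.I * δ) :
    εm + κ = -(2 * Complex.I * δ) * (εm - κ) ∧ (εm - κ) * (1 - 2 * Complex.I * δ) = 2 * εm := by
  have hδ' : (δ : ℂ) ≠ 0 := by exact_mod_cast hδ.ne'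
  -- For `κ = εm` division by zero would make the spectral parameter `0`, which is not `iδ`.
  have hne : κ - εm ≠ 0 := fun h0 => by
    rw [spectralParameter, h0, mul_zero, div_zero] at h
    exact mul_ne_zero Complex.I_ne_zero hδ' h.symm
  rw [spectralParameter, div_eq_iff (by simpa using hne)] at h
  have h1 : εm + κ = -(2 * Complex.I * δ) * (εm - κ) := by linear_combination h
  exact ⟨h1, by linear_combination -h1⟩

/-- A real `κ` has a real spectral parameter, even in the degenerate case `κ = εm`, whereas `iδ` is
not real. -/
theorem im_ne_zero_of_permittivity (hδ : 0 < δ)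
    (h : κ = -(εm : ℂ) + Complex.I * δ ∨ spectralParameter κ εm = Complex.I * δ) : κ.im ≠ 0 := by
  rcases h with rfl | h
  · simpa using hδ.ne'
  · intro h0
    have e : κ = (κ.re : ℂ) := Complex.ext rfl (by simp [h0])
    have him := congrArg Complex.im h
    rw [e, spectralParameter, ← Complex.ofReal_add, ← Complex.ofReal_sub,
      show (2 : ℂ) * ((κ.re - εm : ℝ) : ℂ) = ((2 * (κ.re - εm) : ℝ) : ℂ) by push_cast; ring,
      ← Complex.ofReal_div, Complex.ofReal_im] at him
    simp at him
    exact hδ.ne him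

theorem le_norm_add_mul_I {x y : ℝ} : (|x| + |y|) / 2 ≤ ‖(x + y * Complex.I : ℂ)‖ := by
  have h1 := Complex.abs_re_le_norm (x + y * Complex.I)
  have h2 := Complex.abs_im_le_norm (x + y * Complex.I)
  simp at h1 h2
  linarith

theorem norm_add_mul_I_le {x y : ℝ} : ‖(x + y * Complex.I : ℂ)‖ ≤ |x| + |y| := by
  have h := Complex.norm_le_abs_re_add_abs_im (x + y * Complex.I)
  simpa using h

/-- Lower and upper bounds for the denominators of the coefficients of the field in the ellipse. -/
theorem exists_norm_den_bounds (hεm : 0 < εm) {q : ℝ} (hq1 : q < 1) :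
    ∃ c C : ℝ, 0 < c ∧ 0 < C ∧ ∀ (κ : ℂ) (δ : ℝ), 0 < δ → δ ≤ 1 →
      (κ = -(εm : ℂ) + Complex.I * δ ∨ spectralParameter κ εm = Complex.I * δ) →
      ∀ X : ℝ, 0 < X → X ≤ q →
        (c * (δ + X) ≤ ‖εm + κ + (εm - κ) * X‖ ∧ ‖εm + κ + (εm - κ) * X‖ ≤ C * (δ + X)) ∧
        (c * (δ + X) ≤ ‖εm + κ - (εm - κ) * X‖ ∧ ‖εm + κ - (εm - κ) * X‖ ≤ C * (δ + X)) := by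
  -- For `κ = -εm + iδ` the bounds `(1 - q)/2` and `1/2` serve the imaginary parts `δ(1 ∓ X)`, and
  -- `εm/3` the real parts `±2εm X`. In the other normalization `εm/3` alone suffices.
  obtain ⟨c, hc0, hc1, hc2, hc3⟩ : ∃ c : ℝ, 0 < c ∧ c ≤ (1 - q) / 2 ∧ c ≤ 1 / 2 ∧ c ≤ εm / 3 :=
    ⟨min ((1 - q) / 2) (min (1 / 2) (εm / 3)), by
      have : 0 < 1 - q := by linarith
      positivity, min_le_left _ _, (min_le_right _ _).trans (min_le_left _ _),
      (min_le_right _ _).trans (min_le_right _ _)⟩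
  refine ⟨c, 2 + 4 * εm, hc0, by positivity, fun κ δ hδ hδ1 h X hX hXq => ?_⟩
  rcases h with rfl | h
  · have e1 : (εm : ℂ) + (-(εm : ℂ) + Complex.I * δ) + (εm - (-(εm : ℂ) + Complex.I * δ)) * X =
        ((2 * εm * X : ℝ) : ℂ) + ((δ * (1 - X) : ℝ) : ℂ) * Complex.I := by push_cast; ring
    have e2 : (εm : ℂ) + (-(εm : ℂ) + Complex.I * δ) - (εm - (-(εm : ℂ) + Complex.I * δ)) * X =
        ((-(2 * εm * X) : ℝ) : ℂ) + ((δ * (1 + X) : ℝ) : ℂ) * Complex.I := by push_cast; ring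
    have a1 : |2 * εm * X| = 2 * εm * X := abs_of_pos (by positivity)
    have a2 : |δ * (1 - X)| = δ * (1 - X) := abs_of_nonneg (mul_nonneg hδ.le (by linarith))
    have a3 : |δ * (1 + X)| = δ * (1 + X) := abs_of_pos (by positivity)
    have l1 := @le_norm_add_mul_I (2 * εm * X) (δ * (1 - X))
    have u1 := @norm_add_mul_I_le (2 * εm * X) (δ * (1 - X))
    have l2 := @le_norm_add_mul_I (-(2 * εm * X)) (δ * (1 + X))
    have u2 := @norm_add_mul_I_le (-(2 * εm * X)) (δ * (1 + X))
    rw [abs_neg] at l2 u2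
    rw [a1, a2] at l1 u1
    rw [a1, a3] at l2 u2
    rw [e1, e2]
    have m1 : c * δ ≤ (1 - q) / 2 * δ := by gcongr
    have m2 : c * δ ≤ 1 / 2 * δ := by gcongr
    have m3 : c * X ≤ εm / 3 * X := by gcongr
    have m4 : δ * X ≤ δ * q := by gcongr
    have m5 : 0 < δ * X := by positivity
    have m6 : 0 < εm * X := by positivity
    have m7 : 0 < εm * δ := by positivity
    have m8 : δ * X ≤ δ * 1 := by gcongr; linarith
    refine ⟨⟨by linarith, by linarith⟩, by linarith, by linarith⟩
  · obtain ⟨h1, h2⟩ := eq_of_spectralParameter_eq hδ h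
    set τ : ℂ := εm - κ with hτ
    have e1 : (εm : ℂ) + κ + τ * X = τ * ((X : ℂ) + ((-(2 * δ) : ℝ) : ℂ) * Complex.I) := by
      rw [h1]; push_cast; ring
    have e2 : (εm : ℂ) + κ - τ * X = τ * (((-X : ℝ) : ℂ) + ((-(2 * δ) : ℝ) : ℂ) * Complex.I) := by
      rw [h1]; push_cast; ring
    -- The factor `1 - 2iδ` has modulus between `1` and `3` because `δ ≤ 1`, so `‖τ‖` lies between
    -- `2εm/3` and `2εm`.
    have hn : ‖τ‖ * ‖((1 : ℝ) : ℂ) + ((-(2 * δ) : ℝ) : ℂ) * Complex.I‖ = 2 * εm := by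
      rw [← norm_mul, show τ * (((1 : ℝ) : ℂ) + ((-(2 * δ) : ℝ) : ℂ) * Complex.I) = 2 * εm by
        rw [← h2]; push_cast; ring]
      simp [abs_of_pos hεm]
    have b1 : 1 ≤ ‖((1 : ℝ) : ℂ) + ((-(2 * δ) : ℝ) : ℂ) * Complex.I‖ := by
      have := Complex.abs_re_le_norm (((1 : ℝ) : ℂ) + ((-(2 * δ) : ℝ) : ℂ) * Complex.I)
      simpa using this
    have b2 := @norm_add_mul_I_le 1 (-(2 * δ))
    have a0 : |(-(2 * δ))| = 2 * δ := by rw [abs_neg, abs_of_pos (by positivity)]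
    rw [a0, abs_one] at b2
    have t1 : ‖τ‖ ≤ 2 * εm := by nlinarith [norm_nonneg τ]
    have t2 : 2 * εm / 3 ≤ ‖τ‖ := by nlinarith [norm_nonneg τ]
    have l1 := @le_norm_add_mul_I X (-(2 * δ))
    have u1 := @norm_add_mul_I_le X (-(2 * δ))
    have l2 := @le_norm_add_mul_I (-X) (-(2 * δ))
    have u2 := @norm_add_mul_I_le (-X) (-(2 * δ))
    rw [abs_neg X] at l2 u2
    rw [a0, abs_of_pos hX] at l1 u1 l2 u2
    rw [e1, e2, norm_mul, norm_mul]
    have key1 : ∀ r : ℝ, (X + 2 * δ) / 2 ≤ r → c * (δ + X) ≤ ‖τ‖ * r := fun r hr => by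
      calc c * (δ + X) ≤ εm / 3 * (δ + X) := by gcongr
        _ ≤ 2 * εm / 3 * ((X + 2 * δ) / 2) := by nlinarith
        _ ≤ _ := by gcongr
    have key2 : ∀ r : ℝ, 0 ≤ r → r ≤ X + 2 * δ → ‖τ‖ * r ≤ (2 + 4 * εm) * (δ + X) := fun r h0 hr => by
      calc ‖τ‖ * r ≤ 2 * εm * (X + 2 * δ) := by gcongr
        _ ≤ _ := by nlinarith
    exact ⟨⟨key1 _ l1, key2 _ (norm_nonneg _) u1⟩, key1 _ l2, key2 _ (norm_nonneg _) u2⟩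

end Permittivity

/-! ### Energy bounds and the conclusion. -/

theorem sinh_bounds {x q : ℝ} (hq : Real.exp (-(2 * x)) ≤ q) :
    (1 - q) / 2 * Real.exp x ≤ Real.sinh x ∧ Real.sinh x ≤ Real.exp x / 2 := by
  have h : Real.exp (-x) = Real.exp (-(2 * x)) * Real.exp x := by rw [← Real.exp_add]; ring_nf
  rw [Real.sinh_eq]
  have := Real.exp_pos x
  have := Real.exp_pos (-x)
  constructor
  · rw [h]
    nlinarith
  · linarith

theorem norm_dipoleCoeff_sq (R : ℝ) (A ζz : ℂ) {n : ℕ} (hn : n ≠ 0) :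
    (dipoleCoeff R A ζz n).re ^ 2 + (dipoleCoeff R A ζz n).im ^ 2 =
      ‖-2 * A / (R * Complex.sinh ζz)‖ ^ 2 * Real.exp (-(2 * (n * ζz.re))) := by
  rw [sq, sq, ← Complex.normSq_apply, Complex.normSq_eq_norm_sq, dipoleCoeff, if_neg hn, one_mul, norm_mul, mul_pow, Complex.norm_exp,
    ← Real.exp_nat_mul]
  congr 2
  simp

/-- Two-sided comparison of the energy with the resonance series. -/
theorem exists_energy_bounds {R ρ₀ ρz ωz εm : ℝ} (hR : 0 < R) (hρ₀ : 0 < ρ₀) (hρz : ρ₀ < ρz)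
    (hεm : 0 < εm) {a : Plane} (ha : a ≠ 0) :
    ∃ c C : ℝ, 0 < c ∧ 0 < C ∧ ∀ (κ : ℂ) (δ : ℝ), 0 < δ → δ ≤ 1 →
      (κ = -(εm : ℂ) + Complex.I * δ ∨ spectralParameter κ εm = Complex.I * δ) →
      ∀ u : Plane → ℂ, IsDipoleSolution R ρ₀ κ εm a (ellipticPoint R ρz ωz) u →
        c * resonanceSeries (Real.exp (-(2 * ρ₀))) (Real.exp (-(2 * (ρz - ρ₀)))) δ ≤
          gradL2Sq (ellipseDomain R ρ₀) u ∧
        gradL2Sq (ellipseDomain R ρ₀) u ≤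
          C * resonanceSeries (Real.exp (-(2 * ρ₀))) (Real.exp (-(2 * (ρz - ρ₀)))) δ := by
  set q := Real.exp (-(2 * ρ₀)) with hq
  set r := Real.exp (-(2 * (ρz - ρ₀))) with hr
  have hq0 : 0 < q := Real.exp_pos _
  have hq1 : q < 1 := Real.exp_lt_one_iff.mpr (by linarith)
  have hr0 : 0 < r := Real.exp_pos _
  have hr1 : r < 1 := Real.exp_lt_one_iff.mpr (by linarith)
  obtain ⟨c, C, hc, hC, hden⟩ := exists_norm_den_bounds hεm hq1
  have hπ := Real.pi_pos
  set ζz : ℂ := ρz + ωz * Complex.I with hζz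
  have hre : ζz.re = ρz := by simp [hζz]
  set A : ℂ := planeToComplex a / (2 * Real.pi * εm) with hA
  set D : ℝ := ‖-2 * A / (R * Complex.sinh ζz)‖ ^ 2 with hD
  have hD0 : 0 < D := by
    have h1 : planeToComplex a ≠ 0 := fun h => ha (by simpa using h)
    have h2 : Complex.sinh ζz ≠ 0 := sinh_ne_zero_of_re_pos (by rw [hre]; linarith)
    have h3 : (R : ℂ) ≠ 0 := by exact_mod_cast hR.ne'
    have h4 : (Real.pi : ℂ) ≠ 0 := by exact_mod_cast hπ.ne'
    have h5 : (εm : ℂ) ≠ 0 := by exact_mod_cast hεm.ne'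
    have : -2 * A / (R * Complex.sinh ζz) ≠ 0 := by
      rw [hA]
      simp [h1, h2, h3, h4, h5]
    positivity
  have hq4 : 0 < 1 - q ^ 2 := by nlinarith
  refine ⟨2 * Real.pi * εm ^ 2 * ((1 - q ^ 2) / 2 * D / C ^ 2),
    2 * Real.pi * εm ^ 2 * (1 / 2 * D / c ^ 2), by positivity, by positivity,
    fun κ δ hδ hδ1 hκ u hu => ?_⟩
  have hE := (hu.energy hR hρ₀ hρz hεm (im_ne_zero_of_permittivity hδ hκ) rfl).2
  have hS := (summable_resonanceSeries hq0 hr0 hr1 hδ).hasSum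
  -- Both determinant factors are comparable with the same `δ + q^n`, so the squared real and
  -- imaginary parts recombine into `|β n|²`. The phase of the dipole coefficient plays no role.
  have key : ∀ n : ℕ, n ≠ 0 → ∀ P Q : ℝ,
      (c * (δ + q ^ n) ≤ P ∧ P ≤ C * (δ + q ^ n)) → (c * (δ + q ^ n) ≤ Q ∧ Q ≤ C * (δ + q ^ n)) →
      (1 - q ^ 2) / 2 * D / C ^ 2 * (n * r ^ n / (δ + q ^ n) ^ 2) ≤ n * Real.sinh (2 * n * ρ₀) *
        ((dipoleCoeff R A ζz n).re ^ 2 / P ^ 2 + (dipoleCoeff R A ζz n).im ^ 2 / Q ^ 2) ∧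
      n * Real.sinh (2 * n * ρ₀) *
        ((dipoleCoeff R A ζz n).re ^ 2 / P ^ 2 + (dipoleCoeff R A ζz n).im ^ 2 / Q ^ 2) ≤
        1 / 2 * D / c ^ 2 * (n * r ^ n / (δ + q ^ n) ^ 2) := by
    intro n hn P Q hP hQ
    have hX : 0 < δ + q ^ n := by positivity
    have hn1 : (1 : ℝ) ≤ n := by exact_mod_cast Nat.one_le_iff_ne_zero.2 hn
    have hβ := norm_dipoleCoeff_sq R A ζz hn
    rw [hre, ← hD] at hβ
    set x := (dipoleCoeff R A ζz n).re
    set y := (dipoleCoeff R A ζz n).im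
    have hcX : 0 < c * (δ + q ^ n) := by positivity
    have hP0 : 0 < P := hcX.trans_le hP.1
    have hQ0 : 0 < Q := hcX.trans_le hQ.1
    obtain ⟨s1, s2⟩ := sinh_bounds (x := 2 * n * ρ₀) (q := q ^ 2) (by
      rw [hq, ← Real.exp_nat_mul]
      refine Real.exp_le_exp.2 ?_
      push_cast
      nlinarith)
    -- The growth `e^{2nρ₀}` of the hyperbolic sine and the decay `e^{-2nρz}` of the squared
    -- coefficient combine into `r^n`.
    have hrn : r ^ n = Real.exp (2 * n * ρ₀) * Real.exp (-(2 * (n * ρz))) := by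
      rw [hr, ← Real.exp_nat_mul, ← Real.exp_add]
      ring_nf
    have hs0 : 0 ≤ Real.sinh (2 * n * ρ₀) := Real.sinh_nonneg_iff.2 (by positivity)
    constructor
    · calc (1 - q ^ 2) / 2 * D / C ^ 2 * (n * r ^ n / (δ + q ^ n) ^ 2)
          = n * ((1 - q ^ 2) / 2 * Real.exp (2 * n * ρ₀)) *
            ((x ^ 2 + y ^ 2) / (C * (δ + q ^ n)) ^ 2) := by
            rw [hβ, hrn]
            field_simp
        _ ≤ n * Real.sinh (2 * n * ρ₀) * (x ^ 2 / P ^ 2 + y ^ 2 / Q ^ 2) := by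
            rw [add_div]
            have := hP.2
            have := hQ.2
            gcongr
    · calc n * Real.sinh (2 * n * ρ₀) * (x ^ 2 / P ^ 2 + y ^ 2 / Q ^ 2)
          ≤ n * (Real.exp (2 * n * ρ₀) / 2) * ((x ^ 2 + y ^ 2) / (c * (δ + q ^ n)) ^ 2) := by
            rw [add_div]
            have := hP.1
            have := hQ.1
            gcongr
        _ = _ := by
            rw [hβ, hrn]
            field_simp
  have hb : ∀ n : ℕ, n ≠ 0 →
      (c * (δ + q ^ n) ≤ ‖εm + κ + (εm - κ) * Real.exp (-(2 * ρ₀) * n)‖ ∧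
        ‖εm + κ + (εm - κ) * Real.exp (-(2 * ρ₀) * n)‖ ≤ C * (δ + q ^ n)) ∧
      (c * (δ + q ^ n) ≤ ‖εm + κ - (εm - κ) * Real.exp (-(2 * ρ₀) * n)‖ ∧
        ‖εm + κ - (εm - κ) * Real.exp (-(2 * ρ₀) * n)‖ ≤ C * (δ + q ^ n)) := fun n hn => by
    have e : Real.exp (-(2 * ρ₀) * n) = q ^ n := by rw [hq, ← Real.exp_nat_mul, mul_comm]
    rw [e]
    exact hden κ δ hδ hδ1 hκ _ (by positivity) (pow_le_of_le_one hq0.le hq1.le hn)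
  constructor
  · refine hasSum_le (fun n => ?_) (hS.mul_left _) hE
    rcases eq_or_ne n 0 with rfl | hn
    · simp
    · rw [mul_assoc (2 * Real.pi * εm ^ 2)]
      exact mul_le_mul_of_nonneg_left (key n hn _ _ (hb n hn).1 (hb n hn).2).1 (by positivity)
  · refine hasSum_le (fun n => ?_) hE (hS.mul_left _)
    rcases eq_or_ne n 0 with rfl | hn
    · simp
    · rw [mul_assoc (2 * Real.pi * εm ^ 2)]
      exact mul_le_mul_of_nonneg_left (key n hn _ _ (hb n hn).1 (hb n hn).2).2 (by positivity)

theorem mainTheorem1 (R ρ₀ ρz ωz εm : ℝ) (hR : 0 < R) (hρ₀ : 0 < ρ₀) (hρz : ρ₀ < ρz)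
    (hεm : 0 < εm) (a : Plane) (ha : a ≠ 0) (κ : ℝ → ℂ)
    (hκ : (∀ δ : ℝ, 0 < δ → κ δ = -(εm : ℂ) + Complex.I * δ) ∨
      (∀ δ : ℝ, 0 < δ → spectralParameter (κ δ) εm = Complex.I * δ)) :
    (∀ δ : ℝ, 0 < δ →
      (∃ u : Plane → ℂ, IsDipoleSolution R ρ₀ (κ δ) εm a (ellipticPoint R ρz ωz) u) ∧
      ∀ u v : Plane → ℂ, IsDipoleSolution R ρ₀ (κ δ) εm a (ellipticPoint R ρz ωz) u →
        IsDipoleSolution R ρ₀ (κ δ) εm a (ellipticPoint R ρz ωz) v →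
        Set.EqOn u v {ellipticPoint R ρz ωz}ᶜ) ∧
    ∀ u : ℝ → Plane → ℂ,
      (∀ δ : ℝ, 0 < δ →
        IsDipoleSolution R ρ₀ (κ δ) εm a (ellipticPoint R ρz ωz) (u δ)) →
      (∀ δ : ℝ, 0 < δ → MeasureTheory.IntegrableOn (gradSq (u δ)) (ellipseDomain R ρ₀)) ∧
      (ρz < 3 * ρ₀ →
        Comparable (fun δ => gradL2Sq (ellipseDomain R ρ₀) (u δ))
          (fun δ => δ ^ (-3 + ρz / ρ₀) * |Real.log δ|)) ∧
      (ρz = 3 * ρ₀ →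
        Comparable (fun δ => gradL2Sq (ellipseDomain R ρ₀) (u δ))
          (fun δ => |Real.log δ| ^ 2)) ∧
      (3 * ρ₀ < ρz →
        Comparable (fun δ => gradL2Sq (ellipseDomain R ρ₀) (u δ)) (fun _ => 1)) ∧
      (Tendsto (fun δ => δ * gradL2Sq (ellipseDomain R ρ₀) (u δ)) (𝓝[>] 0) atTop ↔
        ρz ≤ 2 * ρ₀) ∧
      (2 * ρ₀ < ρz →
        Tendsto (fun δ => δ * gradL2Sq (ellipseDomain R ρ₀) (u δ)) (𝓝[>] 0) (𝓝 0)) := by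
  have hκ' : ∀ δ : ℝ, 0 < δ →
      (κ δ = -(εm : ℂ) + Complex.I * δ ∨ spectralParameter (κ δ) εm = Complex.I * δ) :=
    fun δ hδ => hκ.imp (fun h => h δ hδ) (fun h => h δ hδ)
  have him : ∀ δ : ℝ, 0 < δ → (κ δ).im ≠ 0 := fun δ hδ => im_ne_zero_of_permittivity hδ (hκ' δ hδ)
  refine ⟨fun δ hδ => ⟨⟨_, isDipoleSolution_planeSolution hR hρ₀ hρz hεm a (him δ hδ)⟩,
    fun u v hu hv => IsDipoleSolution.eqOn hR hρ₀ hρz hεm (him δ hδ) hu hv⟩, fun u hu => ?_⟩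
  obtain ⟨c₁, C₁, hc₁, hC₁, hE⟩ := exists_energy_bounds (ωz := ωz) hR hρ₀ hρz hεm ha
  set q := Real.exp (-(2 * ρ₀)) with hq
  set r := Real.exp (-(2 * (ρz - ρ₀))) with hr
  have hq0 : 0 < q := Real.exp_pos _
  have hq1 : q < 1 := Real.exp_lt_one_iff.mpr (by linarith)
  have hr0 : 0 < r := Real.exp_pos _
  have hr1 : r < 1 := Real.exp_lt_one_iff.mpr (by linarith)
  have hq2 : q ^ 2 = Real.exp (-(4 * ρ₀)) := by
    rw [hq, ← Real.exp_nat_mul]; push_cast; ring_nf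
  have lift : ∀ g : ℝ → ℝ, (∀ᶠ δ in 𝓝[>] (0 : ℝ), 0 < g δ) →
      (∃ c C : ℝ, 0 < c ∧ ∀ᶠ δ in 𝓝[>] (0 : ℝ), c * g δ ≤ resonanceSeries q r δ ∧
        resonanceSeries q r δ ≤ C * g δ) →
      Comparable (fun δ => gradL2Sq (ellipseDomain R ρ₀) (u δ)) g := by
    rintro g hg ⟨c, C, hc, h⟩
    refine Comparable.of_bounds (c := c₁ * c) (C := C₁ * C) (by positivity) hg ?_
    filter_upwards [h, eventually_pos_lt one_pos] with δ ⟨h1, h2⟩ ⟨hδ, hδ1⟩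
    obtain ⟨e1, e2⟩ := hE (κ δ) δ hδ hδ1.le (hκ' δ hδ) (u δ) (hu δ hδ)
    rw [mul_assoc, mul_assoc]
    exact ⟨(mul_le_mul_of_nonneg_left h1 hc₁.le).trans e1,
      e2.trans (mul_le_mul_of_nonneg_left h2 hC₁.le)⟩
  have hlog : ∀ᶠ δ in 𝓝[>] (0 : ℝ), 0 < |Real.log δ| ^ 2 := by
    filter_upwards [eventually_pos_lt one_pos] with δ ⟨hδ, hδ1⟩
    have := abs_pos.2 (Real.log_neg hδ hδ1).ne
    positivity
  have hone : ∀ᶠ δ in 𝓝[>] (0 : ℝ), 0 < (fun _ : ℝ => (1 : ℝ)) δ := by simp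
  have hlt : ρz < 3 * ρ₀ → Comparable (fun δ => gradL2Sq (ellipseDomain R ρ₀) (u δ))
      (fun δ => δ ^ (-3 + ρz / ρ₀) * |Real.log δ|) := fun h => by
    refine lift _ (eventually_rpow_mul_abs_log_pos _)
      (resonanceSeries_bounds_of_lt hq0 hq1 hr0 hr1 ?_ ?_)
    -- The exponent is determined by `r / q² = e^{-2(ρz - 3ρ₀)} = q^t`, that is, `t = -3 + ρz/ρ₀`.
    · rw [hq2, hq, hr, ← Real.exp_mul, ← Real.exp_add]
      congr 1
      field_simp
      ring
    · have := (div_lt_iff₀ hρ₀).2 h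
      linarith
  have heq : ρz = 3 * ρ₀ → Comparable (fun δ => gradL2Sq (ellipseDomain R ρ₀) (u δ))
      (fun δ => |Real.log δ| ^ 2) := fun h => by
    refine lift _ hlog (resonanceSeries_bounds_of_eq hq0 hq1 hr0 hr1 ?_)
    rw [hq2, hr, h]
    ring_nf
  have hgt : 3 * ρ₀ < ρz → Comparable (fun δ => gradL2Sq (ellipseDomain R ρ₀) (u δ))
      (fun _ => 1) := fun h => by
    refine lift _ hone (resonanceSeries_bounds_of_gt hq0 hr0 hr1 ?_)
    rw [hq2, hr]
    exact Real.exp_lt_exp.2 (by linarith)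
  have hzero : 2 * ρ₀ < ρz →
      Tendsto (fun δ => δ * gradL2Sq (ellipseDomain R ρ₀) (u δ)) (𝓝[>] 0) (𝓝 0) := fun h => by
    rcases lt_trichotomy ρz (3 * ρ₀) with h3 | h3 | h3
    · refine (hlt h3).tendsto_mul_zero (eventually_rpow_mul_abs_log_pos _)
        (tendsto_mul_rpow_mul_abs_log_zero ?_)
      have := (lt_div_iff₀ hρ₀).2 h
      linarith
    · exact (heq h3).tendsto_mul_zero hlog tendsto_mul_abs_log_sq_zero
    · refine (hgt h3).tendsto_mul_zero hone ?_
      simp only [mul_one]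
      exact tendsto_nhdsWithin_of_tendsto_nhds tendsto_id
  refine ⟨fun δ hδ => ((hu δ hδ).energy hR hρ₀ hρz hεm (him δ hδ) rfl).1, hlt, heq, hgt,
    ⟨fun h => ?_, fun h => ?_⟩, hzero⟩
  -- Beyond `2ρ₀` the product tends to `0`, so it cannot tend to infinity.
  · by_contra! h2
    exact not_tendsto_nhds_of_tendsto_atTop h 0 (hzero h2)
  -- Here `ρz ≤ 2ρ₀ < 3ρ₀` and the exponent is at most `-1`; at equality the logarithm alone
  -- produces the divergence.
  · refine (hlt (by linarith)).tendsto_mul_atTop (eventually_rpow_mul_abs_log_pos _)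
      (tendsto_mul_rpow_mul_abs_log_atTop ?_)
    have := (div_le_iff₀ hρ₀).2 h
    linarith
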